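/- Work on the word RAM with words of $w=\Omega(\log(n+m))$ bits (unit-cost arithmetic, logical, shift, comparison and memory operations on words). For every unweighted directed multigraph $G$ with $n$ vertices and $m$ edges, and all vertices $s\neq t$ such that the size $\lambda$ of an $(s,t)$-min-cut (a smallest set of edges whose removal leaves no path from $s$ to $t$) satisfies $\lambda\geq 1$, there is a dual fault-tolerant min-cut oracle: a data structure of $O(\lambda n)$ words from which, given any set $F$ of two edges of $G$, the size of an $(s,t)$-min-cut of $G-F$ is reported in $O(1)$ time. Furthermore, given any such $F$, the oracle reports in $O(n)$ time the partition $(A,V\setminus A)$ of an $(s,t)$-min-cut of $G-F$, that is, a set $A$ with $s\in A$ and $t\notin A$ such that the edges of $G-F$ leading from $A$ to $V\setminus A$ form an $(s,t)$-min-cut of $G-F$. The query algorithms and the constants hidden in the $O$- and $\Omega$-notation do not depend on $G$, $s$, $t$ or $w$. -/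

import Mathlib

/-! ## Directed multigraphs, cuts and minimum cuts -/

/-- A directed multigraph with vertex type `V` and edge type `E`; parallel edges and loops are
allowed. Edges are unweighted. -/
structure MultiDigraph (V E : Type) where
  /-- the vertex that an edge leaves -/
  tail : E → V
  /-- the vertex that an edge enters -/
  head : E → V

namespace MultiDigraph

variable {V E : Type}

/-- There is an edge from `u` to `v`. -/
def Adj (G : MultiDigraph V E) (u v : V) : Prop :=
  ∃ e : E, G.tail e = u ∧ G.head e = v

/-- There is a directed path from `u` to `v`. -/
def Reachable (G : MultiDigraph V E) (u v : V) : Prop :=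
  Relation.ReflTransGen G.Adj u v

/-- The graph `G - F`. -/
def delete (G : MultiDigraph V E) (F : Finset E) : MultiDigraph V {e : E // e ∉ F} where
  tail e := G.tail e.1
  head e := G.head e.1

/-- `C` is an `(s,t)`-cut: there is no path from `s` to `t` in `G - C`. -/
def IsCut (G : MultiDigraph V E) (s t : V) (C : Finset E) : Prop :=
  ¬ (G.delete C).Reachable s t

/-- `C` is an `(s,t)`-min-cut: an `(s,t)`-cut with the smallest number of edges. -/
def IsMinCut (G : MultiDigraph V E) (s t : V) (C : Finset E) : Prop :=
  G.IsCut s t C ∧ ∀ C' : Finset E, G.IsCut s t C' → C.card ≤ C'.card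

/-- The size of an `(s,t)`-min-cut (used for finite `E` and `s ≠ t`, where cuts exist). -/
noncomputable def minCut (G : MultiDigraph V E) (s t : V) : ℕ :=
  sInf {k : ℕ | ∃ C : Finset E, G.IsCut s t C ∧ C.card = k}

/-- `(A, Aᶜ)` is the partition of an `(s,t)`-min-cut: `s` is in `A`, `t` is not, and the edges
that lead from `A` to its complement form an `(s,t)`-min-cut. -/
def IsMinCutPartition (G : MultiDigraph V E) (s t : V) (A : Set V) : Prop :=
  s ∈ A ∧ t ∉ A ∧
    ∃ C : Finset E, (∀ e : E, e ∈ C ↔ G.tail e ∈ A ∧ G.head e ∉ A) ∧ G.IsMinCut s t C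

end MultiDigraph

/-! ## The word RAM

Words have `w` bits. A program has registers, a read-only array of words (the stored data
structure) and a random-access work memory, whose addresses are words. Programs are written
without reference to `w`. Every instruction, and every evaluation of the condition of a branch
or a loop, takes one unit of time. -/

namespace WordRAM

/-- The binary operations of the machine. -/
inductive Op where
  | add | sub | mul | div | mod | and | or | xor | shl | shr | eq | lt

/-- Arithmetic is unsigned and modulo `2 ^ w`; a comparison returns `1` or `0`. -/
def Op.eval {w : ℕ} (o : Op) (x y : BitVec w) : BitVec w :=
  match o with
  | .add => x + y
  | .sub => x - y
  | .mul => x * y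
  | .div => x / y
  | .mod => x % y
  | .and => x &&& y
  | .or => x ||| y
  | .xor => x ^^^ y
  | .shl => x <<< y.toNat
  | .shr => x >>> y.toNat
  | .eq => if x = y then 1 else 0
  | .lt => if x.toNat < y.toNat then 1 else 0

/-- Programs; `r`, `a`, `b`, `c` are names of registers. -/
inductive Prog where
  /-- do nothing -/
  | skip
  /-- `r := k` for a literal `k` -/
  | const (r : ℕ) (k : ℕ)
  /-- `r := a o b` -/
  | op (o : Op) (r a b : ℕ)
  /-- `r := data[a]` -/
  | read (r a : ℕ)
  /-- `r := mem[a]` -/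
  | load (r a : ℕ)
  /-- `mem[a] := b` -/
  | store (a b : ℕ)
  /-- first `p`, then `q` -/
  | seq (p q : Prog)
  /-- `p` if the content of `c` is not zero, and `q` otherwise -/
  | cond (c : ℕ) (p q : Prog)
  /-- repeat `p` as long as the content of `c` is not zero -/
  | loop (c : ℕ) (p : Prog)

/-- Contents of the registers and of the work memory. -/
structure State (w : ℕ) where
  reg : ℕ → BitVec w
  mem : BitVec w → BitVec w

/-- The state after writing `x` into register `r`. -/
def State.setReg {w : ℕ} (σ : State w) (r : ℕ) (x : BitVec w) : State w :=
  { σ with reg := Function.update σ.reg r x }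

/-- The state after writing `x` into the memory cell with address `a`. -/
def State.setMem {w : ℕ} (σ : State w) (a x : BitVec w) : State w :=
  { σ with mem := Function.update σ.mem a x }

/-- `Exec D p σ k τ`: with the stored array `D`, the program `p` started in the state `σ` halts
after exactly `k` units of time in the state `τ`. Reading `D` past its end gives `0`. -/
inductive Exec {w : ℕ} (D : List (BitVec w)) : Prog → State w → ℕ → State w → Prop where
  | skip (σ : State w) : Exec D .skip σ 1 σ
  | const (r k : ℕ) (σ : State w) :
      Exec D (.const r k) σ 1 (σ.setReg r (BitVec.ofNat w k))
  | op (o : Op) (r a b : ℕ) (σ : State w) :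
      Exec D (.op o r a b) σ 1 (σ.setReg r (o.eval (σ.reg a) (σ.reg b)))
  | read (r a : ℕ) (σ : State w) :
      Exec D (.read r a) σ 1 (σ.setReg r (D.getD (σ.reg a).toNat 0))
  | load (r a : ℕ) (σ : State w) :
      Exec D (.load r a) σ 1 (σ.setReg r (σ.mem (σ.reg a)))
  | store (a b : ℕ) (σ : State w) :
      Exec D (.store a b) σ 1 (σ.setMem (σ.reg a) (σ.reg b))
  | seq {p q : Prog} {σ ρ τ : State w} {i j : ℕ}
      (hp : Exec D p σ i ρ) (hq : Exec D q ρ j τ) : Exec D (.seq p q) σ (i + j) τ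
  | cond_true {c : ℕ} {p q : Prog} {σ τ : State w} {i : ℕ}
      (hc : σ.reg c ≠ 0) (hp : Exec D p σ i τ) : Exec D (.cond c p q) σ (i + 1) τ
  | cond_false {c : ℕ} {p q : Prog} {σ τ : State w} {i : ℕ}
      (hc : σ.reg c = 0) (hq : Exec D q σ i τ) : Exec D (.cond c p q) σ (i + 1) τ
  | loop_true {c : ℕ} {p : Prog} {σ ρ τ : State w} {i j : ℕ}
      (hc : σ.reg c ≠ 0) (hp : Exec D p σ i ρ) (hl : Exec D (.loop c p) ρ j τ) :
      Exec D (.loop c p) σ (i + j + 1) τ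
  | loop_false {c : ℕ} {p : Prog} {σ : State w}
      (hc : σ.reg c = 0) : Exec D (.loop c p) σ 1 σ

end WordRAM

/-! ## Dual fault-tolerant min-cut oracles -/

/-- Vertices and edges are named by the numbers `0, …, n - 1` and `0, …, m - 1`. A state presents
the query `{e, e'}` if the names of `e` and `e'` are in registers `0` and `1`; all other registers
and the whole work memory may hold anything, for instance what an earlier query left there. -/
def PresentsQuery {w m : ℕ} (σ : WordRAM.State w) (e e' : Fin m) : Prop :=
  σ.reg 0 = BitVec.ofNat w e ∧ σ.reg 1 = BitVec.ofNat w e'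

/-- With the stored array `D`, the program `p` answers every query `{e, e'}` of two distinct edges
within `T` units of time by the size of the `(s,t)`-min-cut of `G - {e, e'}`, in register `0`. -/
def ReportsMinCutSize {w n m : ℕ} (D : List (BitVec w)) (p : WordRAM.Prog) (T : ℕ)
    (G : MultiDigraph (Fin n) (Fin m)) (s t : Fin n) : Prop :=
  ∀ e e' : Fin m, e ≠ e' → ∀ σ : WordRAM.State w, PresentsQuery σ e e' →
    ∃ (k : ℕ) (τ : WordRAM.State w), k ≤ T ∧ WordRAM.Exec D p σ k τ ∧
      (τ.reg 0).toNat = (G.delete {e, e'}).minCut s t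

/-- With the stored array `D`, the program `p` answers every query `{e, e'}` of two distinct edges
within `T` units of time by the partition `(A, Aᶜ)` of an `(s,t)`-min-cut of `G - {e, e'}`: on
halting, cell `v` of the work memory is `1` for every vertex `v` in `A`, and `0` for every other
vertex `v`. -/
def ReportsMinCutPartition {w n m : ℕ} (D : List (BitVec w)) (p : WordRAM.Prog) (T : ℕ)
    (G : MultiDigraph (Fin n) (Fin m)) (s t : Fin n) : Prop :=
  ∀ e e' : Fin m, e ≠ e' → ∀ σ : WordRAM.State w, PresentsQuery σ e e' →
    ∃ (k : ℕ) (τ : WordRAM.State w) (A : Set (Fin n)), k ≤ T ∧ WordRAM.Exec D p σ k τ ∧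
      (G.delete {e, e'}).IsMinCutPartition s t A ∧
      ∀ v : Fin n, (v ∈ A → τ.mem (BitVec.ofNat w v) = 1) ∧
        (v ∉ A → τ.mem (BitVec.ofNat w v) = 0)

/-! Write `k` for the min-cut size `λ`. Fix `k` edge-disjoint simple paths from `s` to `t` and
reverse their edges to get the residual graph `H`. A cut with sink side `W` has `k` plus the number
of edges of `H` entering `W` many edges (`card_inE`). Hence the minimum cuts are the sets entered by
no residual edge (closed sets), and the cuts of size `k + 1` are entered by exactly one, their gate.
Deleting `e` and `f` costs two if one minimum cut contains both. Otherwise it costs one if one of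
them lies in a minimum cut or both lie in a common cut of size `k + 1`, and nothing in the remaining
case (`minCut_delete`).

Closed sets form a lattice, so questions about minimum cuts are read off the least closed set
containing a given vertex. The hard case is a cut of size `k + 1` through two edges that lie in no
minimum cut. Call two vertices equivalent if no minimum cut separates them; the heads of `e` and `f`
are then equivalent (`cls_head_of_card`). With one representative `ρ` per class, either the sink
side avoids `ρ`, or its complement does so in the reversed graph (`joint_or_joint_rev`). If two
tight sets avoiding `ρ` share a vertex of the class of `ρ`, then by submodularity their union and
intersection are tight as well, since a smaller cut would separate the class (`Tight.inter_union`).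
So there are a least tight set around a vertex, its hull, and a greatest tight set entered by a
given edge, its cell. Two edges have a common cut exactly if the head of each lies in the cell of
the other (`common_iff`).

Space: going along a path, a tight set is left at most once, because the edge leaving it is the
gate. Three numbers per path therefore describe the set (`mem_iff_row`), that is, `O(k)` words. The
cells of all path edges would still be too many. A cell is stored only if the edge is off the paths,
or if its path leaves the hull of its head again within the class; each kind occurs at most once per
head (`nonflow_unique`, `Special.unique`). For any other path edge, every tight set around the head
contains the last vertex `q` of the path in the class. It then suffices to know whether the hull of
`q` and the head of the other edge contains the tail, which needs the row of that hull on a single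
path (`common_iff_headTest`). Only `O(k n)` edges matter, and perfect hashing finds them in constant
time.

Reporting: a vertex belongs to a cell according to whether the tail of the gate of its own hull does
(`mem_cell_iff_gate`), so a cell is computed in one pass ordered by `depth`. Vertices of other
classes are assigned to sides by a linear extension of the order of the classes (`Tight.align`). -/

namespace MultiDigraph

/-! ### Cuts as vertex sets, and submodularity. -/

variable {V E : Type}

/-- `W` contains `t` but not `s`: the sink side of a cut. -/
def Valid (s t : V) (W : Set V) : Prop := s ∉ W ∧ t ∈ W

open Classical in
/-- The edges that enter `W`. -/
noncomputable def inE [Fintype E] (G : MultiDigraph V E) (W : Set V) : Finset E :=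
  Finset.univ.filter fun e => G.tail e ∉ W ∧ G.head e ∈ W

theorem mem_inE [Fintype E] {G : MultiDigraph V E} {W : Set V} {e : E} :
    e ∈ G.inE W ↔ G.tail e ∉ W ∧ G.head e ∈ W := by
  simp [inE]

/-- The sink side is the set of vertices that `s` does not reach once `C` is removed. -/
theorem isCut_iff {G : MultiDigraph V E} {s t : V} {C : Finset E} :
    G.IsCut s t C ↔ ∃ W, Valid s t W ∧ ∀ e, G.tail e ∉ W → G.head e ∈ W → e ∈ C := by
  constructor
  · intro h
    refine ⟨{v | ¬ (G.delete C).Reachable s v}, ⟨?_, h⟩, ?_⟩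
    · exact not_not.2 Relation.ReflTransGen.refl
    · intro e h1 h2
      by_contra hC
      exact h2 ((not_not.1 h1).tail ⟨⟨e, hC⟩, rfl, rfl⟩)
  · rintro ⟨W, ⟨hs, ht⟩, hW⟩ hr
    have key : ∀ v, (G.delete C).Reachable s v → v ∉ W := by
      intro v hv
      induction hv with
      | refl => exact hs
      | tail _ hbc ih =>
        obtain ⟨e, rfl, rfl⟩ := hbc
        intro hh
        exact e.2 (hW e.1 ih hh)
    exact key t hr ht

theorem isCut_inE [Fintype E] {G : MultiDigraph V E} {s t : V} {W : Set V} (h : Valid s t W) :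
    G.IsCut s t (G.inE W) :=
  isCut_iff.2 ⟨W, h, fun _ h1 h2 => mem_inE.2 ⟨h1, h2⟩⟩

theorem minCut_le [Fintype E] {G : MultiDigraph V E} {s t : V} {W : Set V} (h : Valid s t W) :
    G.minCut s t ≤ (G.inE W).card :=
  Nat.sInf_le ⟨_, isCut_inE h, rfl⟩

theorem minCut_le_card [Fintype E] {G : MultiDigraph V E} {s t : V} {C : Finset E}
    (h : G.IsCut s t C) : G.minCut s t ≤ C.card :=
  Nat.sInf_le ⟨_, h, rfl⟩

theorem exists_minCut [Fintype E] (G : MultiDigraph V E) {s t : V} (hst : s ≠ t) :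
    ∃ W, Valid s t W ∧ (G.inE W).card = G.minCut s t := by
  have hne : {k : ℕ | ∃ C : Finset E, G.IsCut s t C ∧ C.card = k}.Nonempty :=
    ⟨_, _, isCut_inE (W := {t}) (by simpa [Valid] using hst), rfl⟩
  obtain ⟨C, hC, hk⟩ := Nat.sInf_mem hne
  obtain ⟨W, hW, hWC⟩ := isCut_iff.1 hC
  refine ⟨W, hW, le_antisymm ?_ (minCut_le hW)⟩
  rw [minCut, ← hk]
  exact Finset.card_le_card fun e he => hWC e (mem_inE.1 he).1 (mem_inE.1 he).2

theorem minCut_eq [Fintype E] {G : MultiDigraph V E} {s t : V} {k : ℕ} (hst : s ≠ t)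
    (h1 : ∃ W, Valid s t W ∧ (G.inE W).card ≤ k)
    (h2 : ∀ W, Valid s t W → k ≤ (G.inE W).card) : G.minCut s t = k := by
  obtain ⟨W, hW, hk⟩ := h1
  obtain ⟨W', hW', hk'⟩ := exists_minCut G hst
  exact le_antisymm ((minCut_le hW).trans hk) (hk' ▸ h2 W' hW')

theorem isMinCutPartition_of [Fintype E] {G : MultiDigraph V E} {s t : V} {W : Set V}
    (h : Valid s t W) (hk : (G.inE W).card ≤ G.minCut s t) :
    G.IsMinCutPartition s t Wᶜ := by
  refine ⟨h.1, by simpa using h.2, G.inE W, fun e => by simp [mem_inE], isCut_inE h, ?_⟩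
  exact fun C' hC' => hk.trans (minCut_le_card hC')

theorem card_inE_delete [Fintype E] [DecidableEq E] (G : MultiDigraph V E) (F : Finset E)
    [Fintype {e : E // e ∉ F}] (W : Set V) :
    ((G.delete F).inE W).card = (G.inE W \ F).card := by
  rw [← Finset.card_map (Function.Embedding.subtype _)]
  congr 1
  ext e
  simp only [Finset.mem_map, mem_inE, Function.Embedding.subtype_apply, Finset.mem_sdiff, delete]
  constructor
  · rintro ⟨a, h, rfl⟩
    exact ⟨h, a.2⟩
  · rintro ⟨h, hF⟩
    exact ⟨⟨e, hF⟩, h, rfl⟩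

theorem inE_inter_subset [Fintype E] [DecidableEq E] (G : MultiDigraph V E) (A B : Set V) :
    G.inE (A ∩ B) ⊆ G.inE A ∪ G.inE B := by
  intro e
  simp only [mem_inE, Finset.mem_union, Set.mem_inter_iff]
  tauto

theorem inE_union_subset [Fintype E] [DecidableEq E] (G : MultiDigraph V E) (A B : Set V) :
    G.inE (A ∪ B) ⊆ G.inE A ∪ G.inE B := by
  intro e
  simp only [mem_inE, Finset.mem_union, Set.mem_union]
  tauto

/-- The inequality holds for each edge separately, by cases on the position of its two ends. -/
theorem card_inE_submodular [Fintype E] (G : MultiDigraph V E) (A B : Set V) :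
    (G.inE (A ∩ B)).card + (G.inE (A ∪ B)).card ≤ (G.inE A).card + (G.inE B).card := by
  classical
  simp only [inE, Finset.card_filter, ← Finset.sum_add_distrib]
  refine Finset.sum_le_sum fun e _ => ?_
  simp only [Set.mem_inter_iff, Set.mem_union]
  by_cases h1 : G.tail e ∈ A <;> by_cases h2 : G.tail e ∈ B <;> by_cases h3 : G.head e ∈ A <;>
    by_cases h4 : G.head e ∈ B <;> simp [h1, h2, h3, h4]

end MultiDigraph

/-! ## Edge-disjoint paths -/

/-- A walk of minimal length repeats no vertex, because the part between two visits could be cut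
out. -/
theorem exists_injective_walk {V E : Type} [Nonempty E] (R : V → E → V → Prop) {a b : V}
    (h : Relation.ReflTransGen (fun x y => ∃ e, R x e y) a b) :
    ∃ (l : ℕ) (v : ℕ → V) (e : ℕ → E), v 0 = a ∧ v l = b ∧
      (∀ p < l, R (v p) (e p) (v (p + 1))) ∧ ∀ p ≤ l, ∀ q ≤ l, v p = v q → p = q := by
  classical
  obtain ⟨e0⟩ := ‹Nonempty E›
  have hex : ∃ (l : ℕ) (v : ℕ → V) (e : ℕ → E), v 0 = a ∧ v l = b ∧
      ∀ p < l, R (v p) (e p) (v (p + 1)) := by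
    induction h with
    | refl => exact ⟨0, fun _ => a, fun _ => e0, rfl, rfl, by simp⟩
    | @tail b c _ hbc ih =>
      obtain ⟨l, v, e, h0, hl, hR⟩ := ih
      obtain ⟨f, hf⟩ := hbc
      refine ⟨l + 1, fun p => if p ≤ l then v p else c, fun p => if p < l then e p else f,
        by simp [h0], by simp, ?_⟩
      intro p hp
      rcases Nat.lt_succ_iff_lt_or_eq.1 hp with hp | rfl
      · have h1 : p ≤ l := hp.le
        have h2 : p + 1 ≤ l := hp
        simpa [hp, h1, h2] using hR p hp
      · simpa [hl] using hf
  obtain ⟨v, e, h0, hl, hR⟩ := Nat.find_spec hex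
  have hmin := fun l => @Nat.find_min _ _ hex l
  set l := Nat.find hex with hl_def
  refine ⟨l, v, e, h0, hl, hR, ?_⟩
  have key : ∀ p q, p < q → q ≤ l → v p ≠ v q := by
    intro p q hpq hq heq
    -- The part between positions `p` and `q` is removed, so that later indices shift by `q - p`.
    refine hmin (l - (q - p)) (by omega)
      ⟨fun k => if k ≤ p then v k else v (k + (q - p)),
       fun k => if k < p then e k else e (k + (q - p)), by simp [h0], ?_, ?_⟩
    · rcases Nat.lt_or_ge p (l - (q - p)) with h | h
      · have : ¬ l - (q - p) ≤ p := by omega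
        simp only [this, if_false]
        rw [← hl]; congr 1; omega
      · have h1 : l - (q - p) ≤ p := h
        have h2 : q = l := by omega
        simp only [h1, if_true]
        rw [← hl, ← h2, ← heq]; congr 1; omega
    · intro k hk
      rcases Nat.lt_trichotomy k p with h | h | h
      · have h1 : k ≤ p := h.le
        have h2 : k + 1 ≤ p := h
        simpa [h, h1, h2] using hR k (by omega)
      · subst h
        have h1 : k + (q - k) = q := by omega
        have h2 : k + 1 + (q - k) = q + 1 := by omega
        simpa [h1, h2, heq] using hR q (by omega)
      · have h1 : ¬ k ≤ p := by omega
        have h2 : ¬ k + 1 ≤ p := by omega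
        have h3 : ¬ k < p := by omega
        simp only [h1, h2, h3, if_false]
        have := hR (k + (q - p)) (by omega)
        rwa [show k + (q - p) + 1 = k + 1 + (q - p) by omega] at this
  intro p hp q hq heq
  rcases Nat.lt_trichotomy p q with h | h | h
  · exact absurd heq (key p q h hq)
  · exact h
  · exact absurd heq.symm (key q p h hp)

namespace MultiDigraph

/-! ### Flows by augmentation, and their decomposition into paths. -/

variable {V E : Type}

open Classical in
/-- The graph with the edges of `S` turned around. -/
noncomputable def flip (G : MultiDigraph V E) (S : Set E) : MultiDigraph V E where
  tail e := if e ∈ S then G.head e else G.tail e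
  head e := if e ∈ S then G.tail e else G.head e

open Classical in
/-- Number of edges of `S` that leave `x` minus the number of those that enter it. -/
noncomputable def excess (G : MultiDigraph V E) (S : Finset E) (x : V) : ℤ :=
  ∑ e ∈ S, ((if G.tail e = x then 1 else 0) - (if G.head e = x then 1 else 0))

-- Augmentation: toggling an edge used by the residual walk, whether this inserts or removes it,
-- raises the excess at the residual tail by one and lowers it at the residual head. Along the walk
-- only the two ends survive.
open Classical in
theorem excess_symmDiff (G : MultiDigraph V E) (S : Finset E) (v : ℕ → V) (e : ℕ → E) (l : ℕ)
    (hw : ∀ p < l, (G.flip S).tail (e p) = v p ∧ (G.flip S).head (e p) = v (p + 1))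
    (he : ∀ p < l, ∀ q < l, e p = e q → p = q) (x : V) :
    G.excess (symmDiff S ((Finset.range l).image e)) x =
      G.excess S x + (if v 0 = x then 1 else 0) - (if v l = x then 1 else 0) := by
  induction l with
  | zero =>
    have : symmDiff S ∅ = S := symmDiff_bot S
    simp [this]
  | succ l ih =>
    have ih := ih (fun p hp => hw p (by omega)) (fun p hp q hq => he p (by omega) q (by omega))
    have hnot : e l ∉ (Finset.range l).image e := by
      simp only [Finset.mem_image, Finset.mem_range, not_exists, not_and]
      intro p hp h
      have := he p (by omega) l (by omega) h
      omega
    obtain ⟨h1, h2⟩ := hw l (by omega)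
    rw [Finset.range_add_one, Finset.image_insert]
    set T := (Finset.range l).image e
    by_cases hS : e l ∈ S
    · have hmem : e l ∈ symmDiff S T := Finset.mem_symmDiff.2 (Or.inl ⟨hS, hnot⟩)
      have : symmDiff S (insert (e l) T) = (symmDiff S T).erase (e l) := by
        ext a
        simp only [Finset.mem_symmDiff, Finset.mem_insert, Finset.mem_erase]
        by_cases ha : a = e l
        · subst ha; simp [hS]
        · simp [ha]
      rw [this]
      simp only [flip, Finset.mem_coe, hS, if_true] at h1 h2
      unfold excess at ih ⊢
      rw [Finset.sum_erase_eq_sub hmem, ih, h1, h2]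
      ring
    · have hmem : e l ∉ symmDiff S T := by simp [Finset.mem_symmDiff, hS, hnot]
      have : symmDiff S (insert (e l) T) = insert (e l) (symmDiff S T) := by
        ext a
        simp only [Finset.mem_symmDiff, Finset.mem_insert]
        by_cases ha : a = e l
        · subst ha; simp [hS]
        · simp [ha]
      rw [this]
      simp only [flip, Finset.mem_coe, hS, if_false] at h1 h2
      unfold excess at ih ⊢
      rw [Finset.sum_insert hmem, ih, h1, h2]
      ring

open Classical in
theorem sum_excess [Fintype V] (G : MultiDigraph V E) (S : Finset E) (A : Set V) :
    ∑ x with x ∈ A, G.excess S x =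
      ∑ e ∈ S, ((if G.tail e ∈ A then 1 else 0) - (if G.head e ∈ A then 1 else 0)) := by
  unfold excess
  rw [Finset.sum_comm]
  refine Finset.sum_congr rfl fun e _ => ?_
  rw [Finset.sum_sub_distrib, Finset.sum_ite_eq, Finset.sum_ite_eq]
  simp

open Classical in
/-- `S` is the edge set of a flow of value `k` from `s` to `t`. -/
def IsFlow (G : MultiDigraph V E) (s t : V) (k : ℕ) (S : Finset E) : Prop :=
  ∀ x, G.excess S x = k * ((if s = x then 1 else 0) - (if t = x then 1 else 0))

open Classical in
theorem IsFlow.sum [Fintype V] {G : MultiDigraph V E} {s t : V} {k : ℕ} {S : Finset E}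
    (h : G.IsFlow s t k S) {A : Set V} (hs : s ∈ A) (ht : t ∉ A) :
    ∑ e ∈ S, ((if G.tail e ∈ A then (1 : ℤ) else 0) - (if G.head e ∈ A then 1 else 0)) = k := by
  rw [← sum_excess, Finset.sum_congr rfl fun x _ => h x, ← Finset.mul_sum,
    Finset.sum_sub_distrib, Finset.sum_ite_eq, Finset.sum_ite_eq]
  simp [hs, ht]

/-- Ford–Fulkerson: if no augmenting walk exists, the vertices residually reachable from `s` form
the source side of a cut with at most `k` edges. -/
theorem exists_flow [Nonempty E] [Fintype V] [Fintype E] (G : MultiDigraph V E) (s t : V) (k : ℕ)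
    (hk : k ≤ G.minCut s t) : ∃ S, G.IsFlow s t k S := by
  classical
  induction k with
  | zero => exact ⟨∅, fun x => by simp [excess]⟩
  | succ k ih =>
    obtain ⟨S, hS⟩ := ih (by omega)
    have hreach : Relation.ReflTransGen
        (fun x y => ∃ e, (G.flip S).tail e = x ∧ (G.flip S).head e = y) s t := by
      by_contra hcon
      set A : Set V := {x | Relation.ReflTransGen
        (fun x y => ∃ e, (G.flip S).tail e = x ∧ (G.flip S).head e = y) s x} with hA
      have hs : s ∈ A := Relation.ReflTransGen.refl
      have hcl : ∀ e, (G.flip S).tail e ∈ A → (G.flip S).head e ∈ A := fun e he =>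
        Relation.ReflTransGen.tail he ⟨e, rfl, rfl⟩
      have hsum := hS.sum hs hcon
      have h1 := minCut_le (G := G) (s := s) (t := t) (W := Aᶜ) ⟨by simpa using hs, hcon⟩
      have h2 : ((G.inE Aᶜ).card : ℤ) ≤ k := by
        have hsub : G.inE Aᶜ ⊆ S := by
          intro e he
          rw [mem_inE] at he
          by_contra heS
          have := hcl e
          simp only [flip, Finset.mem_coe, heS, if_false] at this
          exact he.2 (this (not_not.1 he.1))
        have hc : ((G.inE Aᶜ).card : ℤ) = ∑ e ∈ S, if e ∈ G.inE Aᶜ then 1 else 0 := by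
          rw [Finset.sum_ite_mem, Finset.inter_eq_right.2 hsub]; simp
        -- No flow edge enters `A`, since its reversal would lead out of the reachable set. Hence
        -- the net flow out of `A` counts every edge of the cut.
        rw [← hsum, hc]
        refine Finset.sum_le_sum fun e he => ?_
        have := hcl e
        simp only [flip, Finset.mem_coe, he, if_true] at this
        simp only [mem_inE]
        by_cases h3 : G.tail e ∈ A <;> by_cases h4 : G.head e ∈ A <;> simp_all
      omega
    obtain ⟨l, v, e, h0, hl, hR, hinj⟩ := exists_injective_walk
      (fun x e y => (G.flip S).tail e = x ∧ (G.flip S).head e = y) hreach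
    refine ⟨symmDiff S ((Finset.range l).image e), fun x => ?_⟩
    rw [excess_symmDiff G S v e l hR ?_ x, hS x, h0, hl]
    · push_cast; ring
    · intro p hp q hq hpq
      refine hinj p hp.le q hq.le ?_
      rw [← (hR p hp).1, ← (hR q hq).1, hpq]

/-- `k` edge-disjoint simple paths from `s` to `t`: path `i` runs through the vertices `vtx i p`,
where `p ≤ len i`, and the edges `edge i p`, where `p < len i`. -/
structure PathSystem (G : MultiDigraph V E) (s t : V) (k : ℕ) where
  len : ℕ → ℕ
  vtx : ℕ → ℕ → V
  edge : ℕ → ℕ → E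
  tail_edge : ∀ i < k, ∀ p < len i, G.tail (edge i p) = vtx i p
  head_edge : ∀ i < k, ∀ p < len i, G.head (edge i p) = vtx i (p + 1)
  start : ∀ i < k, vtx i 0 = s
  finish : ∀ i < k, vtx i (len i) = t
  vtx_inj : ∀ i < k, ∀ p ≤ len i, ∀ q ≤ len i, vtx i p = vtx i q → p = q
  edge_inj : ∀ i < k, ∀ j < k, ∀ p < len i, ∀ q < len j, edge i p = edge j q → i = j ∧ p = q

/-- Flow edges can be followed backwards from `t` to `s`: otherwise the vertices reached would
receive a positive net flow without any flow edge entering them. Removing a simple walk of this kind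
lowers the value by one. -/
theorem IsFlow.exists_pathSystem [Nonempty E] [Fintype V] {G : MultiDigraph V E} {s t : V}
    {k : ℕ} {S : Finset E} (h : G.IsFlow s t k S) :
    ∃ P : G.PathSystem s t k, ∀ i < k, ∀ p < P.len i, P.edge i p ∈ S := by
  classical
  induction k generalizing S with
  | zero =>
    obtain ⟨e0⟩ := ‹Nonempty E›
    exact ⟨⟨fun _ => 0, fun _ _ => s, fun _ _ => e0, by simp, by simp, by simp, by simp,
        by simp, by simp⟩, by simp⟩
  | succ k ih =>
    have hreach : Relation.ReflTransGen
        (fun x y => ∃ e, e ∈ S ∧ G.head e = x ∧ G.tail e = y) t s := by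
      by_contra hcon
      set A : Set V := {x | Relation.ReflTransGen
        (fun x y => ∃ e, e ∈ S ∧ G.head e = x ∧ G.tail e = y) t x} with hA
      have ht : t ∈ A := Relation.ReflTransGen.refl
      have hcl : ∀ e ∈ S, G.head e ∈ A → G.tail e ∈ A := fun e heS he =>
        Relation.ReflTransGen.tail he ⟨e, heS, rfl, rfl⟩
      have hsum := h.sum (A := Aᶜ) hcon (by simpa using ht)
      refine absurd (hsum.symm.le.trans (Finset.sum_nonpos fun e he => ?_)) (by push_cast; omega)
      have := hcl e he
      by_cases h3 : G.tail e ∈ A <;> by_cases h4 : G.head e ∈ A <;> simp_all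
    obtain ⟨l, v, e, h0, hl, hR, hinj⟩ := exists_injective_walk
      (fun x e y => e ∈ S ∧ G.head e = x ∧ G.tail e = y) hreach
    have heinj : ∀ p < l, ∀ q < l, e p = e q → p = q := by
      intro p hp q hq hpq
      refine hinj p hp.le q hq.le ?_
      rw [← (hR p hp).2.1, ← (hR q hq).2.1, hpq]
    -- All edges of the walk belong to `S`, so the symmetric difference only removes edges.
    obtain ⟨P, hP⟩ := ih (S := symmDiff S ((Finset.range l).image e)) (by
      intro x
      rw [excess_symmDiff G S v e l ?_ heinj x, h x, h0, hl]
      · push_cast; ring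
      · intro p hp
        simpa [flip, (hR p hp).1] using (hR p hp).2)
    have hPS : ∀ i < k, ∀ p < P.len i, P.edge i p ∈ S ∧ ∀ q < l, e q ≠ P.edge i p := by
      intro i hi p hp
      have := hP i hi p hp
      rw [Finset.mem_symmDiff] at this
      rcases this with ⟨h1, h2⟩ | ⟨h1, h2⟩
      · exact ⟨h1, fun q hq he => h2 (Finset.mem_image.2 ⟨q, Finset.mem_range.2 hq, he⟩)⟩
      · obtain ⟨q, hq, he⟩ := Finset.mem_image.1 h1
        exact absurd (he ▸ (hR q (Finset.mem_range.1 hq)).1) h2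
    refine ⟨⟨fun i => if i < k then P.len i else l,
      fun i p => if i < k then P.vtx i p else v (l - p),
      fun i p => if i < k then P.edge i p else e (l - 1 - p), ?_, ?_, ?_, ?_, ?_, ?_⟩, ?_⟩
    · intro i hi p
      by_cases hik : i < k
      · simpa only [hik, if_true] using P.tail_edge i hik p
      · simp only [hik, if_false]
        intro hp
        rw [(hR (l - 1 - p) (by omega)).2.2]; congr 1; omega
    · intro i hi p
      by_cases hik : i < k
      · simpa only [hik, if_true] using P.head_edge i hik p
      · simp only [hik, if_false]
        intro hp
        rw [(hR (l - 1 - p) (by omega)).2.1]; congr 1; omega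
    · intro i hi
      by_cases hik : i < k
      · simpa only [hik, if_true] using P.start i hik
      · simpa [hik] using hl
    · intro i hi
      by_cases hik : i < k
      · simpa only [hik, if_true] using P.finish i hik
      · simpa [hik] using h0
    · intro i hi p
      by_cases hik : i < k
      · simpa only [hik, if_true] using P.vtx_inj i hik p
      · simp only [hik, if_false]
        intro hp q hq heq
        have := hinj _ (by omega) _ (by omega) heq
        omega
    · intro i hi j hj p
      by_cases hik : i < k <;> by_cases hjk : j < k <;> simp only [hik, hjk, if_true, if_false]
      · exact P.edge_inj i hik j hjk p
      · intro hp q hq heq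
        exact absurd heq.symm ((hPS i hik p hp).2 _ (by omega))
      · intro hp q hq heq
        exact absurd heq ((hPS j hjk q hq).2 _ (by omega))
      · intro hp q hq heq
        have := heinj _ (by omega) _ (by omega) heq
        omega
    · intro i hi p
      by_cases hik : i < k <;> simp only [hik, if_true, if_false]
      · exact fun hp => (hPS i hik p hp).1
      · exact fun hp => (hR _ (by omega)).1

end MultiDigraph

/-! ## Tight cuts of the residual graph -/

/-- In a finite family closed under intersection a minimal member is the least one. -/
theorem least_of_inter {V : Type} [Finite V] {F : Set V → Prop} (h : ∃ W, F W)
    (hi : ∀ A B, F A → F B → F (A ∩ B)) : F {x | ∀ W, F W → x ∈ W} := by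
  obtain ⟨M, hM⟩ := (Set.toFinite {W | F W}).exists_minimal h
  have : {x | ∀ W, F W → x ∈ W} = M := by
    ext x
    refine ⟨fun hx => hx M hM.prop, fun hx W hW => ?_⟩
    exact (hM.le_of_le (hi M W hM.prop hW) Set.inter_subset_left hx).2
  rw [this]
  exact hM.prop

theorem greatest_of_union {V : Type} [Finite V] {F : Set V → Prop} (h : ∃ W, F W)
    (hu : ∀ A B, F A → F B → F (A ∪ B)) : F {x | ∃ W, F W ∧ x ∈ W} := by
  obtain ⟨M, hM⟩ := (Set.toFinite {W | F W}).exists_maximal h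
  have : {x | ∃ W, F W ∧ x ∈ W} = M := by
    ext x
    refine ⟨fun ⟨W, hW, hx⟩ => ?_, fun hx => ⟨M, hM.prop, hx⟩⟩
    exact hM.le_of_ge (hu M W hM.prop hW) Set.subset_union_left (Or.inr hx)
  rw [this]
  exact hM.prop

/-! ### The residual graph of a system of paths. -/

open MultiDigraph

/-- A graph with terminals `s`, `t` and `k` edge-disjoint simple paths between them. -/
structure FlowGraph (V E : Type) where
  G : MultiDigraph V E
  s : V
  t : V
  k : ℕ
  P : G.PathSystem s t k

namespace FlowGraph

variable {V E : Type} (S : FlowGraph V E)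

/-- `e` is the edge number `p` of the path number `i`. -/
def At (e : E) (i p : ℕ) : Prop := i < S.k ∧ p < S.P.len i ∧ S.P.edge i p = e

/-- `e` lies on one of the paths. -/
def IsFlowEdge (e : E) : Prop := ∃ i p, S.At e i p

/-- The residual graph. -/
noncomputable def H : MultiDigraph V E := S.G.flip {e | S.IsFlowEdge e}

variable {S}

theorem At.isFlowEdge {e : E} {i p : ℕ} (h : S.At e i p) : S.IsFlowEdge e := ⟨i, p, h⟩

theorem At.tail {e : E} {i p : ℕ} (h : S.At e i p) : S.G.tail e = S.P.vtx i p := by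
  rw [← h.2.2]; exact S.P.tail_edge i h.1 p h.2.1

theorem At.head {e : E} {i p : ℕ} (h : S.At e i p) : S.G.head e = S.P.vtx i (p + 1) := by
  rw [← h.2.2]; exact S.P.head_edge i h.1 p h.2.1

theorem At.unique {e : E} {i p j q : ℕ} (h : S.At e i p) (h' : S.At e j q) : i = j ∧ p = q :=
  S.P.edge_inj i h.1 j h'.1 p h.2.1 q h'.2.1 (h.2.2.trans h'.2.2.symm)

theorem H_tail_of_flow {e : E} (h : S.IsFlowEdge e) : S.H.tail e = S.G.head e := by
  simp [H, MultiDigraph.flip, h]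

theorem H_head_of_flow {e : E} (h : S.IsFlowEdge e) : S.H.head e = S.G.tail e := by
  simp [H, MultiDigraph.flip, h]

theorem H_tail_of_not {e : E} (h : ¬ S.IsFlowEdge e) : S.H.tail e = S.G.tail e := by
  simp [H, MultiDigraph.flip, h]

theorem H_head_of_not {e : E} (h : ¬ S.IsFlowEdge e) : S.H.head e = S.G.head e := by
  simp [H, MultiDigraph.flip, h]

variable [Fintype E]

theorem mem_H_of_not {e : E} (h : ¬ S.IsFlowEdge e) {W : Set V} :
    e ∈ S.H.inE W ↔ S.G.tail e ∉ W ∧ S.G.head e ∈ W := by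
  rw [mem_inE, H_tail_of_not h, H_head_of_not h]

theorem mem_H_of_flow {e : E} (h : S.IsFlowEdge e) {W : Set V} :
    e ∈ S.H.inE W ↔ S.G.head e ∉ W ∧ S.G.tail e ∈ W := by
  rw [mem_inE, H_tail_of_flow h, H_head_of_flow h]

/-- Every cut is crossed by each path once more forwards than backwards. -/
theorem card_inE {W : Set V} (hW : Valid S.s S.t W) :
    (S.G.inE W).card = S.k + (S.H.inE W).card := by
  classical
  -- Forward minus backward crossings telescope along the path, which starts outside `W` and ends
  -- inside.
  have hpath : ∀ i < S.k, ∑ p ∈ Finset.range (S.P.len i),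
      ((if S.G.head (S.P.edge i p) ∈ W then (1 : ℤ) else 0) -
        (if S.G.tail (S.P.edge i p) ∈ W then 1 else 0)) = 1 := by
    intro i hi
    rw [Finset.sum_congr rfl (g := fun p => (if S.P.vtx i (p + 1) ∈ W then (1 : ℤ) else 0) -
      (if S.P.vtx i p ∈ W then 1 else 0))]
    · rw [Finset.sum_range_sub (f := fun p => if S.P.vtx i p ∈ W then (1 : ℤ) else 0),
        S.P.start i hi, S.P.finish i hi]
      simp [hW.1, hW.2]
    · intro p hp
      rw [Finset.mem_range] at hp
      rw [S.P.tail_edge i hi p hp, S.P.head_edge i hi p hp]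
  have hflow : ∑ e with S.IsFlowEdge e, ((if S.G.head e ∈ W then (1 : ℤ) else 0) -
        (if S.G.tail e ∈ W then 1 else 0)) = S.k := by
    have himg : Finset.univ.filter (fun e => S.IsFlowEdge e) =
        ((Finset.range S.k).sigma fun i => Finset.range (S.P.len i)).image
          fun x => S.P.edge x.1 x.2 := by
      ext e
      rw [Finset.mem_filter]
      simp only [Finset.mem_univ, true_and, Finset.mem_image, Finset.mem_sigma,
        Finset.mem_range, Sigma.exists, IsFlowEdge, At, and_assoc]
    rw [himg, Finset.sum_image, Finset.sum_sigma,
      Finset.sum_congr rfl fun i hi => hpath i (Finset.mem_range.1 hi)]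
    · simp
    · rintro ⟨i, p⟩ h1 ⟨j, q⟩ h2 heq
      simp only [Finset.coe_sigma, Set.mem_sigma_iff, Finset.mem_coe, Finset.mem_range] at h1 h2
      obtain ⟨rfl, rfl⟩ := S.P.edge_inj i h1.1 j h2.1 p h1.2 q h2.2 heq
      rfl
  -- Edges off the paths contribute equally to both counts; a path edge contributes its signed
  -- crossing.
  have hdiff : ((S.G.inE W).card : ℤ) - (S.H.inE W).card = S.k := by
    rw [← hflow, inE, inE, Finset.card_filter, Finset.card_filter, Finset.sum_filter]
    push_cast
    rw [← Finset.sum_sub_distrib]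
    refine Finset.sum_congr rfl fun e _ => ?_
    by_cases he : S.IsFlowEdge e
    · rw [H_tail_of_flow he, H_head_of_flow he]
      by_cases h1 : S.G.tail e ∈ W <;> by_cases h2 : S.G.head e ∈ W <;> simp [he, h1, h2]
    · rw [H_tail_of_not he, H_head_of_not he]
      simp [he]
  omega

variable (S)

/-- The sink side of a cut of size `k`. -/
def Closed (W : Set V) : Prop := Valid S.s S.t W ∧ S.H.inE W = ∅

/-- The sink side of a cut of size `k + 1`, avoiding `ρ`. -/
def Tight (ρ : V) (W : Set V) : Prop :=
  Valid S.s S.t W ∧ (S.H.inE W).card = 1 ∧ ρ ∉ W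

/-- `x` and `y` are on the same side of every cut of size `k`. -/
def Cls (x y : V) : Prop := ∀ W, S.Closed W → (x ∈ W ↔ y ∈ W)

/-! ### Lattice properties of closed and tight sets. -/

variable {S}

theorem _root_.MultiDigraph.Valid.inter {s t : V} {A B : Set V} (hA : Valid s t A)
    (hB : Valid s t B) : Valid s t (A ∩ B) := ⟨fun h => hA.1 h.1, hA.2, hB.2⟩

theorem _root_.MultiDigraph.Valid.union {s t : V} {A B : Set V} (hA : Valid s t A)
    (hB : Valid s t B) : Valid s t (A ∪ B) := ⟨fun h => h.elim hA.1 hB.1, Or.inl hA.2⟩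

theorem Cls.refl (x : V) : S.Cls x x := fun _ _ => Iff.rfl

theorem Cls.symm {x y : V} (h : S.Cls x y) : S.Cls y x := fun W hW => (h W hW).symm

theorem Cls.trans {x y z : V} (h : S.Cls x y) (h' : S.Cls y z) : S.Cls x z :=
  fun W hW => (h W hW).trans (h' W hW)

theorem Closed.inter {A B : Set V} (hA : S.Closed A) (hB : S.Closed B) : S.Closed (A ∩ B) := by
  classical
  refine ⟨hA.1.inter hB.1, ?_⟩
  have := inE_inter_subset S.H A B
  rw [hA.2, hB.2] at this
  simpa using this

theorem Closed.union {A B : Set V} (hA : S.Closed A) (hB : S.Closed B) : S.Closed (A ∪ B) := by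
  classical
  refine ⟨hA.1.union hB.1, ?_⟩
  have := inE_union_subset S.H A B
  rw [hA.2, hB.2] at this
  simpa using this

/-- If no residual edge entered `Y`, then `Y` would be closed and would separate `x` from `ρ`. -/
theorem inE_eq_of_subset {ρ x : V} {Y : Set V} {g : E} (hY : Valid S.s S.t Y) (hx : x ∈ Y)
    (hρ : ρ ∉ Y) (hc : S.Cls x ρ) (hg : S.H.inE Y ⊆ {g}) : S.H.inE Y = {g} := by
  classical
  rcases Finset.subset_singleton_iff.1 hg with h | h
  · exact absurd ((hc Y ⟨hY, h⟩).1 hx) hρ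
  · exact h

theorem Tight.of_subset {ρ x : V} {Y : Set V} {g : E} (hY : Valid S.s S.t Y) (hx : x ∈ Y)
    (hρ : ρ ∉ Y) (hc : S.Cls x ρ) (hg : S.H.inE Y ⊆ {g}) : S.Tight ρ Y :=
  ⟨hY, by rw [inE_eq_of_subset hY hx hρ hc hg, Finset.card_singleton], hρ⟩

theorem Tight.exists_gate {ρ : V} {W : Set V} (h : S.Tight ρ W) : ∃ g, S.H.inE W = {g} :=
  Finset.card_eq_one.1 h.2.1

/-- By submodularity at most two residual edges enter the intersection and the union together.
Neither count is zero, since a closed set cannot separate `x` from `ρ`; so both are one. -/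
theorem Tight.inter_union {ρ x : V} {A B : Set V} (hA : S.Tight ρ A) (hB : S.Tight ρ B)
    (hc : S.Cls x ρ) (hxA : x ∈ A) (hxB : x ∈ B) :
    S.Tight ρ (A ∩ B) ∧ S.Tight ρ (A ∪ B) := by
  have h1 := card_inE_submodular S.H A B
  rw [hA.2.1, hB.2.1] at h1
  have hρi : ρ ∉ A ∩ B := fun h => hA.2.2 h.1
  have hρu : ρ ∉ A ∪ B := fun h => h.elim hA.2.2 hB.2.2
  have hi : (S.H.inE (A ∩ B)).card ≠ 0 := fun h0 =>
    hρi ((hc _ ⟨hA.1.inter hB.1, Finset.card_eq_zero.1 h0⟩).1 ⟨hxA, hxB⟩)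
  have hu : (S.H.inE (A ∪ B)).card ≠ 0 := fun h0 =>
    hρu ((hc _ ⟨hA.1.union hB.1, Finset.card_eq_zero.1 h0⟩).1 (Or.inl hxA))
  exact ⟨⟨hA.1.inter hB.1, by omega, hρi⟩, ⟨hA.1.union hB.1, by omega, hρu⟩⟩

/-- A path edge that leaves `W` enters it in the residual graph. This is why a path leaves a tight
set only through its gate. -/
theorem mem_inE_of_descent {i p : ℕ} (hi : i < S.k) (hp : p < S.P.len i) {W : Set V}
    (h1 : S.P.vtx i p ∈ W) (h2 : S.P.vtx i (p + 1) ∉ W) : S.P.edge i p ∈ S.H.inE W := by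
  have hat : S.At (S.P.edge i p) i p := ⟨hi, hp, rfl⟩
  rw [mem_H_of_flow hat.isFlowEdge, hat.head, hat.tail]
  exact ⟨h2, h1⟩

omit [Fintype E] in
theorem exists_descent {i p q : ℕ} {W : Set V} (h1 : S.P.vtx i p ∈ W) (hpq : p ≤ q)
    (h2 : S.P.vtx i q ∉ W) : ∃ d, p ≤ d ∧ d < q ∧ S.P.vtx i d ∈ W ∧ S.P.vtx i (d + 1) ∉ W := by
  induction q, hpq using Nat.le_induction with
  | base => exact absurd h1 h2
  | succ q hpq ih =>
    by_cases hq : S.P.vtx i q ∈ W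
    · exact ⟨q, hpq, by omega, hq, h2⟩
    · obtain ⟨d, hd⟩ := ih hq
      exact ⟨d, hd.1, by omega, hd.2.2⟩

theorem gate_of_descent {i p : ℕ} (hi : i < S.k) (hp : p < S.P.len i) {W : Set V} {g : E}
    (hg : S.H.inE W ⊆ {g}) (h1 : S.P.vtx i p ∈ W) (h2 : S.P.vtx i (p + 1) ∉ W) : S.At g i p :=
  ⟨hi, hp, Finset.mem_singleton.1 (hg (mem_inE_of_descent hi hp h1 h2))⟩

/-- Cutting `W` with a closed set that contains `ρ`, or joining it with one that does not, still
separates `x` from `ρ`. The result must be entered by some residual edge, and only `g` can do so;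
this locates both ends of `g`. -/
theorem Tight.cls_gate {ρ x : V} {W : Set V} {g : E} (hW : S.Tight ρ W) (hx : x ∈ W)
    (hc : S.Cls x ρ) (hg : S.H.inE W = {g}) :
    S.Cls (S.H.tail g) ρ ∧ S.Cls (S.H.head g) ρ := by
  classical
  have key : ∀ X, S.Closed X →
      (S.H.tail g ∈ X ↔ ρ ∈ X) ∧ (S.H.head g ∈ X ↔ ρ ∈ X) := by
    intro X hX
    have hcl : S.H.head g ∈ X → S.H.tail g ∈ X := by
      intro h
      by_contra h'
      have := mem_inE.2 ⟨h', h⟩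
      rw [hX.2] at this
      simp at this
    by_cases hρ : ρ ∈ X
    · have hsub := inE_inter_subset S.H W X
      rw [hX.2, hg, Finset.union_empty] at hsub
      have := inE_eq_of_subset (hW.1.inter hX.1) ⟨hx, (hc X hX).2 hρ⟩
        (fun h => hW.2.2 h.1) hc hsub
      have hh : g ∈ S.H.inE (W ∩ X) := by rw [this]; simp
      have := (mem_inE.1 hh).2.2
      simp [hρ, this, hcl this]
    · have hsub := inE_union_subset S.H W X
      rw [hX.2, hg, Finset.union_empty] at hsub
      have := inE_eq_of_subset (hW.1.union hX.1) (Or.inl hx)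
        (fun h => h.elim hW.2.2 hρ) hc hsub
      have hh : g ∈ S.H.inE (W ∪ X) := by rw [this]; simp
      have : S.H.tail g ∉ X := fun h => (mem_inE.1 hh).1 (Or.inr h)
      simp [hρ, this, mt hcl this]
  exact ⟨fun X hX => (key X hX).1, fun X hX => (key X hX).2⟩

/-! ### Hulls, cells and common cuts. -/

variable (S)

/-- Some tight set contains `X` but not `u`. -/
def Sep (ρ : V) (X : Set V) (u : V) : Prop := ∃ W, S.Tight ρ W ∧ X ⊆ W ∧ u ∉ W

/-- The least tight set that contains `X`, or everything. -/
def hull (ρ : V) (X : Set V) : Set V := {u | ¬ S.Sep ρ X u}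

/-- The greatest tight set that contains the head but not the tail of `e`, or nothing. -/
def cell (ρ : V) (e : E) : Set V := {x | S.Sep ρ {S.G.head e, x} (S.G.tail e)}

variable {S}

theorem Sep.mono {ρ u : V} {X Y : Set V} (h : S.Sep ρ X u) (hY : Y ⊆ X) : S.Sep ρ Y u := by
  obtain ⟨W, hW, hX, hu⟩ := h
  exact ⟨W, hW, hY.trans hX, hu⟩

theorem sep_pair {ρ x y u : V} :
    S.Sep ρ {x, y} u ↔ ∃ W, S.Tight ρ W ∧ x ∈ W ∧ y ∈ W ∧ u ∉ W := by
  simp only [Sep, Set.insert_subset_iff, Set.singleton_subset_iff, and_assoc]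

theorem sep_singleton {ρ x u : V} :
    S.Sep ρ {x} u ↔ ∃ W, S.Tight ρ W ∧ x ∈ W ∧ u ∉ W := by
  simp only [Sep, Set.singleton_subset_iff]

theorem Tight.hull [Finite V] {ρ x u : V} {X : Set V} (hx : x ∈ X) (hc : S.Cls x ρ)
    (hu : S.Sep ρ X u) : S.Tight ρ (S.hull ρ X) := by
  have := least_of_inter (F := fun W => S.Tight ρ W ∧ X ⊆ W)
    (by obtain ⟨W, h1, h2, _⟩ := hu; exact ⟨W, h1, h2⟩)
    (fun A B hA hB => ⟨(hA.1.inter_union hB.1 hc (hA.2 hx) (hB.2 hx)).1,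
      Set.subset_inter hA.2 hB.2⟩)
  convert this.1 using 1
  ext v
  constructor
  · intro h W hW
    by_contra hv
    exact h ⟨W, hW.1, hW.2, hv⟩
  · rintro h ⟨W, h1, h2, h3⟩
    exact h3 (h W ⟨h1, h2⟩)

theorem subset_hull {ρ : V} {X : Set V} : X ⊆ S.hull ρ X :=
  fun _ hx ⟨_, _, h1, h2⟩ => h2 (h1 hx)

theorem hull_subset {ρ : V} {X W : Set V} (hW : S.Tight ρ W) (h : X ⊆ W) : S.hull ρ X ⊆ W := by
  intro x hx
  by_contra hxW
  exact hx ⟨W, hW, h, hxW⟩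

/-- All candidates share the head of `e`, which lies in the class of `ρ`, so the family is closed
under union. The hypothesis `he` makes it nonempty; without it the cell is empty. -/
theorem Tight.cell [Finite V] {ρ : V} {e : E} (hc : S.Cls (S.G.head e) ρ)
    (he : S.Sep ρ {S.G.head e} (S.G.tail e)) :
    S.Tight ρ (S.cell ρ e) ∧ S.G.head e ∈ S.cell ρ e ∧ S.G.tail e ∉ S.cell ρ e := by
  have := greatest_of_union
    (F := fun W => S.Tight ρ W ∧ S.G.head e ∈ W ∧ S.G.tail e ∉ W)
    (by obtain ⟨W, h1, h2, h3⟩ := he; exact ⟨W, h1, h2 rfl, h3⟩)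
    (fun A B hA hB => ⟨(hA.1.inter_union hB.1 hc hA.2.1 hB.2.1).2, Or.inl hA.2.1,
      fun h => h.elim hA.2.2 hB.2.2⟩)
  convert this using 4 <;>
  · ext x
    simp only [FlowGraph.cell, sep_pair]
    exact ⟨fun ⟨W, h1, h2, h3, h4⟩ => ⟨W, ⟨h1, h2, h4⟩, h3⟩,
      fun ⟨W, ⟨h1, h2, h4⟩, h3⟩ => ⟨W, h1, h2, h3, h4⟩⟩

theorem mem_cell_iff {ρ x : V} {e : E} :
    x ∈ S.cell ρ e ↔ S.Sep ρ {S.G.head e, x} (S.G.tail e) := Iff.rfl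

theorem subset_cell {ρ : V} {e : E} {W : Set V} (hW : S.Tight ρ W) (h1 : S.G.head e ∈ W)
    (h2 : S.G.tail e ∉ W) : W ⊆ S.cell ρ e :=
  fun _ hx => sep_pair.2 ⟨W, hW, h1, hx, h2⟩

variable (S) in
/-- `e` and `f` both lie in one cut of size `k + 1` whose sink side avoids `ρ`. -/
def Common (ρ : V) (e f : E) : Prop :=
  ∃ W, S.Tight ρ W ∧ S.G.head e ∈ W ∧ S.G.tail e ∉ W ∧ S.G.head f ∈ W ∧ S.G.tail f ∉ W

/-- Each membership supplies a tight set that contains both heads and avoids one of the tails; their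
intersection avoids both tails. -/
theorem common_iff {ρ : V} {e f : E} (he : S.Cls (S.G.head e) ρ) :
    S.Common ρ e f ↔ S.G.head f ∈ S.cell ρ e ∧ S.G.head e ∈ S.cell ρ f := by
  rw [mem_cell_iff, mem_cell_iff, sep_pair, sep_pair]
  constructor
  · rintro ⟨W, hW, h1, h2, h3, h4⟩
    exact ⟨⟨W, hW, h1, h3, h2⟩, ⟨W, hW, h3, h1, h4⟩⟩
  · rintro ⟨⟨W, hW, h1, h3, h2⟩, ⟨W', hW', h3', h1', h4'⟩⟩
    exact ⟨W ∩ W', (hW.inter_union hW' he h1 h1').1, ⟨h1, h1'⟩, fun h => h2 h.1, ⟨h3, h3'⟩,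
      fun h => h4' h.2⟩

/-! ### A membership test that needs few stored cells. -/

variable (S) in
/-- The position of the last vertex of path `i` in the class of `ρ`. -/
noncomputable def lastPos (i : ℕ) (ρ : V) : ℕ :=
  open Classical in Nat.findGreatest (fun p => S.Cls (S.P.vtx i p) ρ) (S.P.len i)

variable (S) in
/-- The last vertex of path `i` in the class of `ρ`. -/
noncomputable def last (i : ℕ) (ρ : V) : V := S.P.vtx i (S.lastPos i ρ)

theorem lastPos_le (i : ℕ) (ρ : V) : S.lastPos i ρ ≤ S.P.len i := by
  classical exact Nat.findGreatest_le _

theorem le_lastPos {i p : ℕ} {ρ : V} (hp : p ≤ S.P.len i) (h : S.Cls (S.P.vtx i p) ρ) :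
    p ≤ S.lastPos i ρ := by
  classical exact Nat.le_findGreatest hp h

theorem cls_last {i p : ℕ} {ρ : V} (hp : p ≤ S.P.len i) (h : S.Cls (S.P.vtx i p) ρ) :
    S.Cls (S.last i ρ) ρ := by
  classical
  exact Nat.findGreatest_spec (P := fun p => S.Cls (S.P.vtx i p) ρ) hp h

variable (S) in
/-- A path edge whose path leaves again the least tight set that contains the head. -/
def Special (ρ : V) (e : E) : Prop := ∃ i p, S.At e i p ∧ S.Sep ρ {S.G.head e} (S.last i ρ)

variable (S) in
/-- The edges whose cells are stored explicitly. -/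
def HasRow (ρ : V) (e : E) : Prop :=
  (¬ S.IsFlowEdge e ∧ S.Sep ρ {S.G.head e} (S.G.tail e)) ∨ S.Special ρ e

variable (S) in
/-- A test for `f` having its head in the cell of `e`. -/
def HeadTest (ρ : V) (e f : E) : Prop :=
  (S.HasRow ρ e ∧ S.IsFlowEdge f ∧ S.G.head f ∈ S.cell ρ e) ∨
    ∃ i p, S.At e i p ∧ S.Sep ρ {S.G.head e, S.last i ρ} (S.G.tail e) ∧
      S.Sep ρ {S.G.head f, S.last i ρ} (S.G.tail e)

/-- In the second alternative the two tight sets share the last vertex of the path in the class, so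
their union is a tight set that witnesses the membership. -/
theorem HeadTest.mem_cell {ρ : V} {e f : E} (hc : S.Cls (S.G.head e) ρ)
    (h : S.HeadTest ρ e f) : S.G.head f ∈ S.cell ρ e := by
  rcases h with h | ⟨i, p, hat, h1, h2⟩
  · exact h.2.2
  · rw [sep_pair] at h1 h2
    obtain ⟨W, hW, a1, a2, a3⟩ := h1
    obtain ⟨W', hW', b1, b2, b3⟩ := h2
    rw [hat.head] at hc
    exact sep_pair.2 ⟨W ∪ W',
      (hW.inter_union hW' (cls_last hat.2.1 hc) a2 b2).2, Or.inl a1, Or.inr b1,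
      fun h => h.elim a3 b3⟩

/-- If the path of `e` has its last class vertex inside `W`, then `W` itself serves for the second
alternative. Otherwise the path leaves `W` through the gate, or `e` is off the paths and is the
gate. In both cases the gate is accounted for, `f` must be a path edge, and the cell of `e` is
stored. -/
theorem Common.headTest {ρ : V} {e f : E} (hef : e ≠ f) (hc : S.Cls (S.G.head e) ρ)
    (h : S.Common ρ e f) : S.HeadTest ρ e f := by
  obtain ⟨W, hW, h1, h2, h3, h4⟩ := h
  obtain ⟨g, hg⟩ := hW.exists_gate
  have hcell : S.G.head f ∈ S.cell ρ e := subset_cell hW h1 h2 h3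
  have hflow : ∀ g', g' ∈ S.H.inE W → g' ≠ f → S.IsFlowEdge f := by
    intro g' hg' hne
    by_contra hf
    have := (mem_H_of_not hf).2 ⟨h4, h3⟩
    rw [hg, Finset.mem_singleton] at this hg'
    exact hne (hg'.trans this.symm)
  by_cases he : S.IsFlowEdge e
  · obtain ⟨i, p, hat⟩ := he
    by_cases hq : S.last i ρ ∈ W
    · exact Or.inr ⟨i, p, hat, sep_pair.2 ⟨W, hW, h1, hq, h2⟩, sep_pair.2 ⟨W, hW, h3, hq, h2⟩⟩
    · refine Or.inl ⟨Or.inr ⟨i, p, hat, sep_singleton.2 ⟨W, hW, h1, hq⟩⟩, ?_, hcell⟩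
      rw [hat.head] at h1 hc
      obtain ⟨d, hd1, hd2, hd3, hd4⟩ := exists_descent h1 (le_lastPos hat.2.1 hc) hq
      have hdl : d < S.P.len i := hd2.trans_le (lastPos_le i ρ)
      by_contra hf
      refine hf (hflow _ (mem_inE_of_descent hat.1 hdl hd3 hd4) ?_)
      rintro rfl
      exact hf ⟨i, d, hat.1, hdl, rfl⟩
  · exact Or.inl ⟨Or.inl ⟨he, sep_singleton.2 ⟨W, hW, h1, h2⟩⟩,
      hflow e ((mem_H_of_not he).2 ⟨h2, h1⟩) hef, hcell⟩

/-- Two tests decide whether `e` and `f` lie in a common cut of size `k + 1`. -/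
theorem common_iff_headTest {ρ : V} {e f : E} (hef : e ≠ f) (he : S.Cls (S.G.head e) ρ)
    (hf : S.Cls (S.G.head f) ρ) :
    S.Common ρ e f ↔ S.HeadTest ρ e f ∧ S.HeadTest ρ f e := by
  constructor
  · intro h
    refine ⟨h.headTest hef he, Common.headTest hef.symm hf ?_⟩
    obtain ⟨W, hW, h1, h2, h3, h4⟩ := h
    exact ⟨W, hW, h3, h4, h1, h2⟩
  · rintro ⟨h1, h2⟩
    exact (common_iff he).2 ⟨h1.mem_cell he, h2.mem_cell hf⟩

/-- Both paths leave the hull of the common head, hence both contain its single gate. They are the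
same path by edge-disjointness, and a simple path enters a vertex only once. -/
theorem Special.unique [Finite V] {ρ : V} {e f : E} (hc : S.Cls (S.G.head e) ρ)
    (he : S.Special ρ e) (hf : S.Special ρ f) (h : S.G.head e = S.G.head f) : e = f := by
  obtain ⟨i, p, hat, hs⟩ := he
  obtain ⟨j, q, hat', hs'⟩ := hf
  have hN := Tight.hull (Set.mem_singleton _) hc hs
  obtain ⟨g, hg⟩ := hN.exists_gate
  have key : ∀ {a : E} {i p : ℕ}, S.At a i p → S.G.head a = S.G.head e →
      S.Sep ρ {S.G.head a} (S.last i ρ) → ∃ d, S.At g i d := by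
    intro a i p hat hae hs
    rw [hae] at hs
    have h1 : S.P.vtx i (p + 1) ∈ S.hull ρ {S.G.head e} := by
      rw [← hat.head, hae]; exact subset_hull rfl
    obtain ⟨d, hd1, hd2, hd3, hd4⟩ := exists_descent h1
      (le_lastPos hat.2.1 (by rwa [← hat.head, hae])) (fun h => h hs)
    exact ⟨d, gate_of_descent hat.1 (hd2.trans_le (lastPos_le i ρ)) hg.le hd3 hd4⟩
  obtain ⟨d, hd⟩ := key hat rfl hs
  obtain ⟨d', hd'⟩ := key hat' h.symm hs'
  obtain ⟨rfl, _⟩ := hd.unique hd'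
  rw [hat.head, hat'.head] at h
  have := S.P.vtx_inj i hat.1 _ hat.2.1 _ hat'.2.1 h
  have hpq : p = q := by omega
  subst hpq
  exact hat.2.2.symm.trans hat'.2.2

/-- Both edges enter the intersection of two tight sets around the common head in the residual
graph, so both are its gate. -/
theorem nonflow_unique {ρ : V} {e f : E} (hc : S.Cls (S.G.head e) ρ)
    (he : ¬ S.IsFlowEdge e) (hf : ¬ S.IsFlowEdge f) (he' : S.Sep ρ {S.G.head e} (S.G.tail e))
    (hf' : S.Sep ρ {S.G.head f} (S.G.tail f)) (h : S.G.head e = S.G.head f) : e = f := by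
  obtain ⟨W, hW, h1, h2⟩ := sep_singleton.1 he'
  obtain ⟨W', hW', h1', h2'⟩ := sep_singleton.1 hf'
  have hI := (hW.inter_union hW' hc h1 (h ▸ h1')).1
  obtain ⟨g, hg⟩ := hI.exists_gate
  have a1 := (mem_H_of_not he (W := W ∩ W')).2 ⟨fun h => h2 h.1, h1, h ▸ h1'⟩
  have a2 := (mem_H_of_not hf (W := W ∩ W')).2 ⟨fun h => h2' h.2, h ▸ h1, h1'⟩
  rw [hg, Finset.mem_singleton] at a1 a2
  exact a1.trans a2.symm

/-- Recursive description of a cell. -/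
theorem mem_cell_iff_gate [Finite V] {ρ x : V} {e g' : E} (hc : S.Cls (S.G.head e) ρ)
    (hx : S.Cls x ρ) (he : S.Sep ρ {S.G.head e} (S.G.tail e))
    (hg' : S.H.inE (S.cell ρ e) = {g'}) :
    x ∈ S.cell ρ e ↔ ∃ g, S.H.inE (S.hull ρ {x}) = {g} ∧
      (S.IsFlowEdge e → S.G.tail e ∉ S.hull ρ {x}) ∧ (g = g' ∨ S.H.tail g ∈ S.cell ρ e) := by
  classical
  obtain ⟨hT, hhead, htail⟩ := Tight.cell hc he
  constructor
  · intro h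
    have hs : S.Sep ρ {x} (S.G.tail e) := Sep.mono h (by simp)
    obtain ⟨g, hg⟩ := (Tight.hull (Set.mem_singleton _) hx hs).exists_gate
    refine ⟨g, hg, fun _ h' => h' hs, ?_⟩
    -- The hull lies inside the cell. If the tail of `g` is outside the cell, then `g` enters the
    -- cell too and must be its gate.
    by_contra! hcon
    have hgm : g ∈ S.H.inE (S.hull ρ {x}) := by rw [hg]; simp
    have : g ∈ S.H.inE (S.cell ρ e) := mem_inE.2 ⟨hcon.2,
      hull_subset hT (by simpa using h) (mem_inE.1 hgm).2⟩
    rw [hg', Finset.mem_singleton] at this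
    exact hcon.1 this
  · rintro ⟨g, hg, hfl, hor⟩
    have hN : S.Tight ρ (S.hull ρ {x}) := by
      have hgm : g ∈ S.H.inE (S.hull ρ {x}) := by rw [hg]; simp
      exact Tight.hull (Set.mem_singleton _) hx (not_not.1 (mem_inE.1 hgm).1)
    have hxY : x ∈ S.cell ρ e ∪ S.hull ρ {x} := Or.inr (subset_hull rfl)
    have hρY : ρ ∉ S.cell ρ e ∪ S.hull ρ {x} := fun h => h.elim hT.2.2 hN.2.2
    -- The gate of the hull is either that of the cell or starts inside the cell, so only `g'` can
    -- enter the union.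
    have hsub : S.H.inE (S.cell ρ e ∪ S.hull ρ {x}) ⊆ {g'} := by
      intro a ha
      have := inE_union_subset _ _ _ ha
      rw [hg', hg, Finset.mem_union, Finset.mem_singleton, Finset.mem_singleton] at this
      rcases this with rfl | rfl
      · simp
      · rcases hor with rfl | h
        · simp
        · exact absurd (Or.inl h) (mem_inE.1 ha).1
    have hY := Tight.of_subset (hT.1.union hN.1) hxY hρY hx hsub
    refine subset_cell hY (Or.inl hhead) (fun h => ?_) hxY
    rcases h with h | h
    · exact htail h
    · by_cases hf : S.IsFlowEdge e
      · exact hfl hf h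
      -- An edge off the paths is itself the gate of its cell and of the union. It would not enter
      -- the union if the hull contained its tail; hence the condition on the tail is needed for
      -- path edges only.
      · have h1 := (mem_H_of_not hf).2 ⟨htail, hhead⟩
        rw [hg', Finset.mem_singleton] at h1
        have h2 : e ∈ S.H.inE (S.cell ρ e ∪ S.hull ρ {x}) := by
          rw [inE_eq_of_subset hY.1 hxY hρY hx hsub, h1]; simp
        rw [mem_H_of_not hf] at h2
        exact h2.1 (Or.inr h)

open Classical in
variable (S) in
/-- The number of edges through which tight sets containing `x` are entered. -/
noncomputable def depth (ρ x : V) : ℕ :=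
  (Finset.univ.filter fun h => ∃ W, S.Tight ρ W ∧ x ∈ W ∧ S.H.inE W = {h}).card

/-- Every tight set around the tail of `g`, joined with the hull of `x`, becomes a tight set around
`x` with the same gate. The edge `g` is counted for `x` but not for its own tail, so the recursion
through gates is well-founded. -/
theorem depth_lt [Finite V] {ρ x : V} {g : E} (hx : S.Cls x ρ)
    (hg : S.H.inE (S.hull ρ {x}) = {g}) :
    S.Cls (S.H.tail g) ρ ∧ S.depth ρ (S.H.tail g) < S.depth ρ x := by
  classical
  have hgm : g ∈ S.H.inE (S.hull ρ {x}) := by rw [hg]; simp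
  have hN : S.Tight ρ (S.hull ρ {x}) := Tight.hull (Set.mem_singleton _) hx (not_not.1 (mem_inE.1 hgm).1)
  have hxN : x ∈ S.hull ρ {x} := subset_hull rfl
  refine ⟨(hN.cls_gate hxN hx hg).1, Finset.card_lt_card ?_⟩
  rw [Finset.ssubset_iff_of_subset]
  · refine ⟨g, by simpa using ⟨_, hN, hxN, hg⟩, ?_⟩
    simp only [Finset.mem_filter, Finset.mem_univ, true_and, not_exists, not_and]
    intro W hW hgW hgg
    have : g ∈ S.H.inE W := by rw [hgg]; simp
    exact (mem_inE.1 this).1 hgW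
  · intro h
    simp only [Finset.mem_filter, Finset.mem_univ, true_and]
    rintro ⟨W, hW, hgW, hh⟩
    have hsub : S.H.inE (W ∪ S.hull ρ {x}) ⊆ {h} := by
      intro a ha
      have := inE_union_subset _ _ _ ha
      rw [hh, hg, Finset.mem_union, Finset.mem_singleton, Finset.mem_singleton] at this
      rcases this with rfl | rfl
      · simp
      · exact absurd (Or.inl hgW) (mem_inE.1 ha).1
    have hρ : ρ ∉ W ∪ S.hull ρ {x} := fun h => h.elim hW.2.2 hN.2.2
    exact ⟨_, Tight.of_subset (hW.1.union hN.1) (Or.inr hxN) hρ hx hsub, Or.inr hxN,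
      inE_eq_of_subset (hW.1.union hN.1) (Or.inr hxN) hρ hx hsub⟩

/-! ### Cuts of size `k` -/

variable (S) in
/-- Some closed set contains `x` but not `u`. -/
def CSep (x u : V) : Prop := ∃ W, S.Closed W ∧ x ∈ W ∧ u ∉ W

variable (S) in
/-- The least closed set that contains `x`, or everything. -/
def chull (x : V) : Set V := {u | ¬ S.CSep x u}

theorem Closed.chull [Finite V] {x u : V} (h : S.CSep x u) : S.Closed (S.chull x) := by
  have := least_of_inter (F := fun W => S.Closed W ∧ x ∈ W)
    (by obtain ⟨W, h1, h2, _⟩ := h; exact ⟨W, h1, h2⟩)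
    (fun A B hA hB => ⟨hA.1.inter hB.1, hA.2, hB.2⟩)
  convert this.1 using 1
  ext v
  constructor
  · intro h W hW
    by_contra hv
    exact h ⟨W, hW.1, hW.2, hv⟩
  · rintro h ⟨W, h1, h2, h3⟩
    exact h3 (h W ⟨h1, h2⟩)

/-- Membership in a least closed set is a preorder whose equivalence classes are those of `Cls`;
`level` is monotone for it, and equal levels of comparable vertices force equivalence. -/
theorem chull_subset_of_mem {x y : V} (h : y ∈ S.chull x) : S.chull y ⊆ S.chull x := by
  rintro z hz ⟨W, hW, h1, h2⟩
  refine hz ⟨W, hW, ?_, h2⟩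
  by_contra hy
  exact h ⟨W, hW, h1, hy⟩

theorem mem_chull_self (x : V) : x ∈ S.chull x := fun ⟨_, _, h1, h2⟩ => h2 h1

theorem cls_of_chull_eq {x y : V} (h : S.chull x = S.chull y) : S.Cls x y := by
  intro W hW
  have h1 : x ∈ S.chull y := h ▸ mem_chull_self x
  have h2 : y ∈ S.chull x := h ▸ mem_chull_self y
  constructor
  · intro hx
    by_contra hy
    exact h2 ⟨W, hW, hx, hy⟩
  · intro hy
    by_contra hx
    exact h1 ⟨W, hW, hy, hx⟩

theorem Cls.chull_eq {x y : V} (h : S.Cls x y) : S.chull x = S.chull y := by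
  ext z
  simp only [chull, CSep, Set.mem_ofPred_eq]
  refine not_congr (exists_congr fun W => and_congr_right fun hW => ?_)
  rw [h W hW]

variable (S) in
/-- A linear preorder that extends the order of the classes. -/
noncomputable def level (x : V) : ℕ := (S.chull x).ncard

theorem level_le_of_mem [Finite V] {x y : V} (h : y ∈ S.chull x) : S.level y ≤ S.level x :=
  Set.ncard_le_ncard (chull_subset_of_mem h)

theorem cls_of_level_eq [Finite V] {x y : V} (h : y ∈ S.chull x) (hl : S.level x ≤ S.level y) :
    S.Cls y x :=
  cls_of_chull_eq (Set.eq_of_subset_of_ncard_le (chull_subset_of_mem h) hl)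

variable (S) in
open Classical in
/-- The set `W` within the class of `ρ`, and all lower classes. -/
def align (ρ : V) (W : Set V) : Set V :=
  {x | if S.Cls x ρ then x ∈ W else S.level x < S.level ρ}

theorem mem_align_of_cls {ρ x : V} {W : Set V} (h : S.Cls x ρ) :
    x ∈ S.align ρ W ↔ x ∈ W := by simp [align, h]

theorem mem_align_of_not {ρ x : V} {W : Set V} (h : ¬ S.Cls x ρ) :
    x ∈ S.align ρ W ↔ S.level x < S.level ρ := by simp [align, h]

/-- No residual edge enters a closed set, so its tail is never on a higher level than its head, and
is strictly lower unless both are in one class. An edge entering the aligned set therefore has both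
ends in the class of `ρ`, where the set agrees with `W`. -/
theorem Tight.align [Finite V] {ρ : V} {W : Set V} (hW : S.Tight ρ W) :
    Valid S.s S.t (S.align ρ W) ∧ S.H.inE (S.align ρ W) ⊆ S.H.inE W := by
  have hs : ∀ x, x ∈ S.chull S.s := fun x ⟨W, h1, h2, _⟩ => h1.1.1 h2
  have ht : ∀ x, S.t ∈ S.chull x := fun x ⟨W, h1, _, h2⟩ => h2 h1.1.2
  refine ⟨⟨?_, ?_⟩, ?_⟩
  · by_cases h : S.Cls S.s ρ
    · rw [mem_align_of_cls h]; exact hW.1.1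
    · rw [mem_align_of_not h, not_lt]; exact level_le_of_mem (hs ρ)
  · by_cases h : S.Cls S.t ρ
    · rw [mem_align_of_cls h]; exact hW.1.2
    · rw [mem_align_of_not h]
      by_contra hlt
      exact h (cls_of_level_eq (ht ρ) (not_lt.1 hlt))
  · intro a ha
    obtain ⟨h1, h2⟩ := mem_inE.1 ha
    have hch : S.H.tail a ∈ S.chull (S.H.head a) := by
      rintro ⟨X, hX, b1, b2⟩
      have := mem_inE.2 ⟨b2, b1⟩
      rw [hX.2] at this
      simp at this
    have hle := level_le_of_mem hch
    by_cases hh : S.Cls (S.H.head a) ρ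
    · have hlρ : S.level (S.H.head a) = S.level ρ := by rw [level, level, hh.chull_eq]
      by_cases htl : S.Cls (S.H.tail a) ρ
      · rw [mem_align_of_cls htl] at h1
        rw [mem_align_of_cls hh] at h2
        exact mem_inE.2 ⟨h1, h2⟩
      · rw [mem_align_of_not htl] at h1
        exact absurd ((cls_of_level_eq hch (by omega)).trans hh) htl
    · rw [mem_align_of_not hh] at h2
      by_cases htl : S.Cls (S.H.tail a) ρ
      · have hlρ : S.level (S.H.tail a) = S.level ρ := by rw [level, level, htl.chull_eq]
        omega
      · rw [mem_align_of_not htl] at h1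
        omega

variable (S) in
/-- `e` lies in a cut of size `k`. -/
def InMinCut (e : E) : Prop := S.CSep (S.G.head e) (S.G.tail e)

theorem InMinCut.isFlowEdge {e : E} (h : S.InMinCut e) : S.IsFlowEdge e := by
  obtain ⟨W, hW, h1, h2⟩ := h
  by_contra hf
  have := (mem_H_of_not hf).2 ⟨h2, h1⟩
  rw [hW.2] at this
  simp at this

/-- Reversed in the residual graph, a path edge cannot leave a closed set forwards; if it also
enters none, no minimum cut separates its ends. -/
theorem cls_of_not_inMinCut {e : E} (hf : S.IsFlowEdge e) (h : ¬ S.InMinCut e) :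
    S.Cls (S.G.tail e) (S.G.head e) := by
  intro W hW
  constructor
  · intro h1
    by_contra h2
    have := (mem_H_of_flow hf).2 ⟨h2, h1⟩
    rw [hW.2] at this
    simp at this
  · intro h1
    by_contra h2
    exact h ⟨W, hW, h1, h2⟩

/-- Two edges of a cut of size `k + 1` that lie in no cut of size `k` belong to one class. -/
theorem cls_head_of_card {e f : E} (hef : e ≠ f) (he : ¬ S.InMinCut e) (hf : ¬ S.InMinCut f)
    {W : Set V} (hW : Valid S.s S.t W) (h1 : (S.H.inE W).card = 1)
    (heW : e ∈ S.G.inE W) (hfW : f ∈ S.G.inE W) :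
    S.Cls (S.G.head e) (S.G.head f) ∧ (S.IsFlowEdge e ∨ S.IsFlowEdge f) := by
  classical
  obtain ⟨g, hg⟩ := Finset.card_eq_one.1 h1
  rw [mem_inE] at heW hfW
  have hnf : ∀ a, S.G.tail a ∉ W ∧ S.G.head a ∈ W → ¬ S.IsFlowEdge a → a = g := by
    intro a ha hna
    have := (mem_H_of_not hna).2 ha
    rwa [hg, Finset.mem_singleton] at this
  refine ⟨?_, ?_⟩
  -- Each of the two edges has its head in the same closed sets as the head of the gate `g`.
  · have key : ∀ X, S.Closed X → ∀ a, S.G.tail a ∉ W ∧ S.G.head a ∈ W → ¬ S.InMinCut a →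
        (S.G.head a ∈ X ↔ S.H.head g ∈ X) := by
      intro X hX a ha hna
      have hsub : ∀ Y, S.H.inE Y ⊆ S.H.inE W ∪ S.H.inE X → g ∉ S.H.inE Y → S.H.inE Y = ∅ := by
        intro Y hY hgY
        rw [hX.2, hg, Finset.union_empty] at hY
        rcases Finset.subset_singleton_iff.1 hY with h | h
        · exact h
        · exact absurd (by rw [h]; simp) hgY
      constructor
      · intro haX
        by_contra hgX
        -- The gate misses `W ∩ X`, which is therefore closed and is entered by `a`, contrary to
        -- `hna`.
        refine hna ⟨W ∩ X, ⟨hW.inter hX.1, hsub _ (inE_inter_subset _ _ _) ?_⟩,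
          ⟨ha.2, haX⟩, fun h => ha.1 h.1⟩
        exact fun h => hgX (mem_inE.1 h).2.2
      · intro hgX
        have hgt : S.H.tail g ∈ X := by
          by_contra h
          have := mem_inE.2 ⟨h, hgX⟩
          rw [hX.2] at this
          simp at this
        by_cases haf : S.IsFlowEdge a
        -- Here `X` contains the tail of the gate, so `W ∪ X` is closed. It is not entered by `a`,
        -- which puts the tail of `a` into `X`, and with it the head.
        · have hU : S.Closed (W ∪ X) := ⟨hW.union hX.1,
            hsub _ (inE_union_subset _ _ _) fun h => (mem_inE.1 h).1 (Or.inr hgt)⟩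
          have htl : S.G.tail a ∈ W ∪ X := by
            by_contra h
            exact hna ⟨_, hU, Or.inl ha.2, h⟩
          exact (cls_of_not_inMinCut haf hna X hX).1 (htl.resolve_left ha.1)
        · obtain rfl := hnf a ha haf
          rwa [H_head_of_not haf] at hgX
    exact fun X hX => (key X hX e heW he).trans (key X hX f hfW hf).symm
  · by_contra! hcon
    exact hef ((hnf e heW hcon.1).trans (hnf f hfW hcon.2).symm)

/-- A cut of size `k + 1` through two edges, described class by class. -/
theorem Common.align [Finite V] {ρ : V} {e f : E} (h : S.Common ρ e f)
    (hce : S.Cls (S.G.head e) ρ) (hcf : S.Cls (S.G.head f) ρ)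
    (he : ¬ S.InMinCut e) (hf : ¬ S.InMinCut f) :
    Valid S.s S.t (S.align ρ (S.cell ρ e ∩ S.cell ρ f)) ∧
      (S.H.inE (S.align ρ (S.cell ρ e ∩ S.cell ρ f))).card ≤ 1 ∧
      e ∈ S.G.inE (S.align ρ (S.cell ρ e ∩ S.cell ρ f)) ∧
      f ∈ S.G.inE (S.align ρ (S.cell ρ e ∩ S.cell ρ f)) := by
  obtain ⟨W, hW, h1, h2, h3, h4⟩ := h
  obtain ⟨hTe, he1, he2⟩ := Tight.cell hce (sep_singleton.2 ⟨W, hW, h1, h2⟩)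
  obtain ⟨hTf, hf1, hf2⟩ := Tight.cell hcf (sep_singleton.2 ⟨W, hW, h3, h4⟩)
  have a1 := subset_cell hW h1 h2 h3
  have a2 := subset_cell hW h3 h4 h1
  set Y := S.cell ρ e ∩ S.cell ρ f with hY
  have hT : S.Tight ρ Y := (hTe.inter_union hTf hce he1 a2).1
  obtain ⟨hv, hsub⟩ := hT.align
  obtain ⟨g, hg⟩ := hT.exists_gate
  have key : ∀ a, S.Cls (S.G.head a) ρ → ¬ S.InMinCut a → S.G.head a ∈ Y → S.G.tail a ∉ Y →
      a ∈ S.G.inE (S.align ρ Y) := by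
    intro a hca hna ha1 ha2
    have hct : S.Cls (S.G.tail a) ρ := by
      by_cases haf : S.IsFlowEdge a
      · exact (cls_of_not_inMinCut haf hna).trans hca
      · have := (mem_H_of_not haf).2 ⟨ha2, ha1⟩
        rw [hg, Finset.mem_singleton] at this
        subst this
        have := (hT.cls_gate ha1 hca hg).1
        rwa [H_tail_of_not haf] at this
    rw [mem_inE, mem_align_of_cls hca, mem_align_of_cls hct]
    exact ⟨ha2, ha1⟩
  refine ⟨hv, (Finset.card_le_card hsub).trans hT.2.1.le, ?_, ?_⟩
  · exact key e hce he ⟨he1, a2⟩ fun h => he2 h.1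
  · exact key f hcf hf ⟨a1, hf1⟩ fun h => hf2 h.2

variable (S) in
/-- The greatest closed set that avoids `U`. -/
def cgreatest (U : Set V) : Set V := {x | S.CSep x S.s ∧ ∀ u ∈ U, S.CSep x u}

/-- A vertex lies in some closed set avoiding `U` exactly if its least closed set avoids `U`, which
is tested one vertex of `U` at a time. Separation from `s` guarantees that some closed set contains
the vertex even if `U` is empty. -/
theorem closed_cgreatest [Finite V] {U : Set V} (h : ∃ W, S.Closed W ∧ Disjoint W U) :
    S.Closed (S.cgreatest U) ∧ Disjoint (S.cgreatest U) U := by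
  have := greatest_of_union (F := fun W => S.Closed W ∧ Disjoint W U) h
    (fun A B hA hB => ⟨hA.1.union hB.1, Set.disjoint_union_left.2 ⟨hA.2, hB.2⟩⟩)
  have heq : S.cgreatest U = {x | ∃ W, (S.Closed W ∧ Disjoint W U) ∧ x ∈ W} := by
    ext x
    constructor
    · rintro ⟨h1, h2⟩
      refine ⟨S.chull x, ⟨Closed.chull h1, ?_⟩, mem_chull_self x⟩
      exact Set.disjoint_left.2 fun u hu huU => hu (h2 u huU)
    · rintro ⟨W, ⟨h1, h2⟩, h3⟩
      exact ⟨⟨W, h1, h3, h1.1.1⟩, fun u hu => ⟨W, h1, h3, Set.disjoint_right.1 h2 hu⟩⟩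
  rw [heq]
  exact this

theorem subset_cgreatest {U W : Set V} (h : S.Closed W) (hU : Disjoint W U) :
    W ⊆ S.cgreatest U :=
  fun _ hx => ⟨⟨W, h, hx, h.1.1⟩, fun _ hu => ⟨W, h, hx, Set.disjoint_right.1 hU hu⟩⟩

/-- When two edges lie in a common cut of size `k`. -/
theorem exists_closed_pair_iff {e f : E} :
    (∃ W, S.Closed W ∧ e ∈ S.G.inE W ∧ f ∈ S.G.inE W) ↔
      S.InMinCut e ∧ S.InMinCut f ∧ S.CSep (S.G.head f) (S.G.tail e) ∧
        S.CSep (S.G.head e) (S.G.tail f) := by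
  simp only [mem_inE]
  constructor
  · rintro ⟨W, hW, ⟨h1, h2⟩, h3, h4⟩
    exact ⟨⟨W, hW, h2, h1⟩, ⟨W, hW, h4, h3⟩, ⟨W, hW, h4, h1⟩, ⟨W, hW, h2, h3⟩⟩
  · rintro ⟨⟨W1, c1, a1, b1⟩, ⟨W2, c2, a2, b2⟩, ⟨W3, c3, a3, b3⟩, ⟨W4, c4, a4, b4⟩⟩
    -- `W1` and `W3` avoid the tail of `e`, `W2` and `W4` that of `f`; each union contains both
    -- heads.
    refine ⟨(W1 ∪ W3) ∩ (W2 ∪ W4), (c1.union c3).inter (c2.union c4), ⟨?_, ?_⟩, ?_, ?_⟩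
    · exact fun h => h.1.elim b1 b3
    · exact ⟨Or.inl a1, Or.inr a4⟩
    · exact fun h => h.2.elim b2 b4
    · exact ⟨Or.inr a3, Or.inl a2⟩

end FlowGraph

/-! ## Reversal, and the effect of deleting two edges -/

open MultiDigraph

namespace MultiDigraph

variable {V E : Type}

/-- All edges turned around. -/
def reverse (G : MultiDigraph V E) : MultiDigraph V E where
  tail := G.head
  head := G.tail

/-- The paths run backwards. -/
def PathSystem.reverse {G : MultiDigraph V E} {s t : V} {k : ℕ} (P : G.PathSystem s t k) :
    G.reverse.PathSystem t s k where
  len := P.len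
  vtx i p := P.vtx i (P.len i - p)
  edge i p := P.edge i (P.len i - 1 - p)
  tail_edge i hi p hp := by
    refine (P.head_edge i hi _ (by omega)).trans ?_
    congr 1; omega
  head_edge i hi p hp := by
    refine (P.tail_edge i hi _ (by omega)).trans ?_
    congr 1; omega
  start i hi := P.finish i hi
  finish i hi := by simpa using P.start i hi
  vtx_inj i hi p hp q hq h := by
    have := P.vtx_inj i hi _ (by omega) _ (by omega) h
    omega
  edge_inj i hi j hj p hp q hq h := by
    obtain ⟨rfl, h⟩ := P.edge_inj i hi j hj _ (by omega) _ (by omega) h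
    exact ⟨rfl, by omega⟩

theorem inE_reverse_compl [Fintype E] (G : MultiDigraph V E) (W : Set V) :
    G.reverse.inE Wᶜ = G.inE W := by
  ext e
  simp only [mem_inE, reverse, Set.mem_compl_iff, not_not]
  exact and_comm

theorem Valid.compl {s t : V} {W : Set V} (h : Valid s t W) : Valid t s Wᶜ :=
  ⟨fun h' => h' h.2, h.1⟩

end MultiDigraph

namespace FlowGraph

variable {V E : Type}

/-- The reversed graph. -/
def rev (S : FlowGraph V E) : FlowGraph V E := ⟨S.G.reverse, S.t, S.s, S.k, S.P.reverse⟩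

variable {S : FlowGraph V E}

theorem At.rev {e : E} {i p : ℕ} (h : S.At e i p) : S.rev.At e i (S.P.len i - 1 - p) := by
  refine ⟨h.1, ?_, ?_⟩
  · have : p < S.P.len i := h.2.1
    change S.P.len i - 1 - p < S.P.len i
    omega
  · rw [← h.2.2]
    have := h.2.1
    change S.P.edge i (S.P.len i - 1 - (S.P.len i - 1 - p)) = _
    congr 1; omega

theorem isFlowEdge_rev {e : E} : S.rev.IsFlowEdge e ↔ S.IsFlowEdge e := by
  constructor
  · rintro ⟨i, p, h⟩
    exact ⟨i, S.P.len i - 1 - p, h.1, by have : p < S.P.len i := h.2.1; omega, h.2.2⟩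
  · rintro ⟨i, p, h⟩
    exact h.rev.isFlowEdge

theorem rev_H : S.rev.H = S.H.reverse := by
  have ht : ∀ e, S.rev.H.tail e = S.H.reverse.tail e := by
    intro e
    by_cases h : S.IsFlowEdge e
    · rw [H_tail_of_flow (isFlowEdge_rev.2 h)]; exact (H_head_of_flow h).symm
    · rw [H_tail_of_not (mt isFlowEdge_rev.1 h)]; exact (H_head_of_not h).symm
  have hh : ∀ e, S.rev.H.head e = S.H.reverse.head e := by
    intro e
    by_cases h : S.IsFlowEdge e
    · rw [H_head_of_flow (isFlowEdge_rev.2 h)]; exact (H_tail_of_flow h).symm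
    · rw [H_head_of_not (mt isFlowEdge_rev.1 h)]; exact (H_tail_of_not h).symm
  rcases hA : S.rev.H with ⟨a, b⟩
  rcases hB : S.H.reverse with ⟨c, d⟩
  rw [hA, hB] at ht hh
  rw [show a = c from funext ht, show b = d from funext hh]

variable [Fintype E]

theorem rev_inE_compl {W : Set V} : S.rev.H.inE Wᶜ = S.H.inE W := by
  rw [rev_H, inE_reverse_compl]

theorem closed_rev {W : Set V} : S.rev.Closed Wᶜ ↔ S.Closed W := by
  unfold Closed
  rw [rev_inE_compl]
  refine and_congr_left fun _ => ⟨fun h => ?_, fun h => h.compl⟩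
  exact compl_compl W ▸ h.compl

theorem cls_rev {x y : V} : S.rev.Cls x y ↔ S.Cls x y := by
  constructor
  · intro h W hW
    exact not_iff_not.1 (h Wᶜ (closed_rev.2 hW))
  · intro h W hW
    exact not_iff_not.1 (h Wᶜ (closed_rev.1 (by rwa [compl_compl])))

theorem tight_rev {ρ : V} {W : Set V} (hW : Valid S.s S.t W) (h1 : (S.H.inE W).card = 1)
    (hρ : ρ ∈ W) : S.rev.Tight ρ Wᶜ :=
  ⟨hW.compl, by rw [rev_inE_compl, h1], fun h => h hρ⟩

theorem inMinCut_iff {e : E} : S.InMinCut e ↔ ∃ W, S.Closed W ∧ e ∈ S.G.inE W := by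
  simp only [InMinCut, CSep, mem_inE, and_comm]

theorem inMinCut_rev {e : E} : S.rev.InMinCut e ↔ S.InMinCut e := by
  rw [inMinCut_iff, inMinCut_iff]
  constructor
  · rintro ⟨W, h1, h2⟩
    refine ⟨Wᶜ, closed_rev.1 (by rwa [compl_compl]), ?_⟩
    rw [← inE_reverse_compl, compl_compl]
    exact h2
  · rintro ⟨W, h1, h2⟩
    exact ⟨Wᶜ, closed_rev.2 h1, by rw [← inE_reverse_compl] at h2; exact h2⟩

variable (S) in
/-- The representative of a class. -/
noncomputable def rep (x : V) : V := @Classical.epsilon V ⟨x⟩ fun y => S.Cls y x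

theorem cls_rep (x : V) : S.Cls x (S.rep x) :=
  (Classical.epsilon_spec (p := fun y => S.Cls y x) ⟨x, Cls.refl x⟩).symm

theorem rep_eq_iff {x y : V} : S.rep x = S.rep y ↔ S.Cls x y := by
  constructor
  · intro h
    exact (cls_rep x).trans (h ▸ (cls_rep y).symm)
  · intro h
    unfold rep
    congr 1
    ext z
    exact ⟨fun hz => hz.trans h, fun hz => hz.trans h.symm⟩

/-- The predicate given to `epsilon` depends on the class only, and the classes do not change under
reversal. Both directions thus share their representatives. -/
theorem rep_rev (x : V) : S.rev.rep x = S.rep x := by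
  unfold rep
  congr 1
  ext z
  exact cls_rev

variable (S) in
/-- `e` and `f` have heads in one class, and lie in a common cut of size `k + 1` whose sink side
avoids the representative of that class. -/
def Joint (e f : E) : Prop :=
  S.rep (S.G.head f) = S.rep (S.G.head e) ∧ S.Common (S.rep (S.G.head e)) e f

/-- If `W` contains the representative, its complement avoids it in the reversed graph, where tails
play the role of heads. One of the edges is a path edge whose ends are equivalent, which puts heads
and tails into one class with one representative. -/
theorem joint_or_joint_rev {e f : E} (hef : e ≠ f) (he : ¬ S.InMinCut e) (hf : ¬ S.InMinCut f)
    {W : Set V} (hW : Valid S.s S.t W) (h1 : (S.H.inE W).card = 1)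
    (heW : e ∈ S.G.inE W) (hfW : f ∈ S.G.inE W) : S.Joint e f ∨ S.rev.Joint e f := by
  obtain ⟨hc, hor⟩ := cls_head_of_card hef he hf hW h1 heW hfW
  have heW' := mem_inE.1 heW
  have hfW' := mem_inE.1 hfW
  by_cases hρ : S.rep (S.G.head e) ∈ W
  · right
    have hc' : S.Cls (S.G.tail e) (S.G.tail f) := cls_rev.1 (cls_head_of_card (S := S.rev) hef
      (mt inMinCut_rev.1 he) (mt inMinCut_rev.1 hf) hW.compl (by rw [rev_inE_compl, h1])
      (by rw [← inE_reverse_compl] at heW; exact heW)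
      (by rw [← inE_reverse_compl] at hfW; exact hfW)).1
    have hte : S.Cls (S.G.tail e) (S.G.head e) := by
      rcases hor with h | h
      · exact cls_of_not_inMinCut h he
      · exact (hc'.trans (cls_of_not_inMinCut h hf)).trans hc.symm
    refine ⟨rep_eq_iff.2 (cls_rev.2 hc'.symm), Wᶜ, tight_rev hW h1 ?_, heW'.1,
      fun h => h heW'.2, hfW'.1, fun h => h hfW'.2⟩
    rw [rep_rev]
    change S.rep (S.G.tail e) ∈ W
    rwa [rep_eq_iff.2 hte]
  · left
    exact ⟨rep_eq_iff.2 hc.symm, W, ⟨hW, h1, hρ⟩, heW'.2, heW'.1, hfW'.2, hfW'.1⟩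

theorem Joint.exists_cut {e f : E} (h : S.Joint e f) :
    ∃ W, Valid S.s S.t W ∧ (S.H.inE W).card = 1 ∧ e ∈ S.G.inE W ∧ f ∈ S.G.inE W := by
  obtain ⟨_, W, hW, h1, h2, h3, h4⟩ := h
  exact ⟨W, hW.1, hW.2.1, mem_inE.2 ⟨h2, h1⟩, mem_inE.2 ⟨h4, h3⟩⟩

theorem exists_cut_of_rev {e f : E}
    (h : ∃ W, Valid S.rev.s S.rev.t W ∧ (S.rev.H.inE W).card ≤ 1 ∧ e ∈ S.rev.G.inE W ∧
      f ∈ S.rev.G.inE W) :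
    ∃ W, Valid S.s S.t W ∧ (S.H.inE W).card ≤ 1 ∧ e ∈ S.G.inE W ∧ f ∈ S.G.inE W := by
  obtain ⟨W, hW, h1, h2, h3⟩ := h
  refine ⟨Wᶜ, hW.compl, ?_, ?_, ?_⟩
  · rwa [← rev_inE_compl, compl_compl]
  · rw [← inE_reverse_compl, compl_compl]; exact h2
  · rw [← inE_reverse_compl, compl_compl]; exact h3

/-! ### The minimum cut after the deletion of two edges. -/

section Delete

variable [DecidableEq E]

omit [Fintype E] in
theorem card_sdiff_pair {A : Finset E} {e f : E} (hef : e ≠ f) :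
    (A \ {e, f}).card + ((if e ∈ A then 1 else 0) + (if f ∈ A then 1 else 0)) = A.card := by
  have h := Finset.card_sdiff_add_card_inter A {e, f}
  rw [← h]
  congr 1
  by_cases he : e ∈ A <;> by_cases hf : f ∈ A <;>
    simp [he, hf, Finset.card_pair hef]

/-- The size of a minimum cut after the deletion of two edges. -/
noncomputable def reducedCut (S : FlowGraph V E) (e f : E) : ℕ :=
  open Classical in
  if ∃ W, S.Closed W ∧ e ∈ S.G.inE W ∧ f ∈ S.G.inE W then S.k - 2
  else if S.InMinCut e ∨ S.InMinCut f ∨ S.Joint e f ∨ S.rev.Joint e f then S.k - 1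
  else S.k

/-- A cut with at least two residual edges keeps `k` edges whatever is deleted; the cases are closed
sets, sets with one gate, and the rest. -/
theorem reducedCut_le {e f : E} (hef : e ≠ f) {W : Set V} (hW : Valid S.s S.t W) :
    S.reducedCut e f ≤ (S.G.inE W \ {e, f}).card := by
  classical
  have h := card_sdiff_pair (A := S.G.inE W) hef
  rw [card_inE hW] at h
  unfold reducedCut
  split_ifs with h1 h2
  · split_ifs at h <;> omega
  · by_cases h0 : (S.H.inE W).card = 0
    · have hcl : S.Closed W := ⟨hW, Finset.card_eq_zero.1 h0⟩
      have : ¬ (e ∈ S.G.inE W ∧ f ∈ S.G.inE W) := fun h => h1 ⟨W, hcl, h⟩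
      split_ifs at h <;> first | omega | (exfalso; tauto)
    · split_ifs at h <;> omega
  · push Not at h2
    by_cases h0 : (S.H.inE W).card = 0
    · have hcl : S.Closed W := ⟨hW, Finset.card_eq_zero.1 h0⟩
      have a1 : e ∉ S.G.inE W := fun h => h2.1 (inMinCut_iff.2 ⟨W, hcl, h⟩)
      have a2 : f ∉ S.G.inE W := fun h => h2.2.1 (inMinCut_iff.2 ⟨W, hcl, h⟩)
      simp only [a1, a2, if_false] at h
      omega
    · by_cases h3 : (S.H.inE W).card = 1
      · have : ¬ (e ∈ S.G.inE W ∧ f ∈ S.G.inE W) := fun h =>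
          (joint_or_joint_rev hef h2.1 h2.2.1 hW h3 h.1 h.2).elim h2.2.2.1 h2.2.2.2
        split_ifs at h <;> first | omega | (exfalso; tauto)
      · split_ifs at h <;> omega

variable (S) in
/-- `W` is the sink side of a minimum cut after the deletion of `e` and `f`. -/
def Optimal (e f : E) (W : Set V) : Prop :=
  Valid S.s S.t W ∧ (S.G.inE W \ {e, f}).card ≤ S.reducedCut e f

theorem optimal_of_closed {e f : E} (hef : e ≠ f) {W : Set V} (hW : S.Closed W)
    (h2 : (∃ W, S.Closed W ∧ e ∈ S.G.inE W ∧ f ∈ S.G.inE W) → e ∈ S.G.inE W ∧ f ∈ S.G.inE W)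
    (h1 : S.InMinCut e ∨ S.InMinCut f → e ∈ S.G.inE W ∨ f ∈ S.G.inE W)
    (h0 : S.Joint e f ∨ S.rev.Joint e f → S.InMinCut e ∨ S.InMinCut f) :
    S.Optimal e f W := by
  classical
  refine ⟨hW.1, ?_⟩
  have h := card_sdiff_pair (A := S.G.inE W) hef
  rw [card_inE hW.1, hW.2, Finset.card_empty] at h
  unfold reducedCut
  split_ifs with a1 a2
  · obtain ⟨b1, b2⟩ := h2 a1
    simp only [b1, b2, if_true] at h
    omega
  · have : e ∈ S.G.inE W ∨ f ∈ S.G.inE W := h1 (by tauto)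
    split_ifs at h <;> first | omega | (exfalso; tauto)
  · split_ifs at h <;> omega

theorem optimal_of_card_le_one {e f : E} (hef : e ≠ f) {W : Set V} (hW : Valid S.s S.t W)
    (hc : (S.H.inE W).card ≤ 1) (he : e ∈ S.G.inE W) (hf : f ∈ S.G.inE W)
    (h0 : ¬ ∃ W, S.Closed W ∧ e ∈ S.G.inE W ∧ f ∈ S.G.inE W)  :
    S.Optimal e f W := by
  classical
  refine ⟨hW, ?_⟩
  have h := card_sdiff_pair (A := S.G.inE W) hef
  rw [card_inE hW] at h
  simp only [he, hf, if_true] at h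
  unfold reducedCut
  split_ifs <;> omega

theorem exists_optimal {e f : E} (hef : e ≠ f) (hcl : ∃ W, S.Closed W) :
    ∃ W, S.Optimal e f W := by
  classical
  by_cases h2 : ∃ W, S.Closed W ∧ e ∈ S.G.inE W ∧ f ∈ S.G.inE W
  · obtain ⟨W, hW, h⟩ := h2
    exact ⟨W, optimal_of_closed hef hW (fun _ => h) (fun _ => Or.inl h.1)
      fun _ => Or.inl (inMinCut_iff.2 ⟨W, hW, h.1⟩)⟩
  · by_cases h1 : S.InMinCut e ∨ S.InMinCut f
    · have : ∃ W, S.Closed W ∧ (e ∈ S.G.inE W ∨ f ∈ S.G.inE W) := by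
        rw [inMinCut_iff, inMinCut_iff] at h1
        rcases h1 with ⟨W, hW, h⟩ | ⟨W, hW, h⟩
        · exact ⟨W, hW, Or.inl h⟩
        · exact ⟨W, hW, Or.inr h⟩
      obtain ⟨W, hW, h⟩ := this
      exact ⟨W, optimal_of_closed hef hW (fun h => absurd h h2) (fun _ => h) fun _ => h1⟩
    · by_cases h0 : S.Joint e f ∨ S.rev.Joint e f
      · have : ∃ W, Valid S.s S.t W ∧ (S.H.inE W).card ≤ 1 ∧ e ∈ S.G.inE W ∧ f ∈ S.G.inE W := by
          rcases h0 with h | h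
          · obtain ⟨W, a, b, c⟩ := h.exists_cut
            exact ⟨W, a, b.le, c⟩
          · obtain ⟨W, a, b, c⟩ := h.exists_cut
            exact exists_cut_of_rev ⟨W, a, b.le, c⟩
        obtain ⟨W, hW, hc, he, hf⟩ := this
        exact ⟨W, optimal_of_card_le_one hef hW hc he hf h2⟩
      · obtain ⟨W, hW⟩ := hcl
        exact ⟨W, optimal_of_closed hef hW (fun h => absurd h h2) (fun h => absurd h h1)
          fun h => absurd h h0⟩

theorem minCut_delete {e f : E} (hst : S.s ≠ S.t) (hef : e ≠ f) (hcl : ∃ W, S.Closed W) :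
    (S.G.delete {e, f}).minCut S.s S.t = S.reducedCut e f := by
  obtain ⟨W, hW, hle⟩ := exists_optimal hef hcl
  refine minCut_eq hst ⟨W, hW, ?_⟩ fun W' hW' => ?_
  · rwa [card_inE_delete]
  · rw [card_inE_delete]
    exact reducedCut_le hef hW'

theorem Optimal.isMinCutPartition {e f : E} {W : Set V} (h : S.Optimal e f W)
    (hst : S.s ≠ S.t) (hef : e ≠ f) (hcl : ∃ W, S.Closed W) :
    (S.G.delete {e, f}).IsMinCutPartition S.s S.t Wᶜ := by
  refine isMinCutPartition_of h.1 ?_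
  rw [minCut_delete hst hef hcl, card_inE_delete]
  exact h.2

end Delete

theorem exists_flowGraph [Fintype V] (G : MultiDigraph V E) {s t : V} (hst : s ≠ t)
    (hpos : 0 < G.minCut s t) :
    ∃ S : FlowGraph V E, S.G = G ∧ S.s = s ∧ S.t = t ∧ S.k = G.minCut s t ∧ ∃ W, S.Closed W := by
  obtain ⟨W, hW, hc⟩ := exists_minCut G hst
  have : Nonempty E := by
    obtain ⟨e, _⟩ := Finset.card_pos.1 (hc ▸ hpos)
    exact ⟨e⟩
  obtain ⟨F, hF⟩ := exists_flow G s t _ le_rfl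
  obtain ⟨P, _⟩ := hF.exists_pathSystem
  refine ⟨⟨G, s, t, _, P⟩, rfl, rfl, rfl, rfl, W, hW, ?_⟩
  have := card_inE (S := ⟨G, s, t, _, P⟩) hW
  rw [← Finset.card_eq_zero]
  dsimp only at this
  omega

end FlowGraph

/-! ## Static dictionaries with constant lookup time -/

namespace PerfectHash

theorem card_residue_le (P r c : ℕ) :
    ((Finset.range P).filter fun z => z % r = c).card ≤ P / r + 1 := by
  have : ((Finset.range P).filter fun z => z % r = c).card ≤ (Finset.range (P / r + 1)).card := by
    refine Finset.card_le_card_of_injOn (fun z => z / r) ?_ ?_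
    · intro z hz
      simp only [Finset.coe_filter, Finset.mem_range, Set.mem_ofPred_eq] at hz
      simp only [Finset.coe_range, Set.mem_Iio]
      exact Nat.lt_succ_of_le (Nat.div_le_div_right hz.1.le)
    · intro x hx y hy hxy
      simp only [Finset.coe_filter, Finset.mem_range, Set.mem_ofPred_eq] at hx hy
      rw [← Nat.div_add_mod x r, ← Nat.div_add_mod y r, hx.2, hy.2]
      simp only at hxy
      rw [hxy]
  simpa using this

/-- The hash function with multiplier `a` into `r` buckets. -/
def hash (P r a x : ℕ) : ℕ := a * x % P % r

/-- For a collision, `a * (x - y)` modulo `P` is congruent modulo `r` to `0` or to `P`, depending on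
which of the two reduced products is larger. Multiplication by `x - y` is injective modulo `P`, so
few multipliers `a` collide. -/
theorem card_collide_le {P r x y : ℕ} (hP : P.Prime) (hx : x < P) (hy : y < P)
    (hxy : x ≠ y) :
    ((Finset.range P).filter fun a => hash P r a x = hash P r a y).card ≤ 2 * (P / r + 1) := by
  have hsub : ((Finset.range P).filter fun a => hash P r a x = hash P r a y).card ≤
      ((Finset.range P).filter (fun z => z % r = 0) ∪
        (Finset.range P).filter fun z => z % r = P % r).card := by
    refine Finset.card_le_card_of_injOn (fun a => (a * x % P + (P - a * y % P)) % P) ?_ ?_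
    · intro a ha
      rw [Finset.mem_coe, Finset.mem_filter, Finset.mem_range, hash, hash] at ha
      have hX : a * x % P < P := Nat.mod_lt _ hP.pos
      have hY : a * y % P < P := Nat.mod_lt _ hP.pos
      simp only [Finset.coe_union, Finset.coe_filter, Finset.mem_range, Set.mem_union,
        Set.mem_ofPred_eq]
      have ha2 := ha.2
      set X := a * x % P
      set Y := a * y % P
      rcases Nat.lt_or_ge X Y with h | h
      · right
        rw [Nat.mod_eq_of_lt (by omega : X + (P - Y) < P)]
        refine ⟨by omega, ?_⟩
        have h1 : r ∣ Y - X := (Nat.modEq_iff_dvd' h.le).1 ha2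
        have h2 : X + (P - Y) = P - (Y - X) := by omega
        rw [h2]
        exact (Nat.modEq_iff_dvd' (by omega)).2 (by
          rwa [show P - (P - (Y - X)) = Y - X by omega])
      · left
        have h2 : X + (P - Y) = (X - Y) + P := by omega
        rw [h2, Nat.add_mod_right, Nat.mod_eq_of_lt (by omega : X - Y < P)]
        exact ⟨by omega, Nat.mod_eq_zero_of_dvd ((Nat.modEq_iff_dvd' h).1 ha2.symm)⟩
    · intro a ha b hb hab
      simp only [Finset.coe_filter, Finset.mem_range, Set.mem_ofPred_eq] at ha hb hab
      have key : ∀ c : ℕ, (((c * x % P + (P - c * y % P)) % P : ℕ) : ZMod P) =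
          c * ((x : ZMod P) - y) := by
        intro c
        have hY : c * y % P ≤ P := (Nat.mod_lt _ hP.pos).le
        rw [ZMod.natCast_mod]
        push_cast [hY]
        rw [ZMod.natCast_mod, ZMod.natCast_mod]
        push_cast
        simp
        ring
      have h := key a
      rw [hab, key b] at h
      have := Fact.mk hP
      have hne : (x : ZMod P) - y ≠ 0 := by
        rw [sub_ne_zero]
        intro h
        rw [ZMod.natCast_eq_natCast_iff'] at h
        rw [Nat.mod_eq_of_lt hx, Nat.mod_eq_of_lt hy] at h
        exact hxy h
      have h := mul_right_cancel₀ hne h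
      rw [ZMod.natCast_eq_natCast_iff', Nat.mod_eq_of_lt ha.1, Nat.mod_eq_of_lt hb.1] at h
      exact h.symm
  refine hsub.trans ((Finset.card_union_le _ _).trans ?_)
  have h1 := card_residue_le P r 0
  have h2 := card_residue_le P r (P % r)
  omega

/-- The ordered pairs of distinct elements with equal hash values. -/
def collisions (P r a : ℕ) (K : Finset ℕ) : Finset (ℕ × ℕ) :=
  K.offDiag.filter fun x => hash P r a x.1 = hash P r a x.2

/-- Averaging over the multipliers: the collisions, summed over all `a < P`, are bounded pair by
pair. -/
theorem exists_few_collisions {P r : ℕ} (hP : P.Prime) {K : Finset ℕ} (hK : ∀ x ∈ K, x < P) :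
    ∃ a < P, (collisions P r a K).card * P ≤ K.card ^ 2 * (2 * (P / r + 1)) := by
  by_contra! hcon
  have h1 : ∑ a ∈ Finset.range P, (collisions P r a K).card ≤
      K.card ^ 2 * (2 * (P / r + 1)) := by
    simp only [collisions, Finset.card_filter]
    rw [Finset.sum_comm]
    refine (Finset.sum_le_card_nsmul _ _ (2 * (P / r + 1)) fun x hx => ?_).trans ?_
    · rw [← Finset.card_filter]
      obtain ⟨h1, h2, h3⟩ := Finset.mem_offDiag.1 hx
      exact card_collide_le hP (hK _ h1) (hK _ h2) h3
    · rw [smul_eq_mul, Finset.offDiag_card]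
      refine Nat.mul_le_mul_right _ ?_
      rw [pow_two]
      exact Nat.sub_le _ _
  have h2 : ∑ a ∈ Finset.range P, (K.card ^ 2 * (2 * (P / r + 1))) <
      ∑ a ∈ Finset.range P, (collisions P r a K).card * P :=
    Finset.sum_lt_sum_of_nonempty ⟨0, Finset.mem_range.2 hP.pos⟩
      fun a ha => hcon a (Finset.mem_range.1 ha)
  rw [Finset.sum_const, Finset.card_range, smul_eq_mul, ← Finset.sum_mul, mul_comm] at h2
  exact absurd (Nat.lt_of_mul_lt_mul_right h2) (not_lt.2 h1)

/-- With more than `4 * s ^ 2` buckets the average number of collisions is below one. -/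
theorem exists_injOn {P s : ℕ} (hP : P.Prime) {K : Finset ℕ} (hK : ∀ x ∈ K, x < P)
    (hs : K.card = s) (hsP : 4 * s ^ 2 < P) :
    ∃ a < P, Set.InjOn (hash P (4 * s ^ 2 + 1) a) K := by
  obtain ⟨a, ha, hc⟩ := exists_few_collisions (r := 4 * s ^ 2 + 1) hP hK
  refine ⟨a, ha, ?_⟩
  have hlt : K.card ^ 2 * (2 * (P / (4 * s ^ 2 + 1) + 1)) < P := by
    rw [hs]
    set q := P / (4 * s ^ 2 + 1) with hq
    have h1 : q * (4 * s ^ 2 + 1) ≤ P := Nat.div_mul_le_self _ _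
    nlinarith
  have h0 : (collisions P (4 * s ^ 2 + 1) a K).card = 0 := by
    by_contra h
    have : P ≤ (collisions P (4 * s ^ 2 + 1) a K).card * P :=
      Nat.le_mul_of_pos_left _ (Nat.pos_of_ne_zero h)
    omega
  rw [Finset.card_eq_zero] at h0
  intro x hx y hy hxy
  by_contra hne
  have : (x, y) ∈ collisions P (4 * s ^ 2 + 1) a K :=
    Finset.mem_filter.2 ⟨Finset.mem_offDiag.2 ⟨hx, hy, hne⟩, hxy⟩
  rw [h0] at this
  simp at this

/-- Two-level hashing. -/
structure Dict where
  P : ℕ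
  B : ℕ
  a : ℕ
  mult : ℕ → ℕ
  size : ℕ → ℕ
  off : ℕ → ℕ

/-- The first-level bucket of `x`. -/
def Dict.bucket (d : Dict) (x : ℕ) : ℕ := d.a * x % d.P % d.B

/-- The cell of `x`. -/
def Dict.slot (d : Dict) (x : ℕ) : ℕ :=
  d.off (d.bucket x) + d.mult (d.bucket x) * x % d.P % d.size (d.bucket x)

/-- Two-level hashing of Fredman, Komlós and Szemerédi. The first level has `O(B)` collisions, so
the squares of the bucket sizes add up to `O(B)`, and each bucket can afford a collision-free table
of quadratic size. -/
theorem exists_dict (K : Finset ℕ) {B P : ℕ} (hB : 0 < B) (hKB : K.card ≤ B) (hP : P.Prime)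
    (hK : ∀ x ∈ K, x < P) (hBP : 4 * B ^ 2 < P) :
    ∃ d : Dict, d.P = P ∧ d.B = B ∧ d.a < P ∧ (∀ b, d.mult b < P) ∧ (∀ b, 0 < d.size b) ∧
      (∀ b < B, d.off b + d.size b ≤ 17 * B) ∧ Set.InjOn d.slot K := by
  obtain ⟨a, ha, hc⟩ := exists_few_collisions (r := B) hP hK
  set Kb : ℕ → Finset ℕ := fun b => K.filter fun x => hash P B a x = b with hKb
  have hcard : ∀ b, (Kb b).card ≤ B := fun b => (Finset.card_filter_le _ _).trans hKB
  have hex : ∀ b, ∃ a' < P, Set.InjOn (hash P (4 * (Kb b).card ^ 2 + 1) a') (Kb b) := by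
    intro b
    refine exists_injOn hP (fun x hx => hK x (Finset.mem_filter.1 hx).1) rfl ?_
    have := Nat.pow_le_pow_left (hcard b) 2
    omega
  choose mult hmult hinj using hex
  set size : ℕ → ℕ := fun b => 4 * (Kb b).card ^ 2 + 1 with hsize
  -- The average is about `2 * B`; the rounding term is absorbed since `P` exceeds `4 * B ^ 2`.
  have hcoll : (collisions P B a K).card ≤ 3 * B := by
    have h1 : P / B * B ≤ P := Nat.div_mul_le_self _ _
    have h2 : K.card ^ 2 ≤ B ^ 2 := Nat.pow_le_pow_left hKB 2
    have h3 : K.card ^ 2 * (2 * (P / B + 1)) ≤ B ^ 2 * (2 * (P / B + 1)) :=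
      Nat.mul_le_mul_right _ h2
    have h4 : B ^ 2 * (2 * (P / B + 1)) = 2 * B * (P / B * B) + 2 * B ^ 2 := by ring
    have h5 : 2 * B * (P / B * B) ≤ 2 * B * P := Nat.mul_le_mul_left _ h1
    have h6 : P ≤ B * P := Nat.le_mul_of_pos_left _ hB
    have h7 : (collisions P B a K).card * P ≤ 3 * B * P := by
      calc _ ≤ 2 * B * P + B * P := by omega
        _ = 3 * B * P := by ring
    exact Nat.le_of_mul_le_mul_right h7 hP.pos
  -- A square counts ordered pairs within a bucket: at most `B` diagonal ones and `3 * B`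
  -- collisions.
  have hsq : ∑ b ∈ Finset.range B, (Kb b).card ^ 2 ≤ 4 * B := by
    set T := (K ×ˢ K).filter fun x => hash P B a x.1 = hash P B a x.2 with hT
    have h1 : T.card = ∑ b ∈ Finset.range B, (Kb b).card ^ 2 := by
      rw [Finset.card_eq_sum_card_fiberwise (f := fun x => hash P B a x.1)
        (t := Finset.range B)]
      · refine Finset.sum_congr rfl fun b _ => ?_
        rw [pow_two, ← Finset.card_product]
        congr 1
        ext x
        simp only [hT, hKb, Finset.mem_filter, Finset.mem_product]
        constructor
        · rintro ⟨⟨⟨h1, h2⟩, h3⟩, h4⟩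
          exact ⟨⟨h1, h4⟩, h2, h3 ▸ h4⟩
        · rintro ⟨⟨h1, h4⟩, h2, h3⟩
          exact ⟨⟨⟨h1, h2⟩, h4.trans h3.symm⟩, h4⟩
      · intro x _
        simpa [hash] using Nat.mod_lt _ hB
    have h2 : T ⊆ K.diag ∪ collisions P B a K := by
      intro x hx
      simp only [hT, Finset.mem_filter, Finset.mem_product] at hx
      simp only [Finset.mem_union, Finset.mem_diag, collisions, Finset.mem_filter,
        Finset.mem_offDiag]
      tauto
    have h3 := (Finset.card_le_card h2).trans (Finset.card_union_le _ _)
    rw [Finset.diag_card] at h3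
    omega
  -- The constant is `4 * 4 + 1`, from the size `4 * c ^ 2 + 1` of the table for a bucket with `c`
  -- keys.
  have htot : ∑ b ∈ Finset.range B, size b ≤ 17 * B := by
    simp only [hsize, Finset.sum_add_distrib, ← Finset.mul_sum, Finset.sum_const,
      Finset.card_range, smul_eq_mul]
    omega
  have hoff : ∀ b c, b < c → ∑ b' ∈ Finset.range b, size b' + size b ≤
      ∑ b' ∈ Finset.range c, size b' := by
    intro b c hbc
    rw [← Finset.sum_range_succ]
    exact Finset.sum_le_sum_of_subset (Finset.range_mono hbc)
  refine ⟨⟨P, B, a, mult, size, fun b => ∑ b' ∈ Finset.range b, size b'⟩, rfl, rfl, ha, hmult,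
    fun b => by simp [hsize], fun b hb => (hoff b B hb).trans htot, ?_⟩
  intro x hx y hy hxy
  simp only [Dict.slot, Dict.bucket] at hxy
  have hlt : ∀ b z, z % size b < size b := fun b z => Nat.mod_lt _ (by simp [hsize])
  rcases Nat.lt_trichotomy (a * x % P % B) (a * y % P % B) with h | h | h
  · have h1 := hoff _ _ h
    have h2 := hlt (a * x % P % B) (mult (a * x % P % B) * x % P)
    omega
  · rw [← h] at hxy
    exact hinj (a * x % P % B) (Finset.mem_filter.2 ⟨hx, rfl⟩)
      (Finset.mem_filter.2 ⟨hy, h.symm⟩) (Nat.add_left_cancel hxy)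
  · have h1 := hoff _ _ h
    have h2 := hlt (a * y % P % B) (mult (a * y % P % B) * y % P)
    omega

theorem Dict.slot_lt {d : Dict} (hB : 0 < d.B) (hs : ∀ b, 0 < d.size b)
    (ho : ∀ b < d.B, d.off b + d.size b ≤ 17 * d.B) (x : ℕ) :
    d.slot x < 17 * d.B := by
  have h1 := ho (d.bucket x) (Nat.mod_lt _ hB)
  have h2 := Nat.mod_lt (d.mult (d.bucket x) * x % d.P) (hs (d.bucket x))
  unfold slot
  omega

end PerfectHash

/-! ## Expressions for the word RAM -/

namespace WordRAM

/-- Expressions over the registers `0, …, 3`. -/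
inductive Expr where
  | lit (k : ℕ)
  | var (r : Fin 4)
  | op (o : Op) (a b : Expr)
  | read (a : Expr)
  | load (a : Expr)
  | ite (c a b : Expr)

namespace Expr

variable {w : ℕ}

/-- The value of an expression. -/
def eval (D : List (BitVec w)) (σ : State w) : Expr → BitVec w
  | lit k => BitVec.ofNat w k
  | var r => σ.reg r
  | op o a b => o.eval (a.eval D σ) (b.eval D σ)
  | read a => D.getD (a.eval D σ).toNat 0
  | load a => σ.mem (a.eval D σ)
  | ite c a b => if c.eval D σ ≠ 0 then a.eval D σ else b.eval D σ

/-- A program that writes the value of an expression into register `d`, using no register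
below `d`. -/
def compile : Expr → ℕ → Prog
  | lit k, d => .const d k
  | var r, d => .op .or d r r
  | op o a b, d => .seq (a.compile d) (.seq (b.compile (d + 1)) (.op o d d (d + 1)))
  | read a, d => .seq (a.compile d) (.read d d)
  | load a, d => .seq (a.compile d) (.load d d)
  | ite c a b, d => .seq (c.compile d) (.cond d (a.compile d) (b.compile d))

/-- A bound for the evaluation time. -/
def cost : Expr → ℕ
  | lit _ => 1
  | var _ => 1
  | op _ a b => a.cost + (b.cost + 1)
  | read a => a.cost + 1
  | load a => a.cost + 1
  | ite c a b => c.cost + (a.cost + b.cost + 1)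

theorem eval_congr {D : List (BitVec w)} {σ τ : State w} (h : ∀ r < 4, τ.reg r = σ.reg r)
    (hm : τ.mem = σ.mem) (e : Expr) : e.eval D τ = e.eval D σ := by
  induction e with
  | lit k => rfl
  | var r => exact h r r.2
  | op o a b iha ihb => simp only [eval, iha, ihb]
  | read a ih => simp only [eval, ih]
  | load a ih => simp only [eval, ih, hm]
  | ite c a b ihc iha ihb => simp only [eval, ihc, iha, ihb]

/-- The registers from `d` on serve as an evaluation stack, and those below are preserved. Starting
at `4` protects the query, the loop counter and the flag. -/
theorem exec_compile (D : List (BitVec w)) (e : Expr) {d : ℕ} (hd : 4 ≤ d) (σ : State w) :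
    ∃ k τ, k ≤ e.cost ∧ Exec D (e.compile d) σ k τ ∧ τ.reg d = e.eval D σ ∧
      (∀ r < d, τ.reg r = σ.reg r) ∧ τ.mem = σ.mem := by
  induction e generalizing d σ with
  | lit k =>
    exact ⟨1, _, le_rfl, .const d k σ, by simp [State.setReg, eval],
      fun r hr => by simp [State.setReg, hr.ne], rfl⟩
  | var r =>
    refine ⟨1, _, le_rfl, .op .or d r r σ, by simp [State.setReg, eval, Op.eval],
      fun r hr => by simp [State.setReg, hr.ne], rfl⟩
  | op o a b iha ihb =>
    obtain ⟨k1, τ1, c1, x1, v1, r1, m1⟩ := iha hd σ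
    obtain ⟨k2, τ2, c2, x2, v2, r2, m2⟩ := ihb (d := d + 1) (by omega) τ1
    refine ⟨k1 + (k2 + 1), _, by simp only [cost]; omega,
      .seq x1 (.seq x2 (.op o d d (d + 1) τ2)), ?_, ?_, ?_⟩
    · simp only [State.setReg, Function.update_self, eval]
      rw [v2, r2 d (by omega), v1, eval_congr (fun r hr => r1 r (by omega)) m1]
    · intro r hr
      simp only [State.setReg]
      rw [Function.update_of_ne hr.ne, r2 r (by omega), r1 r hr]
    · exact m2.trans m1
  | read a ih =>
    obtain ⟨k1, τ1, c1, x1, v1, r1, m1⟩ := ih hd σ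
    refine ⟨k1 + 1, _, by simp only [cost]; omega, .seq x1 (.read d d τ1), ?_, ?_, m1⟩
    · simp [State.setReg, eval, v1]
    · intro r hr
      simp only [State.setReg]
      rw [Function.update_of_ne hr.ne, r1 r hr]
  | load a ih =>
    obtain ⟨k1, τ1, c1, x1, v1, r1, m1⟩ := ih hd σ
    refine ⟨k1 + 1, _, by simp only [cost]; omega, .seq x1 (.load d d τ1), ?_, ?_, m1⟩
    · simp [State.setReg, eval, v1, m1]
    · intro r hr
      simp only [State.setReg]
      rw [Function.update_of_ne hr.ne, r1 r hr]
  | ite c a b ihc iha ihb =>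
    obtain ⟨k1, τ1, c1, x1, v1, r1, m1⟩ := ihc hd σ
    have hcongr := fun e => eval_congr (D := D) (fun r hr => r1 r (by omega)) m1 e
    by_cases hc : c.eval D σ = 0
    · obtain ⟨k2, τ2, c2, x2, v2, r2, m2⟩ := ihb hd τ1
      refine ⟨k1 + (k2 + 1), τ2, by simp only [cost]; omega,
        .seq x1 (.cond_false (by rw [v1, hc]) x2), ?_, fun r hr => (r2 r hr).trans (r1 r hr),
        m2.trans m1⟩
      rw [v2, hcongr]
      exact (if_neg (not_not.2 hc)).symm
    · obtain ⟨k2, τ2, c2, x2, v2, r2, m2⟩ := iha hd τ1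
      refine ⟨k1 + (k2 + 1), τ2, by simp only [cost]; omega,
        .seq x1 (.cond_true (by rw [v1]; exact hc) x2), ?_,
        fun r hr => (r2 r hr).trans (r1 r hr), m2.trans m1⟩
      rw [v2, hcongr]
      exact (if_pos hc).symm

/-- The value of an expression as a natural number. -/
def val (D : List (BitVec w)) (σ : State w) (e : Expr) : ℕ := (e.eval D σ).toNat

/-- An expression as a condition. -/
def Holds (D : List (BitVec w)) (σ : State w) (e : Expr) : Prop := e.eval D σ ≠ 0

variable {D : List (BitVec w)} {σ : State w}

theorem eval_eq_of_val {e : Expr} {k : ℕ} (h : e.val D σ = k) :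
    e.eval D σ = BitVec.ofNat w k := by
  rw [← h, val, BitVec.ofNat_toNat, BitVec.setWidth_eq]

theorem holds_iff_val {e : Expr} : e.Holds D σ ↔ e.val D σ ≠ 0 := by
  rw [Holds, val, ne_eq, ne_eq, ← BitVec.toNat_inj]
  simp

theorem val_lit {k : ℕ} (h : k < 2 ^ w) : (lit k).val D σ = k := by
  simp [val, eval, Nat.mod_eq_of_lt h]

theorem val_add {a b : Expr} {x y : ℕ} (ha : a.val D σ = x) (hb : b.val D σ = y)
    (h : x + y < 2 ^ w) : (op .add a b).val D σ = x + y := by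
  unfold val at *
  simp only [eval, Op.eval]
  rw [BitVec.toNat_add, ha, hb, Nat.mod_eq_of_lt h]

theorem val_mul {a b : Expr} {x y : ℕ} (ha : a.val D σ = x) (hb : b.val D σ = y)
    (h : x * y < 2 ^ w) : (op .mul a b).val D σ = x * y := by
  unfold val at *
  simp only [eval, Op.eval]
  rw [BitVec.toNat_mul, ha, hb, Nat.mod_eq_of_lt h]

theorem val_mod {a b : Expr} {x y : ℕ} (ha : a.val D σ = x) (hb : b.val D σ = y) :
    (op .mod a b).val D σ = x % y := by
  unfold val at *
  simp only [eval, Op.eval]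
  rw [BitVec.toNat_umod, ha, hb]

theorem val_sub {a b : Expr} {x y : ℕ} (ha : a.val D σ = x) (hb : b.val D σ = y)
    (h : y ≤ x) : (op .sub a b).val D σ = x - y := by
  have hx : x < 2 ^ w := ha ▸ (a.eval D σ).isLt
  unfold val at *
  simp only [eval, Op.eval]
  rw [BitVec.toNat_sub, ha, hb, show 2 ^ w - y + x = (x - y) + 2 ^ w by omega,
    Nat.add_mod_right, Nat.mod_eq_of_lt (by omega)]

theorem holds_lt (hw : 0 < w) {a b : Expr} :
    (op .lt a b).Holds D σ ↔ a.val D σ < b.val D σ := by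
  have : (1 : BitVec w) ≠ 0 := by
    rw [ne_eq, ← BitVec.toNat_inj]
    have : 1 < 2 ^ w := Nat.one_lt_two_pow hw.ne'
    simp [Nat.mod_eq_of_lt this]
  simp only [Holds, eval, Op.eval, val]
  split_ifs with h
  · exact iff_of_true this h
  · exact iff_of_false (fun h => h rfl) h

theorem holds_eq (hw : 0 < w) {a b : Expr} :
    (op .eq a b).Holds D σ ↔ a.val D σ = b.val D σ := by
  have : (1 : BitVec w) ≠ 0 := by
    rw [ne_eq, ← BitVec.toNat_inj]
    have : 1 < 2 ^ w := Nat.one_lt_two_pow hw.ne'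
    simp [Nat.mod_eq_of_lt this]
  simp only [Holds, eval, Op.eval, val, BitVec.toNat_inj]
  split_ifs with h
  · exact iff_of_true this h
  · exact iff_of_false (fun h => h rfl) h

theorem val_ite_pos {c a b : Expr} (h : c.Holds D σ) : (ite c a b).val D σ = a.val D σ := by
  have : c.eval D σ ≠ 0 := h
  simp only [val, eval, if_pos this]

theorem val_ite_neg {c a b : Expr} (h : ¬ c.Holds D σ) : (ite c a b).val D σ = b.val D σ := by
  have : ¬ c.eval D σ ≠ 0 := h
  simp only [val, eval, if_neg this]

/-- Negation. -/
def not (a : Expr) : Expr := ite a (lit 0) (lit 1)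

/-- Conjunction. -/
def and (a b : Expr) : Expr := ite a b (lit 0)

/-- Disjunction. -/
def or (a b : Expr) : Expr := ite a (lit 1) b

/-- Conversion to `0` or `1`. -/
def bool (a : Expr) : Expr := ite a (lit 1) (lit 0)

theorem holds_lit_one (hw : 0 < w) : (lit 1).Holds D σ := by
  rw [holds_iff_val, val_lit (Nat.one_lt_two_pow hw.ne')]
  simp

theorem not_holds_lit_zero : ¬ (lit 0).Holds D σ := by
  simp [Holds, eval]

theorem holds_ite {c a b : Expr} : (ite c a b).Holds D σ ↔
    (c.Holds D σ ∧ a.Holds D σ) ∨ (¬ c.Holds D σ ∧ b.Holds D σ) := by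
  by_cases h : c.Holds D σ
  · rw [holds_iff_val, val_ite_pos h, ← holds_iff_val]
    tauto
  · rw [holds_iff_val, val_ite_neg h, ← holds_iff_val]
    tauto

theorem holds_not (hw : 0 < w) {a : Expr} : a.not.Holds D σ ↔ ¬ a.Holds D σ := by
  rw [not, holds_ite]
  have h1 := holds_lit_one (D := D) (σ := σ) hw
  have h0 := not_holds_lit_zero (D := D) (σ := σ)
  tauto

theorem holds_and {a b : Expr} : (a.and b).Holds D σ ↔ a.Holds D σ ∧ b.Holds D σ := by
  rw [and, holds_ite]
  have h0 := not_holds_lit_zero (D := D) (σ := σ)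
  tauto

theorem holds_or (hw : 0 < w) {a b : Expr} :
    (a.or b).Holds D σ ↔ a.Holds D σ ∨ b.Holds D σ := by
  rw [or, holds_ite]
  have h1 := holds_lit_one (D := D) (σ := σ) hw
  tauto

theorem eval_bool_pos {a : Expr} (h : a.Holds D σ) : a.bool.eval D σ = 1 := by
  change (if a.eval D σ ≠ 0 then BitVec.ofNat w 1 else BitVec.ofNat w 0) = _
  exact (if_pos h).trans rfl

theorem eval_bool_neg {a : Expr} (h : ¬ a.Holds D σ) : a.bool.eval D σ = 0 := by
  change (if a.eval D σ ≠ 0 then BitVec.ofNat w 1 else BitVec.ofNat w 0) = _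
  exact (if_neg h).trans rfl

end Expr

/-- `r := e` -/
def assign (r : ℕ) (e : Expr) : Prog := .seq (e.compile 4) (.op .or r 4 4)

/-- `mem[a] := e` -/
def put (a e : Expr) : Prog := .seq (a.compile 4) (.seq (e.compile 5) (.store 4 5))

/-! ### Assignments, stores and counted loops. -/

variable {w : ℕ}

theorem exec_assign (D : List (BitVec w)) (r : ℕ) (e : Expr) (σ : State w) :
    ∃ k τ, k ≤ e.cost + 1 ∧ Exec D (assign r e) σ k τ ∧ τ.reg r = e.eval D σ ∧
      (∀ r' < 4, r' ≠ r → τ.reg r' = σ.reg r') ∧ τ.mem = σ.mem := by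
  obtain ⟨k, τ, c, x, v, h, m⟩ := e.exec_compile D le_rfl σ
  refine ⟨k + 1, _, by omega, .seq x (.op .or r 4 4 τ), ?_, ?_, m⟩
  · simp [State.setReg, Op.eval, v]
  · intro r' hr' hne
    simp only [State.setReg]
    rw [Function.update_of_ne hne, h r' hr']

theorem exec_put (D : List (BitVec w)) (a e : Expr) (σ : State w) :
    ∃ k τ, k ≤ a.cost + (e.cost + 1) ∧ Exec D (put a e) σ k τ ∧
      (∀ r < 4, τ.reg r = σ.reg r) ∧
      τ.mem = Function.update σ.mem (a.eval D σ) (e.eval D σ) := by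
  obtain ⟨k1, τ1, c1, x1, v1, r1, m1⟩ := a.exec_compile D le_rfl σ
  obtain ⟨k2, τ2, c2, x2, v2, r2, m2⟩ := e.exec_compile D (d := 5) (by omega) τ1
  refine ⟨k1 + (k2 + 1), _, by omega, .seq x1 (.seq x2 (.store 4 5 τ2)), ?_, ?_⟩
  · intro r hr
    simp only [State.setMem]
    rw [r2 r (by omega), r1 r hr]
  · simp only [State.setMem]
    rw [v2, r2 4 (by omega), v1, m2, m1, Expr.eval_congr r1 m1]

/-- Run `body` with `0, …, k - 1` in register `2`, where `k` is the value of `n`. -/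
def forLoop (n : Expr) (body : Prog) : Prog :=
  .seq (assign 2 (.lit 0)) (.seq (assign 3 (.lit 1)) (.loop 3 (.seq body
    (.seq (assign 2 (.op .add (.var 2) (.lit 1))) (assign 3 (.op .lt (.var 2) n))))))

/-- The invariant concerns the memory only. The body may destroy the flag in register `3`, which is
recomputed after each round. The flag starts as `1`, so the body runs at least once, whence `0 < N`.
-/
theorem exec_forLoop (D : List (BitVec w)) (hw : 0 < w) {n : Expr} {body : Prog} {N c : ℕ}
    (hN : 0 < N) (hNw : N < 2 ^ w) (hn : ∀ σ : State w, n.val D σ = N) {x y : BitVec w}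
    (I : ℕ → (BitVec w → BitVec w) → Prop)
    (hbody : ∀ k < N, ∀ σ : State w, σ.reg 0 = x → σ.reg 1 = y → σ.reg 2 = BitVec.ofNat w k →
      I k σ.mem → ∃ j τ, j ≤ c ∧ Exec D body σ j τ ∧ (∀ r < 3, τ.reg r = σ.reg r) ∧
        I (k + 1) τ.mem)
    (σ : State w) (hx : σ.reg 0 = x) (hy : σ.reg 1 = y) (hI : I 0 σ.mem) :
    ∃ j τ, j ≤ (c + n.cost + 20) * N ∧ Exec D (forLoop n body) σ j τ ∧ I N τ.mem := by
  have hloop : ∀ d k, k + d = N → 0 < d → ∀ σ : State w, σ.reg 0 = x → σ.reg 1 = y →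
      σ.reg 2 = BitVec.ofNat w k → σ.reg 3 ≠ 0 → I k σ.mem →
      ∃ j τ, j ≤ (c + n.cost + 8) * d + 1 ∧ Exec D (.loop 3 (.seq body
        (.seq (assign 2 (.op .add (.var 2) (.lit 1))) (assign 3 (.op .lt (.var 2) n))))) σ j τ ∧
        I N τ.mem := by
    intro d
    induction d with
    | zero => intro k _ h; omega
    | succ d ih =>
      intro k hk _ σ hx hy h2 h3 hI
      obtain ⟨j1, τ1, c1, x1, r1, i1⟩ := hbody k (by omega) σ hx hy h2 hI
      obtain ⟨j2, τ2, c2, x2, v2, r2, m2⟩ :=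
        exec_assign D 2 (.op .add (.var 2) (.lit 1)) τ1
      obtain ⟨j3, τ3, c3, x3, v3, r3, m3⟩ := exec_assign D 3 (.op .lt (.var 2) n) τ2
      have e2 : τ3.reg 2 = BitVec.ofNat w (k + 1) := by
        rw [r3 2 (by omega) (by decide)]
        have hv := Expr.val_add (D := D) (σ := τ1) (a := .var 2) (b := .lit 1) (x := k) (y := 1)
          (by
            change (τ1.reg 2).toNat = k
            rw [r1 2 (by omega), h2, BitVec.toNat_ofNat, Nat.mod_eq_of_lt (by omega)])
          (Expr.val_lit (Nat.one_lt_two_pow hw.ne')) (by omega)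
        exact v2.trans (Expr.eval_eq_of_val hv)
      have e2' : τ2.reg 2 = BitVec.ofNat w (k + 1) := by
        rw [← e2, r3 2 (by omega) (by decide)]
      have e3 : τ3.reg 3 ≠ 0 ↔ k + 1 < N := by
        have hv := Expr.holds_lt (D := D) (σ := τ2) hw (a := .var 2) (b := n)
        rw [hn τ2] at hv
        have hk1 : (Expr.var 2).val D τ2 = k + 1 := by
          change (τ2.reg 2).toNat = k + 1
          rw [e2', BitVec.toNat_ofNat, Nat.mod_eq_of_lt (by omega)]
        rw [hk1] at hv
        rw [← hv, Expr.Holds]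
        exact not_congr (by rw [← v3])
      have hm : I (k + 1) τ3.mem := by rw [m3, m2]; exact i1
      have hexec : Exec D (.seq body (.seq (assign 2 (.op .add (.var 2) (.lit 1)))
        (assign 3 (.op .lt (.var 2) n)))) σ (j1 + (j2 + j3)) τ3 := .seq x1 (.seq x2 x3)
      simp only [Expr.cost] at c2 c3
      have hmul : (c + n.cost + 8) * (d + 1) = (c + n.cost + 8) * d + (c + n.cost + 8) := by ring
      by_cases hd : d = 0
      · subst hd
        have h0 : τ3.reg 3 = 0 := by
          by_contra h
          have := e3.1 h
          omega
        refine ⟨j1 + (j2 + j3) + 1 + 1, τ3, ?_, .loop_true h3 hexec (.loop_false h0), ?_⟩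
        · omega
        · rwa [show k + 1 = N by omega] at hm
      · have q0 : τ3.reg 0 = x := by
          rw [r3 0 (by omega) (by decide), r2 0 (by omega) (by decide), r1 0 (by omega), hx]
        have q1 : τ3.reg 1 = y := by
          rw [r3 1 (by omega) (by decide), r2 1 (by omega) (by decide), r1 1 (by omega), hy]
        obtain ⟨j4, τ4, c4, x4, i4⟩ := ih (k + 1) (by omega) (by omega) τ3 q0 q1 e2
          (e3.2 (by omega)) hm
        exact ⟨j1 + (j2 + j3) + j4 + 1, τ4, by omega, .loop_true h3 hexec x4, i4⟩
  obtain ⟨j1, τ1, c1, x1, v1, r1, m1⟩ := exec_assign D 2 (.lit 0) σ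
  obtain ⟨j2, τ2, c2, x2, v2, r2, m2⟩ := exec_assign D 3 (.lit 1) τ1
  obtain ⟨j3, τ3, c3, x3, i3⟩ := hloop N 0 (by omega) hN τ2
    (by rw [r2 0 (by omega) (by decide), r1 0 (by omega) (by decide), hx])
    (by rw [r2 1 (by omega) (by decide), r1 1 (by omega) (by decide), hy])
    (by rw [r2 2 (by omega) (by decide)]; exact v1)
    (by
      have := Expr.holds_lit_one (D := D) (σ := τ1) hw
      rw [Expr.Holds, ← v2] at this
      exact this)
    (by rw [m2, m1]; exact hI)
  refine ⟨j1 + (j2 + j3), τ3, ?_, .seq x1 (.seq x2 x3), i3⟩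
  simp only [Expr.cost] at c1 c2
  have hmul : (c + n.cost + 20) * N = (c + n.cost + 8) * N + 12 * N := by ring
  omega

/-! ### Arrays in the stored data -/

/-- Eight words `hdr`, followed by `A` arrays of `L` words. -/
def layout (w A L : ℕ) (hdr : ℕ → ℕ) (tab : ℕ → ℕ → ℕ) : List (BitVec w) :=
  (List.range (8 + A * L)).map fun a =>
    BitVec.ofNat w (if a < 8 then hdr a else tab ((a - 8) / L) ((a - 8) % L))

theorem length_layout {A L : ℕ} {hdr : ℕ → ℕ} {tab : ℕ → ℕ → ℕ} :
    (layout w A L hdr tab).length = 8 + A * L := by simp [layout]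

theorem getD_layout_hdr {A L : ℕ} {hdr : ℕ → ℕ} {tab : ℕ → ℕ → ℕ} {a : ℕ} (ha : a < 8) :
    (layout w A L hdr tab).getD a 0 = BitVec.ofNat w (hdr a) := by
  have h : a < 8 + A * L := by omega
  simp [layout, List.getD_eq_getElem?_getD, h, ha]

theorem getD_layout_tab {A L : ℕ} {hdr : ℕ → ℕ} {tab : ℕ → ℕ → ℕ} {a i : ℕ} (ha : a < A)
    (hi : i < L) : (layout w A L hdr tab).getD (8 + a * L + i) 0 = BitVec.ofNat w (tab a i) := by
  have h : 8 + a * L + i < 8 + A * L := by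
    have : (a + 1) * L ≤ A * L := Nat.mul_le_mul_right _ ha
    rw [Nat.add_mul] at this
    omega
  have h1 : 8 + a * L + i - 8 = i + L * a := by rw [Nat.mul_comm]; omega
  have h2 : (8 + a * L + i - 8) / L = a := by
    rw [h1, Nat.add_mul_div_left _ _ (by omega), Nat.div_eq_of_lt hi, Nat.zero_add]
  have h3 : (8 + a * L + i - 8) % L = i := by
    rw [h1, Nat.add_mul_mod_self_left, Nat.mod_eq_of_lt hi]
  have h4 : ¬ 8 + a * L + i < 8 := by omega
  simp only [layout, List.getD_eq_getElem?_getD, List.getElem?_map, List.getElem?_range h,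
    Option.map_some, Option.getD_some, h4, if_false, h2, h3]

namespace Expr

/-- The word number `k` of the header. -/
def hdr (k : ℕ) : Expr := read (lit k)

/-- The entry number `i` of the array number `a`. -/
def arr (a : ℕ) (i : Expr) : Expr :=
  read (op .add (op .add (lit 8) (op .mul (lit a) (hdr 0))) i)

theorem val_hdr {A L : ℕ} {h : ℕ → ℕ} {tab : ℕ → ℕ → ℕ} {σ : State w} {k : ℕ} (hk : k < 8)
    (h8 : 8 < 2 ^ w) (hv : h k < 2 ^ w) : (hdr k).val (layout w A L h tab) σ = h k := by
  have h1 : (lit k).val (layout w A L h tab) σ = k := val_lit (by omega)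
  unfold val at h1 ⊢
  rw [hdr, eval, h1, getD_layout_hdr hk, BitVec.toNat_ofNat, Nat.mod_eq_of_lt hv]

theorem val_arr {A L : ℕ} {h : ℕ → ℕ} {tab : ℕ → ℕ → ℕ} {σ : State w} {a i : ℕ} {e : Expr}
    (hL : h 0 = L) (hA : 8 + A * L < 2 ^ w) (ha : a < A)
    (he : e.val (layout w A L h tab) σ = i) (hi : i < L) (hv : tab a i < 2 ^ w) :
    (arr a e).val (layout w A L h tab) σ = tab a i := by
  have hle : (a + 1) * L ≤ A * L := Nat.mul_le_mul_right _ ha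
  rw [Nat.add_mul] at hle
  have hAL : A ≤ A * L := Nat.le_mul_of_pos_right _ (by omega)
  have h1 : (hdr 0).val (layout w A L h tab) σ = L := by
    rw [val_hdr (by omega) (by omega) (by omega), hL]
  have h2 := val_mul (val_lit (D := layout w A L h tab) (σ := σ) (k := a) (by omega)) h1
    (by omega)
  have h3 := val_add (val_lit (D := layout w A L h tab) (σ := σ) (k := 8) (by omega)) h2
    (by omega)
  have h4 := val_add h3 he (by omega)
  unfold val at h4 ⊢
  rw [arr, eval, h4, getD_layout_tab ha hi, BitVec.toNat_ofNat, Nat.mod_eq_of_lt hv]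

end Expr

end WordRAM

/-! ## Rows: sets of vertices along the paths -/

theorem exists_threshold {Q : ℕ → Prop} {u v : ℕ} (huv : u ≤ v + 1)
    (h : ∀ p, u ≤ p → p < v → Q p → Q (p + 1)) :
    ∃ c, u ≤ c ∧ c ≤ v + 1 ∧ ∀ p, u ≤ p → p ≤ v → (Q p ↔ c ≤ p) := by
  classical
  by_cases hex : ∃ p, u ≤ p ∧ p ≤ v ∧ Q p
  · obtain ⟨h1, h2, h3⟩ := Nat.find_spec hex
    refine ⟨Nat.find hex, h1, by omega, fun p hp hpv => ⟨fun hQ => ?_, fun hc => ?_⟩⟩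
    · exact Nat.find_min' hex ⟨hp, hpv, hQ⟩
    · have : ∀ q, Nat.find hex ≤ q → q ≤ v → Q q := by
        intro q hq
        induction q, hq using Nat.le_induction with
        | base => exact fun _ => h3
        | succ q hq ih => exact fun hv => h q (by omega) (by omega) (ih (by omega))
      exact this p hc hpv
  · push Not at hex
    exact ⟨v + 1, huv, le_rfl, fun p hp hpv =>
      ⟨fun hQ => absurd hQ (hex p hp hpv), fun hc => by omega⟩⟩

/-- A subset of `{0, …, l}` with at most one descent is described by three numbers. -/
theorem exists_row {Q : ℕ → Prop} {l : ℕ} (h : ∀ p < l, ∀ q < l, Q p → ¬ Q (p + 1) → Q q →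
    ¬ Q (q + 1) → p = q) :
    ∃ r : ℕ × ℕ × ℕ, (r.1 ≤ l + 1 ∧ r.2.1 ≤ l + 1 ∧ r.2.2 ≤ l + 1) ∧
      ∀ p ≤ l, Q p ↔ (r.1 ≤ p ∧ p < r.2.1) ∨ r.2.2 ≤ p := by
  by_cases hd : ∃ d < l, Q d ∧ ¬ Q (d + 1)
  · obtain ⟨d, hdl, h1, h2⟩ := hd
    have key : ∀ p < l, p ≠ d → Q p → Q (p + 1) := by
      intro p hp hne hQ
      by_contra hQ'
      exact hne (h p hp d hdl hQ hQ' h1 h2)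
    obtain ⟨a, _, ha, hA⟩ := exists_threshold (Q := Q) (u := 0) (v := d) (by omega)
      fun p _ hp hQ => key p (by omega) (by omega) hQ
    obtain ⟨c, hc', hc, hC⟩ := exists_threshold (Q := Q) (u := d + 1) (v := l) (by omega)
      fun p hp hpl hQ => key p (by omega) (by omega) hQ
    -- Up to the only descent `d` and again after it, the set is upward closed.
    refine ⟨(a, d + 1, c), ⟨by dsimp only; omega, by dsimp only; omega, hc⟩, fun p hp => ?_⟩
    dsimp only
    by_cases hpd : p ≤ d
    · rw [hA p (by omega) hpd]
      omega
    · rw [hC p (by omega) hp]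
      omega
  · push Not at hd
    obtain ⟨c, hc', hc, hC⟩ := exists_threshold (Q := Q) (u := 0) (v := l) (by omega)
      fun p _ hpl hQ => hd p hpl hQ
    refine ⟨(0, 0, c), ⟨by dsimp only; omega, by dsimp only; omega, hc⟩, fun p hp => ?_⟩
    dsimp only
    rw [hC p (by omega) hp]
    omega

open MultiDigraph

namespace FlowGraph

section

variable {V E : Type} (S : FlowGraph V E)

open Classical in
/-- Three numbers that describe the part of `W` on the path number `i`. -/
noncomputable def row (W : Set V) (i : ℕ) : ℕ × ℕ × ℕ :=
  if h : ∃ r : ℕ × ℕ × ℕ, (r.1 ≤ S.P.len i + 1 ∧ r.2.1 ≤ S.P.len i + 1 ∧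
      r.2.2 ≤ S.P.len i + 1) ∧
    ∀ p ≤ S.P.len i, S.P.vtx i p ∈ W ↔ (r.1 ≤ p ∧ p < r.2.1) ∨ r.2.2 ≤ p
  then h.choose else (0, 0, 0)

variable {S}

theorem row_le (W : Set V) (i : ℕ) : (S.row W i).1 ≤ S.P.len i + 1 ∧
    (S.row W i).2.1 ≤ S.P.len i + 1 ∧ (S.row W i).2.2 ≤ S.P.len i + 1 := by
  unfold row
  split_ifs with h
  · exact h.choose_spec.1
  · simp

variable [Fintype E]

theorem mem_iff_row {W : Set V} (hW : (S.H.inE W).card ≤ 1) {i p : ℕ} (hi : i < S.k)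
    (hp : p ≤ S.P.len i) : S.P.vtx i p ∈ W ↔
      ((S.row W i).1 ≤ p ∧ p < (S.row W i).2.1) ∨ (S.row W i).2.2 ≤ p := by
  have h := exists_row (Q := fun p => S.P.vtx i p ∈ W) (l := S.P.len i) (by
    intro p hp q hq h1 h2 h3 h4
    have := Finset.card_le_one.1 hW _ (mem_inE_of_descent hi hp h1 h2) _
      (mem_inE_of_descent hi hq h3 h4)
    exact (S.P.edge_inj i hi i hi p hp q hq this).2)
  unfold row
  rw [dif_pos h]
  exact h.choose_spec.2 p hp

theorem card_inE_univ : (S.H.inE Set.univ).card ≤ 1 := by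
  rw [Finset.card_eq_zero.2]
  · simp
  · ext e; simp [mem_inE]

theorem card_inE_empty : (S.H.inE ∅).card ≤ 1 := by
  rw [Finset.card_eq_zero.2]
  · simp
  · ext e; simp [mem_inE]

theorem card_inE_chull [Finite V] (x : V) : (S.H.inE (S.chull x)).card ≤ 1 := by
  by_cases h : ∃ u, S.CSep x u
  · obtain ⟨u, hu⟩ := h
    rw [(Closed.chull hu).2]
    simp
  · have : S.chull x = Set.univ := Set.eq_univ_of_forall fun u hu => h ⟨u, hu⟩
    rw [this]
    exact card_inE_univ

theorem card_inE_hull [Finite V] {ρ x : V} {X : Set V} (hx : x ∈ X) (hc : S.Cls x ρ) :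
    (S.H.inE (S.hull ρ X)).card ≤ 1 := by
  by_cases h : ∃ u, S.Sep ρ X u
  · obtain ⟨u, hu⟩ := h
    exact (Tight.hull hx hc hu).2.1.le
  · have : S.hull ρ X = Set.univ := Set.eq_univ_of_forall fun u hu => h ⟨u, hu⟩
    rw [this]
    exact card_inE_univ

theorem card_inE_cell [Finite V] {ρ : V} {e : E} (hc : S.Cls (S.G.head e) ρ) :
    (S.H.inE (S.cell ρ e)).card ≤ 1 := by
  by_cases h : S.Sep ρ {S.G.head e} (S.G.tail e)
  · exact (Tight.cell hc h).1.2.1.le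
  · have : S.cell ρ e = ∅ := Set.eq_empty_of_forall_notMem fun x hx =>
      h (Sep.mono (mem_cell_iff.1 hx) (by simp))
    rw [this]
    exact card_inE_empty

open Classical in
variable (S) in
/-- The path and the position of a path edge. -/
noncomputable def place (e : E) : ℕ × ℕ :=
  if h : ∃ x : ℕ × ℕ, S.At e x.1 x.2 then h.choose else (0, 0)

omit [Fintype E] in
theorem at_place {e : E} (h : S.IsFlowEdge e) : S.At e (S.place e).1 (S.place e).2 := by
  obtain ⟨i, p, h⟩ := h
  have h' : ∃ x : ℕ × ℕ, S.At e x.1 x.2 := ⟨(i, p), h⟩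
  unfold place
  rw [dif_pos h']
  exact h'.choose_spec

variable (S) in
/-- The number of the edge through which `W` is entered, plus one; or zero. -/
noncomputable def gateNum {V : Type} {m : ℕ} (S : FlowGraph V (Fin m)) (W : Set V) : ℕ :=
  open Classical in if h : ∃ g, S.H.inE W = {g} then (h.choose : ℕ) + 1 else 0

theorem gateNum_of {V : Type} {m : ℕ} {S : FlowGraph V (Fin m)} {W : Set V} {g : Fin m}
    (h : S.H.inE W = {g}) : S.gateNum W = g + 1 := by
  have h' : ∃ g, S.H.inE W = {g} := ⟨g, h⟩
  unfold gateNum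
  rw [dif_pos h']
  have := h'.choose_spec.symm.trans h
  rw [Finset.singleton_inj.1 this]

theorem gateNum_le {V : Type} {m : ℕ} {S : FlowGraph V (Fin m)} {W : Set V} :
    S.gateNum W ≤ m := by
  unfold gateNum
  split_ifs with h
  · exact h.choose.2
  · exact Nat.zero_le _

theorem gateNum_ne_zero {V : Type} {m : ℕ} {S : FlowGraph V (Fin m)} {W : Set V}
    (h : S.gateNum W ≠ 0) : ∃ g, S.H.inE W = {g} := by
  by_contra h'
  exact h (by unfold gateNum; rw [dif_neg h'])

end

/-! ### Tables -/

section

variable {n m : ℕ} [NeZero n] (S : FlowGraph (Fin n) (Fin m))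

/-- The number of the edge whose cell is stored. -/
noncomputable def rowIdx (e : Fin m) : ℕ :=
  open Classical in if S.IsFlowEdge e then S.G.head e else n + S.G.head e

/-- The cell with number `r`. -/
def rowCell (r : ℕ) : Set (Fin n) :=
  {x | ∃ e, S.HasRow (S.rep (S.G.head e)) e ∧ S.rowIdx e = r ∧
    x ∈ S.cell (S.rep (S.G.head e)) e}

/-- The sets of vertices whose rows are stored. -/
noncomputable def rowSet (c r j : ℕ) : Set (Fin n) :=
  match c with
  | 0 => S.chull (Fin.ofNat n r)
  | 1 => S.hull (S.rep (Fin.ofNat n r)) {Fin.ofNat n r, S.last j (S.rep (Fin.ofNat n r))}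
  | 2 => S.hull (S.rep (Fin.ofNat n r)) {Fin.ofNat n r}
  | _ => S.rowCell r

open Classical in
/-- What is stored about an edge. -/
noncomputable def edgeTab (a : ℕ) (e : Fin m) : ℕ :=
  match a with
  | 0 => if S.IsFlowEdge e then 1 else 0
  | 1 => if S.InMinCut e then 1 else 0
  | 2 => (S.place e).1
  | 3 => (S.place e).2
  | 4 => S.G.head e
  | 5 => if S.Sep (S.rep (S.G.head e)) {S.G.head e, S.last (S.place e).1 (S.rep (S.G.head e))}
      (S.G.tail e) then 1 else 0
  | 6 => if S.HasRow (S.rep (S.G.head e)) e then 1 else 0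
  | 7 => S.rowIdx e
  | _ => S.gateNum (S.cell (S.rep (S.G.head e)) e)

/-- The vertices in the order of their depths. -/
noncomputable def order : Equiv.Perm (Fin n) := Tuple.sort fun x => S.depth (S.rep x) x

open Classical in
/-- The vertex from which the least tight set that contains `x` is entered. -/
noncomputable def parent (x : Fin n) : Fin n :=
  if h : ∃ g, S.H.inE (S.hull (S.rep x) {x}) = {g} then S.H.tail h.choose else x

/-- What is stored about a vertex. -/
noncomputable def vertexTab (a : ℕ) (x : Fin n) : ℕ :=
  match a with
  | 0 => S.rep x
  | 1 => S.level x
  | 2 => S.parent x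
  | 3 => S.gateNum (S.hull (S.rep x) {x})
  | _ => S.order x

/-- The stored arrays for one of the two directions. The arrays `0, …, 8` are addressed by
the slots of a dictionary. -/
noncomputable def table (key : ℕ → Option (Fin m)) (a i : ℕ) : ℕ :=
  if a < 9 then (key i).elim 0 (S.edgeTab a)
  else if a < 21 then
    let r := S.row (S.rowSet ((a - 9) / 3) (i / S.k) (i % S.k)) (i % S.k)
    if a % 3 = 0 then r.1 else if a % 3 = 1 then r.2.1 else r.2.2
  else S.vertexTab (a - 21) (Fin.ofNat n i)

variable {S}

omit [NeZero n] in
theorem parent_of {x : Fin n} {g : Fin m} (h : S.H.inE (S.hull (S.rep x) {x}) = {g}) :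
    S.parent x = S.H.tail g := by
  have h' : ∃ g, S.H.inE (S.hull (S.rep x) {x}) = {g} := ⟨g, h⟩
  unfold parent
  rw [dif_pos h']
  rw [Finset.singleton_inj.1 (h'.choose_spec.symm.trans h)]

theorem ofNat_val (x : Fin n) : Fin.ofNat n (x : ℕ) = x := by
  ext; simp

-- `rowCell` is a union over all edges with the given number. Head and kind determine an edge with a
-- stored cell, so only one edge contributes.
omit [NeZero n] in
theorem rowCell_rowIdx {e : Fin m} (he : S.HasRow (S.rep (S.G.head e)) e) :
    S.rowCell (S.rowIdx e) = S.cell (S.rep (S.G.head e)) e := by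
  ext x
  refine ⟨?_, fun h => ⟨e, he, rfl, h⟩⟩
  rintro ⟨f, hf, hi, hx⟩
  have : f = e := by
    have hh : S.G.head f = S.G.head e ∧ (S.IsFlowEdge f ↔ S.IsFlowEdge e) := by
      unfold rowIdx at hi
      have h1 := (S.G.head e).2
      have h2 := (S.G.head f).2
      split_ifs at hi with a b b
      · exact ⟨Fin.ext hi, iff_of_true a b⟩
      · omega
      · omega
      · exact ⟨Fin.ext (by omega), iff_of_false a b⟩
    rw [hh.1] at hf
    rcases he with ⟨h1, h2⟩ | h1 <;> rcases hf with ⟨h3, h4⟩ | h3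
    · exact nonflow_unique (by rw [hh.1]; exact cls_rep _) h3 h1 (by rwa [hh.1] at h4 ⊢) h2 hh.1
    · exact absurd (hh.2.1 (by obtain ⟨i, p, h, _⟩ := h3; exact ⟨i, p, h⟩)) h1
    · exact absurd (hh.2.2 (by obtain ⟨i, p, h, _⟩ := h1; exact ⟨i, p, h⟩)) h3
    · exact Special.unique (by rw [hh.1]; exact cls_rep _) h3 h1 hh.1
  rwa [this] at hx

omit [NeZero n] in
theorem card_inE_rowCell_rowIdx {e : Fin m} (he : S.HasRow (S.rep (S.G.head e)) e) :
    (S.H.inE (S.rowCell (S.rowIdx e))).card ≤ 1 := by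
  rw [rowCell_rowIdx he]
  exact card_inE_cell (cls_rep _)

omit [NeZero n] in
theorem rowIdx_lt (e : Fin m) : S.rowIdx e < 2 * n := by
  unfold rowIdx
  have h1 := (S.G.head e).2
  split_ifs <;> omega

omit [NeZero n] in
theorem len_lt {i : ℕ} (hi : i < S.k) : S.P.len i < n := by
  have : Function.Injective fun p : Fin (S.P.len i + 1) => S.P.vtx i p := by
    intro p q h
    exact Fin.ext (S.P.vtx_inj i hi p (by omega) q (by omega) h)
  simpa using Fintype.card_le_of_injective _ this

omit [NeZero n] in
theorem place_lt {e : Fin m} (h : S.IsFlowEdge e) : (S.place e).1 < S.k ∧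
    (S.place e).2 < S.P.len (S.place e).1 ∧ (S.place e).2 + 1 < n := by
  obtain ⟨h1, h2, _⟩ := at_place h
  have := len_lt h1
  exact ⟨h1, h2, by omega⟩

theorem edgeTab_le (a : ℕ) (e : Fin m) : S.edgeTab a e ≤ 2 * n + m + S.k := by
  have hn : 0 < n := Nat.pos_of_ne_zero (NeZero.ne n)
  unfold edgeTab
  have hpl : (S.place e).1 ≤ S.k ∧ (S.place e).2 ≤ n := by
    by_cases h : S.IsFlowEdge e
    · have := place_lt h
      omega
    · have : ¬ ∃ x : ℕ × ℕ, S.At e x.1 x.2 := fun ⟨x, hx⟩ => h ⟨_, _, hx⟩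
      unfold place
      rw [dif_neg this]
      simp
  split
  · split_ifs <;> omega
  · split_ifs <;> omega
  · omega
  · omega
  · have := (S.G.head e).2
    omega
  · split_ifs <;> omega
  · split_ifs <;> omega
  · have := S.rowIdx_lt e
    omega
  · have := gateNum_le (S := S) (W := S.cell (S.rep (S.G.head e)) e)
    omega

omit [NeZero n] in
theorem vertexTab_le (a : ℕ) (x : Fin n) : S.vertexTab a x ≤ 2 * n + m + S.k := by
  unfold vertexTab
  split
  · have := (S.rep x).2
    omega
  · have : S.level x ≤ n := by
      unfold level
      simpa using Set.ncard_le_card (S.chull x)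
    omega
  · have := (S.parent x).2
    omega
  · have := gateNum_le (S := S) (W := S.hull (S.rep x) {x})
    omega
  · have := (S.order x).2
    omega

theorem table_le (hk : 0 < S.k) (key : ℕ → Option (Fin m)) (a i : ℕ) :
    S.table key a i ≤ 2 * n + m + S.k := by
  unfold table
  have hlt := len_lt (S := S) (Nat.mod_lt i hk)
  have := S.row_le (S.rowSet ((a - 9) / 3) (i / S.k) (i % S.k)) (i % S.k)
  dsimp only
  split_ifs
  · cases key i with
    | none => simp
    | some e => exact edgeTab_le a e
  · omega
  · omega
  · omega
  · exact vertexTab_le _ _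

theorem table_edge {key : ℕ → Option (Fin m)} {a i : ℕ} {e : Fin m} (ha : a < 9)
    (hi : key i = some e) : S.table key a i = S.edgeTab a e := by
  simp [table, ha, hi]

theorem table_row {key : ℕ → Option (Fin m)} {c r j : ℕ} (hc : c < 4) (hj : j < S.k) :
    S.table key (9 + 3 * c) (r * S.k + j) = (S.row (S.rowSet c r j) j).1 ∧
    S.table key (9 + 3 * c + 1) (r * S.k + j) = (S.row (S.rowSet c r j) j).2.1 ∧
    S.table key (9 + 3 * c + 2) (r * S.k + j) = (S.row (S.rowSet c r j) j).2.2 := by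
  have h1 : (r * S.k + j) / S.k = r := by
    rw [Nat.mul_comm, Nat.mul_add_div (by omega), Nat.div_eq_of_lt hj, Nat.add_zero]
  have h2 : (r * S.k + j) % S.k = j := by
    rw [Nat.mul_comm, Nat.mul_add_mod, Nat.mod_eq_of_lt hj]
  unfold table
  rw [h1, h2]
  refine ⟨?_, ?_, ?_⟩
  · rw [if_neg (by omega), if_pos (by omega), show (9 + 3 * c - 9) / 3 = c by omega]
    exact if_pos (by omega)
  · rw [if_neg (by omega), if_pos (by omega), show (9 + 3 * c + 1 - 9) / 3 = c by omega]
    exact (if_neg (by omega)).trans (if_pos (by omega))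
  · rw [if_neg (by omega), if_pos (by omega), show (9 + 3 * c + 2 - 9) / 3 = c by omega]
    exact (if_neg (by omega)).trans (if_neg (by omega))

theorem table_vertex {key : ℕ → Option (Fin m)} {a : ℕ} (x : Fin n) :
    S.table key (21 + a) x = S.vertexTab a x := by
  unfold table
  rw [if_neg (by omega), if_neg (by omega), ofNat_val, Nat.add_sub_cancel_left]

/-! ### The edges in the dictionary -/

variable (S) in
open Classical in
/-- The edges about which something is stored. -/
noncomputable def keys : Finset (Fin m) :=
  Finset.univ.filter fun e => S.IsFlowEdge e ∨ S.HasRow (S.rep (S.G.head e)) e ∨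
    S.rev.HasRow (S.rev.rep (S.rev.G.head e)) e

omit [NeZero n] in
theorem mem_keys_of_hasRow {e : Fin m} (h : S.HasRow (S.rep (S.G.head e)) e) : e ∈ S.keys := by
  simp [keys, h]

omit [NeZero n] in
theorem mem_keys_of_isFlowEdge {e : Fin m} (h : S.IsFlowEdge e) : e ∈ S.keys := by
  simp [keys, h]

omit [NeZero n] in
open Classical in
theorem card_flow_le : (Finset.univ.filter fun e => S.IsFlowEdge e).card ≤ S.k * n := by
  have : (Finset.univ.filter fun e => S.IsFlowEdge e).card ≤
      (Finset.range S.k ×ˢ Finset.range n).card := by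
    refine Finset.card_le_card_of_injOn S.place ?_ ?_
    · intro e he
      have := place_lt (Finset.mem_filter.1 he).2
      simp only [Finset.coe_product, Finset.coe_range, Set.mem_prod, Set.mem_Iio]
      omega
    · intro e he f hf h
      have h1 := at_place (Finset.mem_filter.1 he).2
      have h2 := at_place (Finset.mem_filter.1 hf).2
      rw [h] at h1
      exact h1.2.2.symm.trans h2.2.2
  simpa using this

omit [NeZero n] in
open Classical in
theorem card_nonflow_le : (Finset.univ.filter fun e => ¬ S.IsFlowEdge e ∧
    S.HasRow (S.rep (S.G.head e)) e).card ≤ n := by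
  have : (Finset.univ.filter fun e => ¬ S.IsFlowEdge e ∧
      S.HasRow (S.rep (S.G.head e)) e).card ≤ (Finset.univ : Finset (Fin n)).card := by
    refine Finset.card_le_card_of_injOn S.G.head (fun _ _ => Finset.mem_coe.2 (Finset.mem_univ _)) ?_
    intro e he f hf h
    obtain ⟨h1, h2⟩ := (Finset.mem_filter.1 he).2
    obtain ⟨h3, h4⟩ := (Finset.mem_filter.1 hf).2
    have key : ∀ e, ¬ S.IsFlowEdge e → S.HasRow (S.rep (S.G.head e)) e →
        S.Sep (S.rep (S.G.head e)) {S.G.head e} (S.G.tail e) := by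
      rintro e h1 (h | ⟨i, p, h, _⟩)
      · exact h.2
      · exact absurd ⟨i, p, h⟩ h1
    have h5 := key f h3 h4
    rw [← h] at h5
    exact nonflow_unique (cls_rep _) h1 h3 (key e h1 h2) (by rw [← h]; exact h5) h
  simpa using this

-- At most `k * n` path edges, and in each direction at most `n` further edges with a stored cell.
omit [NeZero n] in
theorem card_keys_le (hk : 0 < S.k) : S.keys.card ≤ 3 * (S.k * n) := by
  classical
  have h : S.keys ⊆ (Finset.univ.filter fun e => S.IsFlowEdge e) ∪
      ((Finset.univ.filter fun e => ¬ S.IsFlowEdge e ∧ S.HasRow (S.rep (S.G.head e)) e) ∪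
      (Finset.univ.filter fun e => ¬ S.rev.IsFlowEdge e ∧
        S.rev.HasRow (S.rev.rep (S.rev.G.head e)) e)) := by
    intro e he
    simp only [keys, Finset.mem_filter, Finset.mem_univ, true_and] at he
    simp only [Finset.mem_union, Finset.mem_filter, Finset.mem_univ, true_and, isFlowEdge_rev]
    tauto
  have h1 := (Finset.card_le_card h).trans (Finset.card_union_le _ _)
  have h2 := Finset.card_union_le (Finset.univ.filter fun e => ¬ S.IsFlowEdge e ∧
    S.HasRow (S.rep (S.G.head e)) e) (Finset.univ.filter fun e => ¬ S.rev.IsFlowEdge e ∧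
        S.rev.HasRow (S.rev.rep (S.rev.G.head e)) e)
  have h3 := S.card_flow_le
  have h4 := S.card_nonflow_le
  have h5 := S.rev.card_nonflow_le
  have h6 : n ≤ S.k * n := Nat.le_mul_of_pos_left _ hk
  omega

end

end FlowGraph

/-! ## Queries as expressions -/

open MultiDigraph FlowGraph WordRAM

namespace MinCutOracle

/-- The bucket of a key. -/
def bucket (x : Expr) : Expr := .op .mod (.op .mod (.op .mul (.hdr 5) x) (.hdr 3)) (.hdr 4)

/-- The slot of a key. -/
def slot (x : Expr) : Expr :=
  .op .add (.arr 2 (bucket x))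
    (.op .mod (.op .mod (.op .mul (.arr 0 (bucket x)) x) (.hdr 3)) (.arr 1 (bucket x)))

/-- Is there an entry for this edge? -/
def valid (x : Expr) : Expr := .op .eq (.arr 3 (slot x)) (.op .add x (.lit 1))

/-- An item stored about an edge. -/
def fld (b a : ℕ) (x : Expr) : Expr := .arr (b + a) (slot x)

/-- An item stored about a vertex. -/
def vtab (b a : ℕ) (v : Expr) : Expr := .arr (b + (21 + a)) v

/-- Is the vertex number `p` of the path number `j` in the stored set with number `r`? -/
def memRow (b c : ℕ) (r j p : Expr) : Expr :=
  ((Expr.not (.op .lt p (.arr (b + (9 + 3 * c)) (.op .add (.op .mul r (.hdr 1)) j)))).and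
    (.op .lt p (.arr (b + (9 + 3 * c + 1)) (.op .add (.op .mul r (.hdr 1)) j)))).or
  (Expr.not (.op .lt p (.arr (b + (9 + 3 * c + 2)) (.op .add (.op .mul r (.hdr 1)) j))))

/-- Is the edge in a minimum cut? -/
def inc (b : ℕ) (x : Expr) : Expr := (valid x).and (fld b 1 x)

/-- Is the tail of the path edge `x` outside of the least closed set that contains `v`? -/
def avoids (b : ℕ) (v x : Expr) : Expr := (memRow b 0 v (fld b 2 x) (fld b 3 x)).not

/-- Are both edges in one minimum cut? -/
def two (b : ℕ) (x y : Expr) : Expr :=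
  (inc b x).and ((inc b y).and ((avoids b (fld b 4 y) x).and (avoids b (fld b 4 x) y)))

/-- The test `FlowGraph.HeadTest`. -/
def headTest (b : ℕ) (x y : Expr) : Expr :=
  ((fld b 6 x).and ((fld b 0 y).and
    (memRow b 3 (fld b 7 x) (fld b 2 y) (.op .add (fld b 3 y) (.lit 1))))).or
  ((fld b 0 x).and ((fld b 5 x).and (memRow b 1 (fld b 4 y) (fld b 2 x) (fld b 3 x)).not))

/-- The test `FlowGraph.Joint`. -/
def joint (b : ℕ) (x y : Expr) : Expr :=
  (valid x).and ((valid y).and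
    ((Expr.op .eq (vtab b 0 (fld b 4 y)) (vtab b 0 (fld b 4 x))).and
      ((headTest b x y).and (headTest b y x))))

/-- The stored array has a dictionary with keys `K`. -/
structure HasDict {w : ℕ} (n m k L M : ℕ) (D : List (BitVec w)) (d : PerfectHash.Dict)
    (key : ℕ → Option (Fin m)) (K : Finset (Fin m)) : Prop where
  fit : M * M + M < 2 ^ w
  le_L : 64 * (k * n) ≤ L
  L_lt : L < M
  m_lt : m < M
  P_le : d.P ≤ M
  a_lt : d.a < d.P
  mult_lt : ∀ b, d.mult b < d.P
  B_pos : 0 < d.B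
  slot_lt : ∀ x, d.slot x < L
  mem_iff : ∀ e, e ∈ K ↔ key (d.slot e) = some e
  val_k : ∀ σ, (Expr.hdr 1).val D σ = k
  val_n : ∀ σ, (Expr.hdr 2).val D σ = n
  val_P : ∀ σ, (Expr.hdr 3).val D σ = d.P
  val_B : ∀ σ, (Expr.hdr 4).val D σ = d.B
  val_a : ∀ σ, (Expr.hdr 5).val D σ = d.a
  val_mult : ∀ σ e i, i < d.B → Expr.val D σ e = i → (Expr.arr 0 e).val D σ = d.mult i
  val_size : ∀ σ e i, i < d.B → Expr.val D σ e = i → (Expr.arr 1 e).val D σ = d.size i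
  val_off : ∀ σ e i, i < d.B → Expr.val D σ e = i → (Expr.arr 2 e).val D σ = d.off i
  val_key : ∀ σ e i, i < L → Expr.val D σ e = i →
    (Expr.arr 3 e).val D σ = (key i).elim 0 fun e => (e : ℕ) + 1

/-- The stored array has the tables for `S`, from the array number `b` on. -/
structure HasTable {w n m : ℕ} [NeZero n] (L : ℕ) (D : List (BitVec w))
    (key : ℕ → Option (Fin m)) (K : Finset (Fin m)) (S : FlowGraph (Fin n) (Fin m)) (b : ℕ) :
    Prop where
  val_tab : ∀ σ a e i, a < 26 → i < L → Expr.val D σ e = i →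
    (Expr.arr (b + a) e).val D σ = S.table key a i
  flow_mem : ∀ e, S.IsFlowEdge e → e ∈ K
  row_mem : ∀ e, S.HasRow (S.rep (S.G.head e)) e → e ∈ K

variable {w n m k L M : ℕ} {D : List (BitVec w)} {d : PerfectHash.Dict}
  {key : ℕ → Option (Fin m)} {K : Finset (Fin m)} {σ : State w} {e f : Fin m} {x y : Expr}

section

variable (hD : HasDict n m k L M D d key K)

include hD

theorem HasDict.lt_of_le {a : ℕ} (h : a ≤ M * M + M) : a < 2 ^ w :=
  lt_of_le_of_lt h hD.fit

theorem HasDict.w_pos : 0 < w := by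
  rcases Nat.eq_zero_or_pos w with rfl | h
  · have := hD.fit
    have := hD.L_lt
    omega
  · exact h

theorem HasDict.val_bucket (hx : x.val D σ = e) : (bucket x).val D σ = d.bucket e := by
  have h1 : d.a * (e : ℕ) ≤ M * M :=
    Nat.mul_le_mul (hD.a_lt.le.trans hD.P_le) (e.2.le.trans hD.m_lt.le)
  exact Expr.val_mod (Expr.val_mod (Expr.val_mul (hD.val_a σ) hx (hD.lt_of_le (by omega)))
    (hD.val_P σ)) (hD.val_B σ)

theorem HasDict.bucket_lt (i : ℕ) : d.bucket i < d.B :=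
  Nat.mod_lt _ hD.B_pos

theorem HasDict.val_slot (hx : x.val D σ = e) : (slot x).val D σ = d.slot e := by
  have hb := hD.val_bucket hx
  have h1 : d.mult (d.bucket e) * (e : ℕ) ≤ M * M :=
    Nat.mul_le_mul ((hD.mult_lt _).le.trans hD.P_le) (e.2.le.trans hD.m_lt.le)
  have h2 := hD.slot_lt e
  have h3 := hD.L_lt
  exact Expr.val_add (hD.val_off σ _ _ (hD.bucket_lt _) hb) (Expr.val_mod (Expr.val_mod
    (Expr.val_mul (hD.val_mult σ _ _ (hD.bucket_lt _) hb) hx (hD.lt_of_le (by omega)))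
    (hD.val_P σ)) (hD.val_size σ _ _ (hD.bucket_lt _) hb))
    (lt_of_lt_of_le h2 (hD.lt_of_le (by omega)).le)

theorem HasDict.holds_valid (hx : x.val D σ = e) : (valid x).Holds D σ ↔ e ∈ K := by
  have h1 : (1 : ℕ) < 2 ^ w := Nat.one_lt_two_pow hD.w_pos.ne'
  have hm := hD.m_lt
  have he := e.2
  rw [valid, Expr.holds_eq hD.w_pos, hD.val_key σ _ _ (hD.slot_lt e) (hD.val_slot hx),
    Expr.val_add hx (Expr.val_lit h1) (hD.lt_of_le (by omega)), hD.mem_iff]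
  cases h : key (d.slot e) with
  | none => simp
  | some f =>
    simp only [Option.elim_some, Option.some_inj, Nat.add_right_cancel_iff]
    exact Fin.val_inj

variable [NeZero n] {S : FlowGraph (Fin n) (Fin m)} {b : ℕ} (hT : HasTable L D key K S b)

include hT

theorem HasDict.val_fld (hx : x.val D σ = e) (he : e ∈ K) {a : ℕ} (ha : a < 9) :
    (fld b a x).val D σ = S.edgeTab a e := by
  rw [fld, hT.val_tab σ a _ _ (by omega) (hD.slot_lt e) (hD.val_slot hx)]
  exact table_edge ha ((hD.mem_iff e).1 he)

omit hT in
theorem HasDict.n_lt (hk : 0 < k) : 3 * n < L := by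
  have := hD.le_L
  have h2 : n ≤ k * n := Nat.le_mul_of_pos_left _ hk
  have h3 : 0 < n := Nat.pos_of_ne_zero (NeZero.ne n)
  omega

theorem HasDict.val_vtab (hk : 0 < k) {v : Fin n} (hx : x.val D σ = v) {a : ℕ} (ha : a < 5) :
    (vtab b a x).val D σ = S.vertexTab a v := by
  have := v.2
  have := hD.n_lt hk
  rw [vtab, hT.val_tab σ (21 + a) _ _ (by omega) (by omega) hx]
  exact table_vertex v

theorem HasDict.holds_fld_zero (hx : x.val D σ = e) (he : e ∈ K) :
    (fld b 0 x).Holds D σ ↔ S.IsFlowEdge e := by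
  rw [Expr.holds_iff_val, hD.val_fld hT hx he (by omega)]
  simp [edgeTab]

theorem HasDict.holds_inc (hx : x.val D σ = e) : (inc b x).Holds D σ ↔ S.InMinCut e := by
  rw [inc, Expr.holds_and, hD.holds_valid hx]
  constructor
  · rintro ⟨he, h⟩
    rw [Expr.holds_iff_val, hD.val_fld hT hx he (by omega)] at h
    simpa [edgeTab] using h
  · intro h
    have he := hT.flow_mem e h.isFlowEdge
    refine ⟨he, ?_⟩
    rw [Expr.holds_iff_val, hD.val_fld hT hx he (by omega)]
    simpa [edgeTab] using h

variable (hk : S.k = k)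

include hk

theorem HasDict.holds_memRow {r j p : Expr} {c r' j' p' : ℕ} (hc : c < 4)
    (hr : r.val D σ = r') (hj : j.val D σ = j') (hp : p.val D σ = p') (hr' : r' < 2 * n)
    (hj' : j' < S.k) (hp' : p' ≤ S.P.len j') (hW : (S.H.inE (S.rowSet c r' j')).card ≤ 1) :
    (memRow b c r j p).Holds D σ ↔ S.P.vtx j' p' ∈ S.rowSet c r' j' := by
  -- There are fewer than `2 * n` rows of `k` entries, well within an array of length `64 * (k *
  -- n)`.
  have h1 : r' * S.k + j' < 2 * (k * n) := by
    rw [hk] at hj' ⊢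
    have : (r' + 1) * k ≤ 2 * n * k := Nat.mul_le_mul_right _ hr'
    have h2 : (r' + 1) * k = r' * k + k := by ring
    have h3 : 2 * n * k = 2 * (k * n) := by ring
    omega
  have h2 := hD.le_L
  have h3 := hD.L_lt
  have hidx : (Expr.op .add (.op .mul r (.hdr 1)) j).val D σ = r' * S.k + j' := by
    refine Expr.val_add (Expr.val_mul hr ((hD.val_k σ).trans hk.symm) ?_) hj ?_ <;>
      exact hD.lt_of_le (by omega)
  obtain ⟨t1, t2, t3⟩ := table_row (S := S) (key := key) (c := c) (r := r') hc hj'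
  rw [memRow, Expr.holds_or hD.w_pos, Expr.holds_and, Expr.holds_not hD.w_pos,
    Expr.holds_not hD.w_pos, Expr.holds_lt hD.w_pos, Expr.holds_lt hD.w_pos,
    Expr.holds_lt hD.w_pos, hT.val_tab σ _ _ _ (by omega) (by omega) hidx,
    hT.val_tab σ _ _ _ (by omega) (by omega) hidx,
    hT.val_tab σ _ _ _ (by omega) (by omega) hidx, t1, t2, t3, hp, mem_iff_row hW hj' hp',
    not_lt, not_lt]

theorem HasDict.holds_memRow_tail {r : Expr} {c r' : ℕ} (hc : c < 4) (hx : x.val D σ = e)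
    (he : S.IsFlowEdge e) (hr : r.val D σ = r') (hr' : r' < 2 * n)
    (hW : (S.H.inE (S.rowSet c r' (S.place e).1)).card ≤ 1) :
    (memRow b c r (fld b 2 x) (fld b 3 x)).Holds D σ ↔
      S.G.tail e ∈ S.rowSet c r' (S.place e).1 := by
  have hK := hT.flow_mem e he
  have hat := at_place he
  rw [hat.tail]
  exact hD.holds_memRow hT hk hc hr (hD.val_fld hT hx hK (by omega))
    (hD.val_fld hT hx hK (by omega)) hr' hat.1 hat.2.1.le hW

theorem HasDict.holds_avoids {v : Fin n} (hx : x.val D σ = e) (he : S.IsFlowEdge e)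
    (hy : y.val D σ = v) : (avoids b y x).Holds D σ ↔ S.CSep v (S.G.tail e) := by
  have h0 : S.rowSet 0 v (S.place e).1 = S.chull v := by
    change S.chull (Fin.ofNat n v) = _
    rw [ofNat_val]
  have hv := v.2
  rw [avoids, Expr.holds_not hD.w_pos, hD.holds_memRow_tail hT hk (by omega) hx he hy
    (by omega) (by rw [h0]; exact card_inE_chull v), h0]
  exact not_not

theorem HasDict.holds_two (hx : x.val D σ = e) (hy : y.val D σ = f) :
    (two b x y).Holds D σ ↔ ∃ W, S.Closed W ∧ e ∈ S.G.inE W ∧ f ∈ S.G.inE W := by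
  rw [exists_closed_pair_iff, two, Expr.holds_and, Expr.holds_and, Expr.holds_and,
    hD.holds_inc hT hx, hD.holds_inc hT hy]
  refine and_congr_right fun he => and_congr_right fun hf => ?_
  have he := he.isFlowEdge
  have hf := hf.isFlowEdge
  rw [hD.holds_avoids hT hk hx he (v := S.G.head f)
    (hD.val_fld hT hy (hT.flow_mem f hf) (a := 4) (by omega)),
    hD.holds_avoids hT hk hy hf (v := S.G.head e)
    (hD.val_fld hT hx (hT.flow_mem e he) (a := 4) (by omega))]

theorem HasDict.holds_headTest (hx : x.val D σ = e) (hy : y.val D σ = f) (he : e ∈ K)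
    (hf : f ∈ K) (hr : S.rep (S.G.head f) = S.rep (S.G.head e)) :
    (headTest b x y).Holds D σ ↔ S.HeadTest (S.rep (S.G.head e)) e f := by
  rw [headTest, HeadTest, Expr.holds_or hD.w_pos, Expr.holds_and, Expr.holds_and,
    Expr.holds_and, Expr.holds_and, hD.holds_fld_zero hT hx he, hD.holds_fld_zero hT hy hf,
    Expr.holds_iff_val (e := fld b 6 x), Expr.holds_iff_val (e := fld b 5 x),
    hD.val_fld hT hx he (by omega), hD.val_fld hT hx he (by omega)]
  refine or_congr ?_ ?_
  · have h6 : S.edgeTab 6 e ≠ 0 ↔ S.HasRow (S.rep (S.G.head e)) e := by simp [edgeTab]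
    rw [h6]
    refine and_congr_right fun h1 => and_congr_right fun h2 => ?_
    obtain ⟨p1, p2, p3⟩ := place_lt h2
    have hn := hD.n_lt (by omega)
    have := hD.L_lt
    rw [hD.holds_memRow hT hk (c := 3) (r' := S.rowIdx e) (j' := (S.place f).1)
      (p' := (S.place f).2 + 1) (by omega) (hD.val_fld hT hx he (a := 7) (by omega))
      (hD.val_fld hT hy hf (a := 2) (by omega))
      (Expr.val_add (hD.val_fld hT hy hf (a := 3) (by omega))
        (Expr.val_lit (Nat.one_lt_two_pow hD.w_pos.ne')) (hD.lt_of_le ?_))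
      (rowIdx_lt e) p1 p2 (card_inE_rowCell_rowIdx h1)]
    · have : S.rowSet 3 (S.rowIdx e) (S.place f).1 = S.cell (S.rep (S.G.head e)) e :=
        rowCell_rowIdx h1
      rw [this, (at_place h2).head]
    · omega
  · constructor
    · rintro ⟨h1, h2, h3⟩
      have hat := at_place h1
      have hs : S.rowSet 1 (S.G.head f) (S.place e).1 = S.hull (S.rep (S.G.head f))
          {S.G.head f, S.last (S.place e).1 (S.rep (S.G.head f))} := by
        change S.hull (S.rep (Fin.ofNat n (S.G.head f)))
          {Fin.ofNat n (S.G.head f), S.last _ (S.rep (Fin.ofNat n (S.G.head f)))} = _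
        rw [ofNat_val]
      have hlt := (S.G.head f).2
      rw [Expr.holds_not hD.w_pos, hD.holds_memRow_tail hT hk (by omega) hx h1
        (r' := S.G.head f) (hD.val_fld hT hy hf (a := 4) (by omega)) (by omega)
        (by rw [hs]; exact card_inE_hull (Set.mem_insert _ _) (cls_rep _)), hs, hr] at h3
      refine ⟨_, _, hat, ?_, not_not.1 h3⟩
      simpa [edgeTab] using h2
    · rintro ⟨i, p, hat, h2, h3⟩
      have h1 : S.IsFlowEdge e := ⟨i, p, hat⟩
      obtain ⟨rfl, rfl⟩ := hat.unique (at_place h1)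
      have hs : S.rowSet 1 (S.G.head f) (S.place e).1 = S.hull (S.rep (S.G.head f))
          {S.G.head f, S.last (S.place e).1 (S.rep (S.G.head f))} := by
        change S.hull (S.rep (Fin.ofNat n (S.G.head f)))
          {Fin.ofNat n (S.G.head f), S.last _ (S.rep (Fin.ofNat n (S.G.head f)))} = _
        rw [ofNat_val]
      have hlt := (S.G.head f).2
      refine ⟨h1, by simpa [edgeTab] using h2, ?_⟩
      rw [Expr.holds_not hD.w_pos, hD.holds_memRow_tail hT hk (by omega) hx h1
        (r' := S.G.head f) (hD.val_fld hT hy hf (a := 4) (by omega)) (by omega)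
        (by rw [hs]; exact card_inE_hull (Set.mem_insert _ _) (cls_rep _)), hs, hr]
      exact not_not.2 h3

-- An edge missing from the dictionary fails the test, so the lookup may answer negatively for it.
omit hD hk in
theorem HasTable.mem_of_headTest (h : S.HeadTest (S.rep (S.G.head e)) e f) : e ∈ K := by
  rcases h with ⟨h, _⟩ | ⟨i, p, h, _⟩
  · exact hT.row_mem e h
  · exact hT.flow_mem e ⟨i, p, h⟩

theorem HasDict.holds_joint (hef : e ≠ f) (hpos : 0 < k) (hx : x.val D σ = e)
    (hy : y.val D σ = f) : (joint b x y).Holds D σ ↔ S.Joint e f := by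
  have hrep : ∀ {x : Expr} {e : Fin m}, x.val D σ = e → e ∈ K →
      (vtab b 0 (fld b 4 x)).val D σ = S.rep (S.G.head e) := fun hx he =>
    hD.val_vtab hT hpos (hD.val_fld hT hx he (a := 4) (by omega)) (a := 0) (by omega)
  have hcls : S.rep (S.G.head f) = S.rep (S.G.head e) →
      S.Cls (S.G.head f) (S.rep (S.G.head e)) := fun h => h ▸ cls_rep _
  rw [joint, Expr.holds_and, Expr.holds_and, Expr.holds_and, Expr.holds_and,
    hD.holds_valid hx, hD.holds_valid hy, Expr.holds_eq hD.w_pos, Joint]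
  constructor
  · rintro ⟨he, hf, hr, h1, h2⟩
    rw [hrep hx he, hrep hy hf, Fin.val_inj] at hr
    rw [hD.holds_headTest hT hk hx hy he hf hr] at h1
    rw [hD.holds_headTest hT hk hy hx hf he hr.symm, hr] at h2
    exact ⟨hr, (common_iff_headTest hef (cls_rep _) (hcls hr)).2 ⟨h1, h2⟩⟩
  · rintro ⟨hr, h⟩
    obtain ⟨h1, h2⟩ := (common_iff_headTest hef (cls_rep _) (hcls hr)).1 h
    have he := hT.mem_of_headTest h1
    rw [← hr] at h2
    have hf := hT.mem_of_headTest h2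
    refine ⟨he, hf, ?_, ?_, ?_⟩
    · rw [hrep hx he, hrep hy hf, hr]
    · rwa [hD.holds_headTest hT hk hx hy he hf hr]
    · rwa [hD.holds_headTest hT hk hy hx hf he hr.symm]

end

end MinCutOracle

/-! ## The query for the size -/

open MultiDigraph FlowGraph WordRAM

namespace FlowGraph

variable {V E : Type} [Fintype E] {S : FlowGraph V E}

theorem cls_rep_iff {x y : V} : S.Cls x (S.rep y) ↔ S.rep x = S.rep y :=
  rep_eq_iff.symm.trans (by rw [rep_eq_iff.2 (cls_rep y).symm])

theorem level_rep (x : V) : S.level (S.rep x) = S.level x := by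
  unfold level
  rw [(cls_rep x).chull_eq]

variable (S) in
/-- The vertices that the sink side of a minimum cut has to avoid in order to contain as many of
the edges `e` and `f` as possible. -/
def avoidSet (e f : E) : Set V :=
  {u | (S.InMinCut e ∧ u = S.G.tail e) ∨ (S.InMinCut f ∧ (S.InMinCut e →
    ∃ W, S.Closed W ∧ e ∈ S.G.inE W ∧ f ∈ S.G.inE W) ∧ u = S.G.tail f)}

theorem optimal_cgreatest [Finite V] [DecidableEq E] {e f : E} (hef : e ≠ f)
    (hcl : ∃ W, S.Closed W)
    (h0 : S.Joint e f ∨ S.rev.Joint e f → S.InMinCut e ∨ S.InMinCut f) :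
    S.Optimal e f (S.cgreatest (S.avoidSet e f)) := by
  by_cases h2 : ∃ W, S.Closed W ∧ e ∈ S.G.inE W ∧ f ∈ S.G.inE W
  · obtain ⟨W, hW, he, hf⟩ := id h2
    rw [mem_inE] at he hf
    have hd : Disjoint W (S.avoidSet e f) := by
      rw [Set.disjoint_left]
      rintro u hu (⟨_, rfl⟩ | ⟨_, _, rfl⟩)
      · exact he.1 hu
      · exact hf.1 hu
    -- The greatest admissible closed set contains `W`, hence both heads, and avoids both tails.
    obtain ⟨hc, hdis⟩ := closed_cgreatest ⟨W, hW, hd⟩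
    have hsub := subset_cgreatest hW hd
    have hie : S.InMinCut e := ⟨W, hW, he.2, he.1⟩
    have hif : S.InMinCut f := ⟨W, hW, hf.2, hf.1⟩
    have h3 : e ∈ S.G.inE (S.cgreatest (S.avoidSet e f)) ∧
        f ∈ S.G.inE (S.cgreatest (S.avoidSet e f)) := by
      rw [mem_inE, mem_inE]
      exact ⟨⟨fun h => Set.disjoint_left.1 hdis h (Or.inl ⟨hie, rfl⟩), hsub he.2⟩,
        fun h => Set.disjoint_left.1 hdis h (Or.inr ⟨hif, fun _ => h2, rfl⟩), hsub hf.2⟩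
    exact optimal_of_closed hef hc (fun _ => h3) (fun _ => Or.inl h3.1) h0
  · by_cases hie : S.InMinCut e
    · obtain ⟨W, hW, he1, he2⟩ := id hie
      have hd : Disjoint W (S.avoidSet e f) := by
        rw [Set.disjoint_left]
        rintro u hu (⟨_, rfl⟩ | ⟨_, h, rfl⟩)
        · exact he2 hu
        · exact h2 (h hie)
      obtain ⟨hc, hdis⟩ := closed_cgreatest ⟨W, hW, hd⟩
      have hsub := subset_cgreatest hW hd
      refine optimal_of_closed hef hc (fun h => absurd h h2) (fun _ => Or.inl ?_) h0
      rw [mem_inE]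
      exact ⟨fun h => Set.disjoint_left.1 hdis h (Or.inl ⟨hie, rfl⟩), hsub he1⟩
    · by_cases hif : S.InMinCut f
      · obtain ⟨W, hW, hf1, hf2⟩ := id hif
        have hd : Disjoint W (S.avoidSet e f) := by
          rw [Set.disjoint_left]
          rintro u hu (⟨h, _⟩ | ⟨_, _, rfl⟩)
          · exact hie h
          · exact hf2 hu
        obtain ⟨hc, hdis⟩ := closed_cgreatest ⟨W, hW, hd⟩
        have hsub := subset_cgreatest hW hd
        refine optimal_of_closed hef hc (fun h => absurd h h2) (fun _ => Or.inr ?_) h0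
        rw [mem_inE]
        exact ⟨fun h => Set.disjoint_left.1 hdis h
          (Or.inr ⟨hif, fun h => absurd h hie, rfl⟩), hsub hf1⟩
      · obtain ⟨W, hW⟩ := hcl
        have hd : Disjoint W (S.avoidSet e f) := by
          rw [Set.disjoint_left]
          rintro u hu (⟨h, _⟩ | ⟨h, _⟩)
          · exact hie h
          · exact hif h
        refine optimal_of_closed hef (closed_cgreatest ⟨W, hW, hd⟩).1
          (fun h => absurd h h2) (fun h => ?_) h0
        exact absurd h (not_or.2 ⟨hie, hif⟩)

end FlowGraph

namespace MinCutOracle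

/-- Does the deletion of the two edges decrease the size of a minimum cut? -/
def one (x y : Expr) : Expr :=
  (inc 4 x).or ((inc 4 y).or ((joint 4 x y).or (joint 30 x y)))

/-- The size of a minimum cut after the deletion of two edges. -/
def sizeExpr (x y : Expr) : Expr :=
  .ite (two 4 x y) (.op .sub (.hdr 1) (.lit 2))
    (.ite (one x y) (.op .sub (.hdr 1) (.lit 1)) (.hdr 1))

/-- Does a cut of the original minimum size suffice? -/
def modeExpr (x y : Expr) : Expr :=
  (inc 4 x).or ((inc 4 y).or ((joint 4 x y).or (joint 30 x y)).not)

/-- Is `v` in the greatest closed set that avoids `FlowGraph.avoidSet`? -/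
def sinkSide (v x y : Expr) : Expr :=
  (memRow 4 0 v (.lit 0) (.lit 0)).not.and
    (((inc 4 x).not.or (avoids 4 v x)).and
      (((inc 4 y).and ((inc 4 x).not.or (two 4 x y))).not.or (avoids 4 v y)))

/-- The stored array describes `S` and `S.rev`. -/
structure Represents {w n m : ℕ} [NeZero n] (D : List (BitVec w))
    (S : FlowGraph (Fin n) (Fin m)) (L M : ℕ) (d : PerfectHash.Dict)
    (key : ℕ → Option (Fin m)) (K : Finset (Fin m)) : Prop where
  dict : HasDict n m S.k L M D d key K
  fwd : HasTable L D key K S 4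
  bwd : HasTable L D key K S.rev 30
  pos : 0 < S.k

section

variable {w n m L M : ℕ} [NeZero n] {D : List (BitVec w)} {S : FlowGraph (Fin n) (Fin m)}
  {d : PerfectHash.Dict} {key : ℕ → Option (Fin m)} {K : Finset (Fin m)} {σ : State w}
  {e f : Fin m} {x y v : Expr} (h : Represents D S L M d key K)

include h

theorem Represents.holds_joint (hef : e ≠ f) (hx : x.val D σ = e) (hy : y.val D σ = f) :
    (joint 4 x y).Holds D σ ↔ S.Joint e f :=
  h.dict.holds_joint h.fwd rfl hef h.pos hx hy

theorem Represents.holds_joint_rev (hef : e ≠ f) (hx : x.val D σ = e) (hy : y.val D σ = f) :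
    (joint 30 x y).Holds D σ ↔ S.rev.Joint e f :=
  h.dict.holds_joint h.bwd rfl hef h.pos hx hy

theorem Represents.val_sizeExpr (hef : e ≠ f) (hx : x.val D σ = e) (hy : y.val D σ = f) :
    (sizeExpr x y).val D σ = S.reducedCut e f := by
  have hw := h.dict.w_pos
  have hn := h.dict.n_lt h.pos
  have h64 := h.dict.le_L
  have hL := h.dict.L_lt
  have hkn : 0 < S.k * n := Nat.mul_pos h.pos (Nat.pos_of_ne_zero (NeZero.ne n))
  have hone : (one x y).Holds D σ ↔
      S.InMinCut e ∨ S.InMinCut f ∨ S.Joint e f ∨ S.rev.Joint e f := by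
    rw [one, Expr.holds_or hw, Expr.holds_or hw, Expr.holds_or hw,
      h.dict.holds_inc h.fwd hx, h.dict.holds_inc h.fwd hy, h.holds_joint hef hx hy,
      h.holds_joint_rev hef hx hy]
  have htwo := h.dict.holds_two h.fwd rfl hx hy
  unfold sizeExpr reducedCut
  by_cases h2 : ∃ W, S.Closed W ∧ e ∈ S.G.inE W ∧ f ∈ S.G.inE W
  · rw [Expr.val_ite_pos (htwo.2 h2), if_pos h2]
    obtain ⟨W, hW, he, hf⟩ := h2
    have h3 : 1 < (S.G.inE W).card := Finset.one_lt_card.2 ⟨e, he, f, hf, hef⟩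
    rw [card_inE hW.1, hW.2, Finset.card_empty] at h3
    exact Expr.val_sub (h.dict.val_k σ) (Expr.val_lit (h.dict.lt_of_le (by omega))) (by omega)
  · rw [Expr.val_ite_neg (mt htwo.1 h2), if_neg h2]
    by_cases h1 : S.InMinCut e ∨ S.InMinCut f ∨ S.Joint e f ∨ S.rev.Joint e f
    · rw [Expr.val_ite_pos (hone.2 h1), if_pos h1]
      exact Expr.val_sub (h.dict.val_k σ) (Expr.val_lit (h.dict.lt_of_le (by omega))) h.pos
    · rw [Expr.val_ite_neg (mt hone.1 h1), if_neg h1]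
      exact h.dict.val_k σ

theorem Represents.holds_modeExpr (hef : e ≠ f) (hx : x.val D σ = e) (hy : y.val D σ = f) :
    (modeExpr x y).Holds D σ ↔
      (S.Joint e f ∨ S.rev.Joint e f → S.InMinCut e ∨ S.InMinCut f) := by
  have hw := h.dict.w_pos
  rw [modeExpr, Expr.holds_or hw, Expr.holds_or hw, Expr.holds_not hw, Expr.holds_or hw,
    h.dict.holds_inc h.fwd hx, h.dict.holds_inc h.fwd hy, h.holds_joint hef hx hy,
    h.holds_joint_rev hef hx hy]
  tauto

theorem Represents.holds_sinkSide {u : Fin n} (hv : v.val D σ = u)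
    (hx : x.val D σ = e) (hy : y.val D σ = f) :
    (sinkSide v x y).Holds D σ ↔ u ∈ S.cgreatest (S.avoidSet e f) := by
  have hw := h.dict.w_pos
  have hs : (memRow 4 0 v (.lit 0) (.lit 0)).Holds D σ ↔ ¬ S.CSep u S.s := by
    have h0 : S.rowSet 0 u 0 = S.chull u := by
      change S.chull (Fin.ofNat n u) = _
      rw [ofNat_val]
    have hu := u.2
    rw [h.dict.holds_memRow h.fwd rfl (by omega) hv (Expr.val_lit (Nat.two_pow_pos w))
      (Expr.val_lit (Nat.two_pow_pos w)) (by omega) h.pos (Nat.zero_le _)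
      (by rw [h0]; exact card_inE_chull u), h0, S.P.start 0 h.pos]
    rfl
  rw [sinkSide, Expr.holds_and, Expr.holds_and, Expr.holds_not hw, Expr.holds_or hw,
    Expr.holds_or hw, Expr.holds_not hw, Expr.holds_not hw, Expr.holds_and, Expr.holds_or hw,
    Expr.holds_not hw, h.dict.holds_inc h.fwd hx, h.dict.holds_inc h.fwd hy,
    h.dict.holds_two h.fwd rfl hx hy, hs]
  have he : S.InMinCut e → ((avoids 4 v x).Holds D σ ↔ S.CSep u (S.G.tail e)) := fun hi =>
    h.dict.holds_avoids h.fwd rfl hx hi.isFlowEdge hv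
  have hf : S.InMinCut f → ((avoids 4 v y).Holds D σ ↔ S.CSep u (S.G.tail f)) := fun hi =>
    h.dict.holds_avoids h.fwd rfl hy hi.isFlowEdge hv
  have hU : (∀ a ∈ S.avoidSet e f, S.CSep u a) ↔ (S.InMinCut e → S.CSep u (S.G.tail e)) ∧
      (S.InMinCut f ∧ (S.InMinCut e → ∃ W, S.Closed W ∧ e ∈ S.G.inE W ∧ f ∈ S.G.inE W) →
        S.CSep u (S.G.tail f)) := by
    constructor
    · exact fun hall => ⟨fun hi => hall _ (Or.inl ⟨hi, rfl⟩),
        fun hi => hall _ (Or.inr ⟨hi.1, hi.2, rfl⟩)⟩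
    · rintro ⟨h1, h2⟩ a (⟨hi, rfl⟩ | ⟨hi, hj, rfl⟩)
      · exact h1 hi
      · exact h2 ⟨hi, hj⟩
  have hmem : u ∈ S.cgreatest (S.avoidSet e f) ↔ S.CSep u S.s ∧
      ∀ a ∈ S.avoidSet e f, S.CSep u a := Iff.rfl
  rw [hmem, hU]
  have key : ∀ P Q T C A B A' B' : Prop, (P → (A ↔ A')) → (Q → (B ↔ B')) →
      (¬¬C ∧ (¬P ∨ A) ∧ (¬(Q ∧ (¬P ∨ T)) ∨ B) ↔ C ∧ (P → A') ∧ (Q ∧ (P → T) → B')) := by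
    intro P Q T C A B A' B' h1 h2
    by_cases hP : P <;> by_cases hQ : Q <;> by_cases hT : T <;> simp_all
  exact key _ _ _ _ _ _ _ _ he hf

end

/-! ## The query for the partition -/

/-- `1` or `0`, according to whether the truth value of `a` is `g`. -/
def sign (g : Bool) (a : Expr) : Expr := if g then a.bool else a.not.bool

/-- Is `v` in the cell of the edge `x`? The answers for the vertices before `v` are expected in
the work memory from the address `z` on. -/
def bit (b : ℕ) (z v x : Expr) : Expr :=
  (vtab b 3 v).and
    (((fld b 0 x).and (memRow b 2 v (fld b 2 x) (fld b 3 x))).not.and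
      ((Expr.op .eq (vtab b 3 v) (fld b 8 x)).or (.load (.op .add z (vtab b 2 v)))))

/-- Is `v` in the set `FlowGraph.align` for the intersection of two cells? -/
def inAlign (b : ℕ) (z₁ z₂ v x : Expr) : Expr :=
  .ite (.op .eq (vtab b 0 v) (vtab b 0 (fld b 4 x)))
    ((Expr.load (.op .add z₁ v)).and (.load (.op .add z₂ v)))
    (.op .lt (vtab b 1 v) (vtab b 1 (fld b 4 x)))

/-- The address `n`. -/
def base₁ : Expr := .hdr 2

/-- The address `2 * n`. -/
def base₂ : Expr := .op .add (.hdr 2) (.hdr 2)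

/-- The step for the vertex with number `var 2` in the order of the depths. -/
def sideBody (b : ℕ) (g : Bool) : Prog :=
  .seq (put (.op .add base₁ (vtab b 4 (.var 2))) (bit b base₁ (vtab b 4 (.var 2)) (.var 0)))
    (.seq (put (.op .add base₂ (vtab b 4 (.var 2))) (bit b base₂ (vtab b 4 (.var 2)) (.var 1)))
      (put (vtab b 4 (.var 2))
        (sign g (inAlign b base₁ base₂ (vtab b 4 (.var 2)) (.var 0)))))

/-- A time bound for `sideBody`. -/
def sideCost (b : ℕ) (g : Bool) : ℕ :=
  (Expr.op .add base₁ (vtab b 4 (.var 2))).cost +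
    ((bit b base₁ (vtab b 4 (.var 2)) (.var 0)).cost + 1) +
  ((Expr.op .add base₂ (vtab b 4 (.var 2))).cost +
    ((bit b base₂ (vtab b 4 (.var 2)) (.var 1)).cost + 1)) +
  ((vtab b 4 (.var 2)).cost +
    ((sign g (inAlign b base₁ base₂ (vtab b 4 (.var 2)) (.var 0))).cost + 1))

theorem eval_sign {w : ℕ} {D : List (BitVec w)} {σ : State w} (hw : 0 < w) {g : Bool}
    {a : Expr} {p : Prop} (h : a.Holds D σ ↔ p) :
    ((p ↔ g = true) → (sign g a).eval D σ = 1) ∧ (¬ (p ↔ g = true) → (sign g a).eval D σ = 0) := by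
  have hn := (Expr.holds_not (D := D) (σ := σ) hw (a := a)).trans (not_congr h)
  cases g with
  | true =>
    simp only [iff_true]
    exact ⟨fun hp => Expr.eval_bool_pos (h.2 hp), fun hp => Expr.eval_bool_neg (mt h.1 hp)⟩
  | false =>
    simp only [Bool.false_eq_true, iff_false, not_not]
    exact ⟨fun hp => Expr.eval_bool_pos (hn.2 hp),
      fun hp => Expr.eval_bool_neg (fun h' => hn.1 h' hp)⟩

theorem update_ofNat {w a c : ℕ} (ha : a < 2 ^ w) (hc : c < 2 ^ w) (μ : BitVec w → BitVec w)
    (z : BitVec w) : Function.update μ (BitVec.ofNat w c) z (BitVec.ofNat w a) =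
      if a = c then z else μ (BitVec.ofNat w a) := by
  have : BitVec.ofNat w a = BitVec.ofNat w c ↔ a = c := by
    rw [← BitVec.toNat_inj, BitVec.toNat_ofNat, BitVec.toNat_ofNat, Nat.mod_eq_of_lt ha,
      Nat.mod_eq_of_lt hc]
  split_ifs with h
  · rw [h, Function.update_self]
  · exact Function.update_of_ne (mt this.1 h) _ _

section

variable {w n m k L M : ℕ} [NeZero n] {D : List (BitVec w)} {S : FlowGraph (Fin n) (Fin m)}
  {d : PerfectHash.Dict} {key : ℕ → Option (Fin m)} {K : Finset (Fin m)} {σ : State w}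
  {e f : Fin m} {x y v : Expr} {b : ℕ} (hD : HasDict n m k L M D d key K)
  (hT : HasTable L D key K S b) (hk : S.k = k) (hpos : 0 < k)

omit [NeZero n] in
-- Within a class the sorting key is the depth relative to one representative, so a vertex comes
-- after the parent that its recursion refers to.
theorem _root_.FlowGraph.symm_order_lt {x y : Fin n}
    (h : S.depth (S.rep y) y < S.depth (S.rep x) x) : S.order.symm y < S.order.symm x := by
  by_contra hlt
  have := Tuple.monotone_sort (fun x => S.depth (S.rep x) x) (not_lt.1 hlt)
  simp only [Function.comp] at this
  change S.depth (S.rep (S.order (S.order.symm x))) (S.order (S.order.symm x)) ≤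
    S.depth (S.rep (S.order (S.order.symm y))) (S.order (S.order.symm y)) at this
  rw [Equiv.apply_symm_apply, Equiv.apply_symm_apply] at this
  omega

include hD hT hk hpos

theorem HasDict.holds_bit {z : Expr} {β : ℕ} {u : Fin n} (hv : v.val D σ = u)
    (hx : x.val D σ = e) (hz : z.val D σ = β) (hβ : β ≤ 2 * n) (he : e ∈ K)
    (hc : S.Cls u (S.rep (S.G.head e)))
    (hs : S.Sep (S.rep (S.G.head e)) {S.G.head e} (S.G.tail e))
    (hmem : ∀ y, S.Cls y (S.rep (S.G.head e)) →
      S.depth (S.rep (S.G.head e)) y < S.depth (S.rep (S.G.head e)) u →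
      (σ.mem (BitVec.ofNat w (β + y)) ≠ 0 ↔ y ∈ S.cell (S.rep (S.G.head e)) e)) :
    (bit b z v x).Holds D σ ↔ u ∈ S.cell (S.rep (S.G.head e)) e := by
  have hw := hD.w_pos
  have hn := hD.n_lt hpos
  have hL := hD.L_lt
  have hru := cls_rep_iff.1 hc
  obtain ⟨g', hg'⟩ := (Tight.cell (cls_rep (S.G.head e)) hs).1.exists_gate
  rw [mem_cell_iff_gate (cls_rep _) hc hs hg']
  have hval : (vtab b 3 v).val D σ = S.gateNum (S.hull (S.rep u) {u}) :=
    hD.val_vtab hT hpos hv (a := 3) (by omega)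
  rw [hru] at hval
  rw [bit, Expr.holds_and, Expr.holds_iff_val, hval]
  by_cases hg : ∃ g, S.H.inE (S.hull (S.rep (S.G.head e)) {u}) = {g}
  · obtain ⟨g, hg⟩ := hg
    have hpar : (vtab b 2 v).val D σ = S.H.tail g :=
      (hD.val_vtab hT hpos hv (a := 2) (by omega)).trans
        (congrArg Fin.val (parent_of (by rw [hru]; exact hg)))
    have hgate : (fld b 8 x).val D σ = g' + 1 :=
      (hD.val_fld hT hx he (a := 8) (by omega)).trans (gateNum_of hg')
    have hlt := (S.H.tail g).2
    have haddr := Expr.eval_eq_of_val (Expr.val_add hz hpar (hD.lt_of_le (by omega)))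
    -- The tail of the gate has smaller depth, so its bit is already in memory.
    have hload : (Expr.load (.op .add z (vtab b 2 v))).Holds D σ ↔
        S.H.tail g ∈ S.cell (S.rep (S.G.head e)) e := by
      have := depth_lt hc hg
      rw [← hmem _ this.1 this.2, ← haddr]
      rfl
    have hrow : (fld b 0 x).Holds D σ ∧ (memRow b 2 v (fld b 2 x) (fld b 3 x)).Holds D σ ↔
        S.IsFlowEdge e ∧ S.G.tail e ∈ S.hull (S.rep (S.G.head e)) {u} := by
      rw [hD.holds_fld_zero hT hx he]
      refine and_congr_right fun hf => ?_
      have h2 : S.rowSet 2 u (S.place e).1 = S.hull (S.rep u) {u} := by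
        change S.hull (S.rep (Fin.ofNat n u)) {Fin.ofNat n u} = _
        rw [ofNat_val]
      have := u.2
      rw [hD.holds_memRow_tail hT hk (by omega) hx hf hv (by omega)
        (by rw [h2]; exact card_inE_hull rfl (cls_rep _)), h2, hru]
    have hgg : (g : ℕ) + 1 = g' + 1 ↔ g = g' := by
      rw [Nat.add_right_cancel_iff, Fin.val_inj]
    rw [gateNum_of hg] at hval ⊢
    rw [Expr.holds_and, Expr.holds_not hw, Expr.holds_and, hrow, Expr.holds_or hw,
      Expr.holds_eq hw, hval, hgate, hload, hgg]
    constructor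
    · rintro ⟨_, h1, h2⟩
      exact ⟨g, hg, fun hf ht => h1 ⟨hf, ht⟩, h2⟩
    · rintro ⟨g₁, hg₁, h1, h2⟩
      obtain rfl := Finset.singleton_inj.1 (hg.symm.trans hg₁)
      exact ⟨Nat.succ_ne_zero _, fun h => h1 h.1 h.2, h2⟩
  · constructor
    · rintro ⟨h, _⟩
      exact absurd (gateNum_ne_zero h) hg
    · rintro ⟨g, h, _⟩
      exact absurd ⟨g, h⟩ hg

omit hk in
theorem HasDict.holds_inAlign {z₁ z₂ : Expr} {u : Fin n} (hv : v.val D σ = u)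
    (hx : x.val D σ = e) (hz₁ : z₁.val D σ = n) (hz₂ : z₂.val D σ = n + n) (he : e ∈ K)
    {A B : Set (Fin n)} (hA : S.Cls u (S.rep (S.G.head e)) →
      (σ.mem (BitVec.ofNat w (n + u)) ≠ 0 ↔ u ∈ A) ∧
      (σ.mem (BitVec.ofNat w (n + n + u)) ≠ 0 ↔ u ∈ B)) :
    (inAlign b z₁ z₂ v x).Holds D σ ↔ u ∈ S.align (S.rep (S.G.head e)) (A ∩ B) := by
  have hw := hD.w_pos
  have hn := hD.n_lt hpos
  have hL := hD.L_lt
  have hu := u.2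
  have h4 : (fld b 4 x).val D σ = S.G.head e := hD.val_fld hT hx he (a := 4) (by omega)
  have h1 : (vtab b 0 v).val D σ = S.rep u := hD.val_vtab hT hpos hv (a := 0) (by omega)
  have h2 : (vtab b 0 (fld b 4 x)).val D σ = S.rep (S.G.head e) :=
    hD.val_vtab hT hpos h4 (a := 0) (by omega)
  have h5 : (vtab b 1 v).val D σ = S.level u := hD.val_vtab hT hpos hv (a := 1) (by omega)
  have h6 : (vtab b 1 (fld b 4 x)).val D σ = S.level (S.G.head e) :=
    hD.val_vtab hT hpos h4 (a := 1) (by omega)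
  rw [inAlign, Expr.holds_ite, Expr.holds_eq hw, h1, h2, Fin.val_inj, ← cls_rep_iff,
    Expr.holds_lt hw, h5, h6, Expr.holds_and]
  by_cases hc : S.Cls u (S.rep (S.G.head e))
  · obtain ⟨a1, a2⟩ := hA hc
    have e1 := Expr.eval_eq_of_val (Expr.val_add hz₁ hv (hD.lt_of_le (by omega)))
    have e2 := Expr.eval_eq_of_val (Expr.val_add hz₂ hv (hD.lt_of_le (by omega)))
    rw [← e1] at a1
    rw [← e2] at a2
    rw [mem_align_of_cls hc]
    simp only [hc, true_and, not_true, false_and, or_false]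
    exact and_congr a1 a2
  · rw [mem_align_of_not hc, level_rep]
    simp [hc]

/-- One pass over the vertices by increasing depth. The cell bits of `e` and `f` are kept at the
addresses from `n` and `2 * n` on, and the answer at the addresses below `n`; the three blocks do
not interfere. -/
theorem HasDict.exec_sideLoop (hef : e ≠ f) (hJ : S.Joint e f) (g : Bool)
    (hx : σ.reg 0 = BitVec.ofNat w e) (hy : σ.reg 1 = BitVec.ofNat w f) :
    ∃ j τ, j ≤ (sideCost b g + (Expr.hdr 2).cost + 20) * n ∧
      Exec D (forLoop (.hdr 2) (sideBody b g)) σ j τ ∧ ∀ u : Fin n,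
        ((u ∈ S.align (S.rep (S.G.head e)) (S.cell (S.rep (S.G.head e)) e ∩
            S.cell (S.rep (S.G.head e)) f) ↔ g = true) → τ.mem (BitVec.ofNat w u) = 1) ∧
        (¬ (u ∈ S.align (S.rep (S.G.head e)) (S.cell (S.rep (S.G.head e)) e ∩
            S.cell (S.rep (S.G.head e)) f) ↔ g = true) → τ.mem (BitVec.ofNat w u) = 0) := by
  have hw := hD.w_pos
  have hn := hD.n_lt hpos
  have hL := hD.L_lt
  have hMw : M < 2 ^ w := hD.lt_of_le (by omega)
  have hmM := hD.m_lt
  have hn0 : 0 < n := Nat.pos_of_ne_zero (NeZero.ne n)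
  obtain ⟨hr, hcom⟩ := hJ
  have hclsf : S.Cls (S.G.head f) (S.rep (S.G.head e)) := hr ▸ cls_rep _
  obtain ⟨ht1, ht2⟩ := (common_iff_headTest hef (cls_rep _) hclsf).1 hcom
  have heK := hT.mem_of_headTest ht1
  have hfK : f ∈ K := by
    rw [← hr] at ht2
    exact hT.mem_of_headTest ht2
  obtain ⟨W, hW, w1, w2, w3, w4⟩ := hcom
  have hse : S.Sep (S.rep (S.G.head e)) {S.G.head e} (S.G.tail e) :=
    sep_singleton.2 ⟨W, hW, w1, w2⟩
  have hsf : S.Sep (S.rep (S.G.head f)) {S.G.head f} (S.G.tail f) := by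
    rw [hr]
    exact sep_singleton.2 ⟨W, hW, w3, w4⟩
  set ρ := S.rep (S.G.head e) with hρ
  set Z := S.align ρ (S.cell ρ e ∩ S.cell ρ f)
  -- Cell bits are guaranteed only within the class of `ρ`; stale contents elsewhere are never used,
  -- because `align` decides by level there.
  let Q : (BitVec w → BitVec w) → Fin n → Prop := fun μ u =>
    (S.Cls u ρ → (μ (BitVec.ofNat w (n + u)) ≠ 0 ↔ u ∈ S.cell ρ e) ∧
      (μ (BitVec.ofNat w (n + n + u)) ≠ 0 ↔ u ∈ S.cell ρ f)) ∧
    ((u ∈ Z ↔ g = true) → μ (BitVec.ofNat w u) = 1) ∧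
    (¬ (u ∈ Z ↔ g = true) → μ (BitVec.ofNat w u) = 0)
  obtain ⟨j, τ, c, hex, hI⟩ := exec_forLoop D hw (n := .hdr 2) (body := sideBody b g) (N := n)
    (c := sideCost b g) hn0 (by omega) hD.val_n (x := BitVec.ofNat w e) (y := BitVec.ofNat w f)
    (fun k μ => ∀ u, (S.order.symm u : ℕ) < k → Q μ u) (by
      intro k hkn σ hx hy h2 hI
      set u : Fin n := S.order ⟨k, hkn⟩ with hu
      have hsymm : S.order.symm u = ⟨k, hkn⟩ := by rw [hu, Equiv.symm_apply_apply]
      have hu' := u.2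
      have he' := e.2
      have hf' := f.2
      have v0 : ∀ τ : State w, τ.reg 0 = σ.reg 0 → (Expr.var 0).val D τ = e := by
        intro τ h
        change (τ.reg 0).toNat = e
        rw [h, hx, BitVec.toNat_ofNat, Nat.mod_eq_of_lt (by omega)]
      have v1 : ∀ τ : State w, τ.reg 1 = σ.reg 1 → (Expr.var 1).val D τ = f := by
        intro τ h
        change (τ.reg 1).toNat = f
        rw [h, hy, BitVec.toNat_ofNat, Nat.mod_eq_of_lt (by omega)]
      have vv : ∀ τ : State w, τ.reg 2 = σ.reg 2 → (vtab b 4 (.var 2)).val D τ = u := by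
        intro τ h
        refine hD.val_vtab hT hpos (v := ⟨k, hkn⟩) (a := 4) ?_ (by omega)
        change (τ.reg 2).toNat = k
        rw [h, h2, BitVec.toNat_ofNat, Nat.mod_eq_of_lt (by omega)]
      have b1 : ∀ τ : State w, base₁.val D τ = n := hD.val_n
      have b2 : ∀ τ : State w, base₂.val D τ = n + n := fun τ =>
        Expr.val_add (hD.val_n τ) (hD.val_n τ) (by omega)
      have hprev : ∀ y, S.Cls y ρ → S.depth ρ y < S.depth ρ u → S.Cls u ρ → Q σ.mem y := by
        intro y hy hd hcu
        refine hI y ?_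
        have := symm_order_lt (S := S) (x := u) (y := y)
          (by rw [cls_rep_iff.1 hcu, cls_rep_iff.1 hy]; exact hd)
        rw [hsymm] at this
        exact this
      obtain ⟨k1, τ1, c1, x1, r1, m1⟩ := exec_put D (.op .add base₁ (vtab b 4 (.var 2)))
        (bit b base₁ (vtab b 4 (.var 2)) (.var 0)) σ
      obtain ⟨k2, τ2, c2, x2, r2, m2⟩ := exec_put D (.op .add base₂ (vtab b 4 (.var 2)))
        (bit b base₂ (vtab b 4 (.var 2)) (.var 1)) τ1
      obtain ⟨k3, τ3, c3, x3, r3, m3⟩ := exec_put D (vtab b 4 (.var 2))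
        (sign g (inAlign b base₁ base₂ (vtab b 4 (.var 2)) (.var 0))) τ2
      rw [Expr.eval_eq_of_val (Expr.val_add (b1 σ) (vv σ rfl) (by omega))] at m1
      rw [Expr.eval_eq_of_val (Expr.val_add (b2 τ1) (vv τ1 (r1 2 (by omega))) (by omega))] at m2
      have q2 : ∀ r < 4, τ2.reg r = σ.reg r := fun r hr => (r2 r hr).trans (r1 r hr)
      rw [Expr.eval_eq_of_val (vv τ2 (q2 2 (by omega)))] at m3
      set z1 := (bit b base₁ (vtab b 4 (.var 2)) (.var 0)).eval D σ with hz1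
      set z2 := (bit b base₂ (vtab b 4 (.var 2)) (.var 1)).eval D τ1 with hz2
      set z3 := (sign g (inAlign b base₁ base₂ (vtab b 4 (.var 2)) (.var 0))).eval D τ2 with hz3
      have a1 : ∀ a < 3 * n, τ1.mem (BitVec.ofNat w a) =
          if a = n + u then z1 else σ.mem (BitVec.ofNat w a) := fun a ha => by
        rw [m1, update_ofNat (by omega) (by omega)]
      have a2 : ∀ a < 3 * n, τ2.mem (BitVec.ofNat w a) =
          if a = n + n + u then z2 else τ1.mem (BitVec.ofNat w a) := fun a ha => by
        rw [m2, update_ofNat (by omega) (by omega)]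
      have a3 : ∀ a < 3 * n, τ3.mem (BitVec.ofNat w a) =
          if a = u then z3 else τ2.mem (BitVec.ofNat w a) := fun a ha => by
        rw [m3, update_ofNat (by omega) (by omega)]
      have t1 : S.Cls u ρ → (z1 ≠ 0 ↔ u ∈ S.cell ρ e) := fun hcu =>
        hD.holds_bit hT hk hpos (vv σ rfl) (v0 σ rfl) (b1 σ) (by omega) heK hcu hse
          fun y hy hd => ((hprev y hy hd hcu).1 hy).1
      have t2 : S.Cls u ρ → (z2 ≠ 0 ↔ u ∈ S.cell ρ f) := by
        intro hcu
        have := hD.holds_bit hT hk hpos (vv τ1 (r1 2 (by omega))) (v1 τ1 (r1 1 (by omega)))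
          (b2 τ1) (by omega) hfK (by rw [hr]; exact hcu) hsf (by
            rw [hr]
            intro y hy hd
            have hy' := y.2
            rw [a1 _ (by omega), if_neg (by omega)]
            exact ((hprev y hy hd hcu).1 hy).2)
        rw [hr] at this
        exact this
      have t3 := eval_sign hw (g := g) (hD.holds_inAlign hT hpos (vv τ2 (q2 2 (by omega)))
        (v0 τ2 (q2 0 (by omega))) (b1 τ2) (b2 τ2) heK (A := S.cell ρ e) (B := S.cell ρ f) (by
          intro hcu
          rw [a2 _ (by omega), a2 _ (by omega), if_neg (by omega), if_pos rfl,
            a1 _ (by omega), if_pos rfl]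
          exact ⟨t1 hcu, t2 hcu⟩))
      refine ⟨k1 + (k2 + k3), τ3, by unfold sideCost; omega, .seq x1 (.seq x2 x3),
        fun r hr => (r3 r (by omega)).trans (q2 r (by omega)), fun y hy => ?_⟩
      have hy' := y.2
      by_cases hyu : y = u
      · subst hyu
        refine ⟨fun hcu => ?_, ?_⟩
        · rw [a3 _ (by omega), a3 _ (by omega), if_neg (by omega), if_neg (by omega),
            a2 _ (by omega), a2 _ (by omega), if_neg (by omega), if_pos rfl,
            a1 _ (by omega), if_pos rfl]
          exact ⟨t1 hcu, t2 hcu⟩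
        · rw [a3 _ (by omega), if_pos rfl]
          exact t3
      · have hne : (y : ℕ) ≠ u := fun h => hyu (Fin.ext h)
        have hlt : (S.order.symm y : ℕ) < k := by
          have : (S.order.symm y : ℕ) ≠ k := by
            intro h
            apply hyu
            rw [hu, ← Equiv.symm_apply_eq]
            exact Fin.ext h
          omega
        have := hI y hlt
        have e1 : τ3.mem (BitVec.ofNat w (n + y)) = σ.mem (BitVec.ofNat w (n + y)) := by
          rw [a3 _ (by omega), if_neg (by omega), a2 _ (by omega), if_neg (by omega),
            a1 _ (by omega), if_neg (by omega)]
        have e2 : τ3.mem (BitVec.ofNat w (n + n + y)) = σ.mem (BitVec.ofNat w (n + n + y)) := by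
          rw [a3 _ (by omega), if_neg (by omega), a2 _ (by omega), if_neg (by omega),
            a1 _ (by omega), if_neg (by omega)]
        have e3 : τ3.mem (BitVec.ofNat w y) = σ.mem (BitVec.ofNat w y) := by
          rw [a3 _ (by omega), if_neg (by omega), a2 _ (by omega), if_neg (by omega),
            a1 _ (by omega), if_neg (by omega)]
        change (S.Cls y ρ → (τ3.mem (BitVec.ofNat w (n + y)) ≠ 0 ↔ y ∈ S.cell ρ e) ∧
          (τ3.mem (BitVec.ofNat w (n + n + y)) ≠ 0 ↔ y ∈ S.cell ρ f)) ∧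
          ((y ∈ Z ↔ g = true) → τ3.mem (BitVec.ofNat w y) = 1) ∧
          (¬ (y ∈ Z ↔ g = true) → τ3.mem (BitVec.ofNat w y) = 0)
        rw [e1, e2, e3]
        exact this) σ hx hy (fun u hu => absurd hu (Nat.not_lt_zero _))
  exact ⟨j, τ, c, hex, fun u => (hI u (S.order.symm u).2).2⟩

end

end MinCutOracle

/-! ## The oracle -/

open MultiDigraph FlowGraph WordRAM

namespace MinCutOracle

/-- The program that reports the size. -/
def sizeQuery : Prog := assign 0 (sizeExpr (.var 0) (.var 1))

/-- The partition of a cut whose size is the minimum of the original graph. -/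
def closedBody : Prog := put (.var 2) (sign false (sinkSide (.var 2) (.var 0) (.var 1)))

/-- A time bound for `closedBody`. -/
def closedCost : ℕ :=
  (Expr.var 2).cost + ((sign false (sinkSide (.var 2) (.var 0) (.var 1))).cost + 1)

/-- The program that reports the partition. -/
def partitionQuery : Prog :=
  .seq (assign 3 (modeExpr (.var 0) (.var 1)))
    (.cond 3 (forLoop (.hdr 2) closedBody)
      (.seq (assign 3 (joint 4 (.var 0) (.var 1)))
        (.cond 3 (forLoop (.hdr 2) (sideBody 4 false)) (forLoop (.hdr 2) (sideBody 30 true)))))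

/-- A time bound for `partitionQuery`, per vertex. -/
def partitionCost : ℕ :=
  (modeExpr (.var 0) (.var 1)).cost + (joint 4 (.var 0) (.var 1)).cost + 4 +
    (closedCost + (Expr.hdr 2).cost + 20) + (sideCost 4 false + (Expr.hdr 2).cost + 20) +
    (sideCost 30 true + (Expr.hdr 2).cost + 20)

section

variable {w n m L M : ℕ} [NeZero n] {D : List (BitVec w)} {S : FlowGraph (Fin n) (Fin m)}
  {d : PerfectHash.Dict} {key : ℕ → Option (Fin m)} {K : Finset (Fin m)} {σ : State w}
  {e f : Fin m} (h : Represents D S L M d key K)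

include h

theorem Represents.val_var (r : Fin 4) (hr : σ.reg r = BitVec.ofNat w e) :
    (Expr.var r).val D σ = e := by
  change (σ.reg r).toNat = e
  have := h.dict.m_lt
  have := h.dict.lt_of_le (a := M) (by omega)
  have := e.2
  rw [hr, BitVec.toNat_ofNat, Nat.mod_eq_of_lt (by omega)]

theorem Represents.reportsMinCutSize (hst : S.s ≠ S.t) (hcl : ∃ W, S.Closed W) :
    ReportsMinCutSize D sizeQuery ((sizeExpr (.var 0) (.var 1)).cost + 1) S.G S.s S.t := by
  rintro e f hef σ ⟨hx, hy⟩
  obtain ⟨j, τ, c, hex, hv, -⟩ := exec_assign D 0 (sizeExpr (.var 0) (.var 1)) σ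
  refine ⟨j, τ, c, hex, ?_⟩
  rw [hv, minCut_delete hst hef hcl]
  exact h.val_sizeExpr hef (h.val_var 0 hx) (h.val_var 1 hy)

theorem Represents.exec_closedLoop (hx : σ.reg 0 = BitVec.ofNat w e)
    (hy : σ.reg 1 = BitVec.ofNat w f) :
    ∃ j τ, j ≤ (closedCost + (Expr.hdr 2).cost + 20) * n ∧
      Exec D (forLoop (.hdr 2) closedBody) σ j τ ∧ ∀ u : Fin n,
        (u ∉ S.cgreatest (S.avoidSet e f) → τ.mem (BitVec.ofNat w u) = 1) ∧
        (u ∈ S.cgreatest (S.avoidSet e f) → τ.mem (BitVec.ofNat w u) = 0) := by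
  have hw := h.dict.w_pos
  have hn := h.dict.n_lt h.pos
  have hL := h.dict.L_lt
  have hMw : M < 2 ^ w := h.dict.lt_of_le (by omega)
  have hn0 : 0 < n := Nat.pos_of_ne_zero (NeZero.ne n)
  obtain ⟨j, τ, c, hex, hI⟩ := exec_forLoop D hw (n := .hdr 2) (body := closedBody) (N := n)
    (c := closedCost) hn0 (by omega) h.dict.val_n (x := BitVec.ofNat w e)
    (y := BitVec.ofNat w f)
    (fun k μ => ∀ u : Fin n, (u : ℕ) < k →
      (u ∉ S.cgreatest (S.avoidSet e f) → μ (BitVec.ofNat w u) = 1) ∧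
      (u ∈ S.cgreatest (S.avoidSet e f) → μ (BitVec.ofNat w u) = 0)) (by
      intro k hkn σ hx hy h2 hI
      obtain ⟨k1, τ1, c1, x1, r1, m1⟩ := exec_put D (.var 2)
        (sign false (sinkSide (.var 2) (.var 0) (.var 1))) σ
      refine ⟨k1, τ1, c1, x1, fun r hr => r1 r (by omega), fun u hu => ?_⟩
      have hu' := u.2
      rw [m1, show (Expr.var 2).eval D σ = BitVec.ofNat w k from h2,
        update_ofNat (by omega) (by omega)]
      split_ifs with huk
      · have hv : (Expr.var 2).val D σ = u := by
          change (σ.reg 2).toNat = u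
          rw [h2, BitVec.toNat_ofNat, Nat.mod_eq_of_lt (by omega), huk]
        have := eval_sign hw (g := false)
          (h.holds_sinkSide hv (h.val_var 0 hx) (h.val_var 1 hy))
        simpa only [Bool.false_eq_true, iff_false, not_not] using this
      · exact hI u (by omega)) σ hx hy (fun u hu => absurd hu (Nat.not_lt_zero _))
  exact ⟨j, τ, c, hex, fun u => hI u u.2⟩

theorem Represents.reportsMinCutPartition (hst : S.s ≠ S.t) (hcl : ∃ W, S.Closed W) :
    ReportsMinCutPartition D partitionQuery (partitionCost * n) S.G S.s S.t := by
  rintro e f hef σ ⟨hx, hy⟩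
  have hn0 : 0 < n := Nat.pos_of_ne_zero (NeZero.ne n)
  obtain ⟨j1, τ1, c1, x1, v1, r1, -⟩ := exec_assign D 3 (modeExpr (.var 0) (.var 1)) σ
  have hmode := h.holds_modeExpr hef (h.val_var 0 hx) (h.val_var 1 hy)
  rw [Expr.Holds, ← v1] at hmode
  have hx1 : τ1.reg 0 = BitVec.ofNat w e := (r1 0 (by omega) (by omega)).trans hx
  have hy1 : τ1.reg 1 = BitVec.ofNat w f := (r1 1 (by omega) (by omega)).trans hy
  have hT : partitionCost * n = (modeExpr (.var 0) (.var 1)).cost * n +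
      (joint 4 (.var 0) (.var 1)).cost * n + 4 * n +
      (closedCost + (Expr.hdr 2).cost + 20) * n + (sideCost 4 false + (Expr.hdr 2).cost + 20) * n +
      (sideCost 30 true + (Expr.hdr 2).cost + 20) * n := by
    unfold partitionCost
    ring
  have hT1 := Nat.le_mul_of_pos_right (modeExpr (.var 0) (.var 1)).cost hn0
  have hT2 := Nat.le_mul_of_pos_right (joint 4 (.var 0) (.var 1)).cost hn0
  by_cases h3 : τ1.reg 3 = 0
  · obtain ⟨hJ, hi⟩ : (S.Joint e f ∨ S.rev.Joint e f) ∧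
        ¬ (S.InMinCut e ∨ S.InMinCut f) := by
      have := mt hmode.2 (not_not.2 h3)
      tauto
    obtain ⟨hie, hif⟩ := not_or.1 hi
    -- Neither edge lies in a minimum cut, so a common cut of size `k + 1` gives the optimal drop by
    -- one.
    have h2 : ¬ ∃ W, S.Closed W ∧ e ∈ S.G.inE W ∧ f ∈ S.G.inE W := by
      rw [exists_closed_pair_iff]
      exact fun h => hie h.1
    obtain ⟨j2, τ2, c2, x2, v2, r2, -⟩ := exec_assign D 3 (joint 4 (.var 0) (.var 1)) τ1
    have hjoint := h.holds_joint hef (h.val_var 0 hx1) (h.val_var 1 hy1)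
    rw [Expr.Holds, ← v2] at hjoint
    have hx2 : τ2.reg 0 = BitVec.ofNat w e := (r2 0 (by omega) (by omega)).trans hx1
    have hy2 : τ2.reg 1 = BitVec.ofNat w f := (r2 1 (by omega) (by omega)).trans hy1
    by_cases hj : S.Joint e f
    · obtain ⟨j3, τ3, c3, x3, hm⟩ := h.dict.exec_sideLoop h.fwd rfl h.pos hef hj false hx2 hy2
      have hclsf : S.Cls (S.G.head f) (S.rep (S.G.head e)) := hj.1 ▸ cls_rep _
      obtain ⟨a1, a2, a3, a4⟩ := hj.2.align (cls_rep _) hclsf hie hif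
      refine ⟨j1 + (j2 + (j3 + 1) + 1), τ3, _, ?_,
        .seq x1 (.cond_false h3 (.seq x2 (.cond_true (hjoint.2 hj) x3))),
        (optimal_of_card_le_one hef a1 a2 a3 a4 h2).isMinCutPartition hst hef hcl,
        fun u => ⟨fun hu => (hm u).1 ?_, fun hu => (hm u).2 ?_⟩⟩
      · omega
      · simp only [Bool.false_eq_true, iff_false]
        exact hu
      · simp only [Bool.false_eq_true, iff_false]
        exact hu
    · have hj' := hJ.resolve_left hj
      obtain ⟨j3, τ3, c3, x3, hm⟩ :=
        h.dict.exec_sideLoop h.bwd rfl h.pos hef hj' true hx2 hy2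
      have hclsf : S.rev.Cls (S.rev.G.head f) (S.rev.rep (S.rev.G.head e)) :=
        hj'.1 ▸ cls_rep _
      obtain ⟨a1, a2, a3, a4⟩ := hj'.2.align (cls_rep _) hclsf (mt inMinCut_rev.1 hie)
        (mt inMinCut_rev.1 hif)
      -- A sink side of the reversed graph is a source side of the original one, so the membership
      -- bits are reported without negation.
      set Z := S.rev.align (S.rev.rep (S.rev.G.head e))
        (S.rev.cell (S.rev.rep (S.rev.G.head e)) e ∩ S.rev.cell (S.rev.rep (S.rev.G.head e)) f)
      have hH : S.H.inE Zᶜ = S.rev.H.inE Z := by rw [← rev_inE_compl, compl_compl]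
      have hG : S.G.inE Zᶜ = S.rev.G.inE Z := by
        rw [← inE_reverse_compl, compl_compl]
        rfl
      rw [← hH] at a2
      rw [← hG] at a3 a4
      have hopt := (optimal_of_card_le_one hef (Valid.compl a1) a2 a3 a4 h2).isMinCutPartition
        hst hef hcl
      rw [compl_compl] at hopt
      refine ⟨j1 + (j2 + (j3 + 1) + 1), τ3, Z, ?_,
        .seq x1 (.cond_false h3 (.seq x2 (.cond_false (not_not.1 (mt hjoint.1 hj)) x3))),
        hopt, fun u => ⟨fun hu => (hm u).1 ?_, fun hu => (hm u).2 ?_⟩⟩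
      · omega
      · simpa only [iff_true] using hu
      · simpa only [iff_true] using hu
  · obtain ⟨j2, τ2, c2, x2, hm⟩ := h.exec_closedLoop hx1 hy1
    refine ⟨j1 + (j2 + 1), τ2, _, ?_, .seq x1 (.cond_true h3 x2),
      (optimal_cgreatest hef hcl (hmode.1 h3)).isMinCutPartition hst hef hcl,
      fun u => ⟨fun hu => (hm u).1 hu, fun hu => (hm u).2 (not_not.1 hu)⟩⟩
    omega

end

/-- The stored arrays. -/
noncomputable def tables {n m : ℕ} [NeZero n] (S : FlowGraph (Fin n) (Fin m))
    (d : PerfectHash.Dict) (key : ℕ → Option (Fin m)) (a i : ℕ) : ℕ :=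
  if a = 0 then d.mult i
  else if a = 1 then if i < d.B then d.size i else 0
  else if a = 2 then if i < d.B then d.off i else 0
  else if a = 3 then (key i).elim 0 fun e => (e : ℕ) + 1
  else if a < 30 then S.table key (a - 4) i
  else S.rev.table key (a - 30) i

/-- The header of the stored array. -/
def header (n k L : ℕ) (d : PerfectHash.Dict) (i : ℕ) : ℕ :=
  match i with
  | 0 => L
  | 1 => k
  | 2 => n
  | 3 => d.P
  | 4 => d.B
  | 5 => d.a
  | _ => 0

theorem exists_represents {w n m M : ℕ} [NeZero n] (S : FlowGraph (Fin n) (Fin m))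
    (hpos : 0 < S.k) (hfit : M * M + M < 2 ^ w) (hL : 8 + 56 * (64 * (S.k * n)) < M)
    (hnm : 2 * n + m + S.k < M) (hP : 2 * (m + 4 * (3 * (S.k * n)) ^ 2 + 1) ≤ M) :
    ∃ (D : List (BitVec w)) (L : ℕ) (d : PerfectHash.Dict) (key : ℕ → Option (Fin m))
      (K : Finset (Fin m)), D.length = 8 + 56 * (64 * (S.k * n)) ∧
        Represents D S L M d key K := by
  classical
  have hn0 : 0 < n := Nat.pos_of_ne_zero (NeZero.ne n)
  have hkn : 0 < S.k * n := Nat.mul_pos hpos hn0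
  -- By Bertrand's postulate, a prime above all edge numbers and above `4 * B ^ 2` with `B = 3 * (k
  -- * n)`, yet polynomial in the input size.
  obtain ⟨P, hPp, hP1, hP2⟩ :=
    Nat.exists_prime_lt_and_le_two_mul (m + 4 * (3 * (S.k * n)) ^ 2 + 1) (by omega)
  obtain ⟨d, rfl, hB, ha, hmult, hsize, hoff, hinj⟩ := PerfectHash.exists_dict
    (S.keys.map Fin.valEmbedding) (B := 3 * (S.k * n)) (by omega)
    (by rw [Finset.card_map]; exact card_keys_le hpos) hPp
    (by
      intro x hx
      obtain ⟨e, -, rfl⟩ := Finset.mem_map.1 hx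
      have := e.2
      change (e : ℕ) < P
      omega) (by omega)
  have hB0 : 0 < d.B := by omega
  have hoff' : ∀ b < d.B, d.off b + d.size b ≤ 17 * d.B := by rw [hB]; exact hoff
  set key : ℕ → Option (Fin m) := fun i =>
    if h : ∃ e ∈ S.keys, d.slot e = i then some h.choose else none with hkey
  have hmem : ∀ e, e ∈ S.keys ↔ key (d.slot e) = some e := by
    intro e
    rw [hkey]
    constructor
    · intro he
      have h : ∃ e' ∈ S.keys, d.slot e' = d.slot e := ⟨e, he, rfl⟩
      simp only [dif_pos h, Option.some_inj]
      obtain ⟨h1, h2⟩ := h.choose_spec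
      exact Fin.ext (hinj (Finset.mem_coe.2 (Finset.mem_map_of_mem Fin.valEmbedding h1))
        (Finset.mem_coe.2 (Finset.mem_map_of_mem Fin.valEmbedding he)) h2)
    · intro h
      by_cases h' : ∃ e' ∈ S.keys, d.slot e' = d.slot e
      · simp only [dif_pos h', Option.some_inj] at h
        exact h ▸ h'.choose_spec.1
      · simp only [dif_neg h'] at h
        exact absurd h (by simp)
  set L := 64 * (S.k * n) with hLdef
  have hMw : M < 2 ^ w := by omega
  -- Bucket sizes and offsets are bounded only for buckets below `d.B`; the tables hold zero beyond.
  have htab : ∀ a i, tables S d key a i < 2 ^ w := by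
    intro a i
    unfold tables
    split_ifs with _ _ hi _ hi
    · have := hmult i
      omega
    · have := hoff' i hi
      omega
    · omega
    · have := hoff' i hi
      omega
    · omega
    · cases key i with
      | none => simp only [Option.elim_none]; omega
      | some e => simp only [Option.elim_some]; omega
    · have := table_le hpos key (a - 4) i
      omega
    · have := table_le (S := S.rev) hpos key (a - 30) i
      have h2 : S.rev.k = S.k := rfl
      omega
  have hhdr : ∀ i, header n S.k L d i < 2 ^ w := by
    intro i
    unfold header
    split <;> omega
  have hval : ∀ (σ : State w) (a : ℕ) (e : Expr) (i : ℕ), a < 56 → i < L →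
      e.val (layout w 56 L (header n S.k L d) (tables S d key)) σ = i →
      (Expr.arr a e).val (layout w 56 L (header n S.k L d) (tables S d key)) σ =
        tables S d key a i := fun σ a e i ha hi he =>
    Expr.val_arr rfl (by omega) ha he hi (htab a i)
  have hhval : ∀ (σ : State w) (i : ℕ), i < 8 →
      (Expr.hdr i).val (layout w 56 L (header n S.k L d) (tables S d key)) σ =
        header n S.k L d i := fun σ i hi =>
    Expr.val_hdr hi (by omega) (hhdr i)
  refine ⟨layout w 56 L (header n S.k L d) (tables S d key), L, d, key, S.keys,
    length_layout, ⟨?_, ?_, ?_, hpos⟩⟩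
  · refine
      { fit := hfit
        le_L := le_rfl
        L_lt := by omega
        m_lt := by omega
        P_le := by omega
        a_lt := ha
        mult_lt := hmult
        B_pos := hB0
        -- `17 * B` is `51 * (k * n)`, below the array length `64 * (k * n)`.
        slot_lt := fun x => (PerfectHash.Dict.slot_lt hB0 hsize hoff' x).trans_le (by omega)
        mem_iff := hmem
        val_k := fun σ => hhval σ 1 (by omega)
        val_n := fun σ => hhval σ 2 (by omega)
        val_P := fun σ => hhval σ 3 (by omega)
        val_B := fun σ => hhval σ 4 (by omega)
        val_a := fun σ => hhval σ 5 (by omega)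
        val_mult := ?_
        val_size := ?_
        val_off := ?_
        val_key := ?_ }
    · intro σ e i hi he
      exact hval σ 0 e i (by omega) (by omega) he
    · intro σ e i hi he
      exact (hval σ 1 e i (by omega) (by omega) he).trans (if_pos hi)
    · intro σ e i hi he
      exact (hval σ 2 e i (by omega) (by omega) he).trans (if_pos hi)
    · intro σ e i hi he
      exact hval σ 3 e i (by omega) (by omega) he
  · refine ⟨fun σ a e i ha hi he => ?_, fun e he => mem_keys_of_isFlowEdge he,
      fun e he => mem_keys_of_hasRow he⟩
    rw [hval σ (4 + a) e i (by omega) hi he]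
    unfold tables
    rw [if_neg (by omega), if_neg (by omega), if_neg (by omega), if_neg (by omega),
      if_pos (by omega), Nat.add_sub_cancel_left]
  · refine ⟨fun σ a e i ha hi he => ?_,
      fun e he => mem_keys_of_isFlowEdge (isFlowEdge_rev.1 he), fun e he => ?_⟩
    · rw [hval σ (30 + a) e i (by omega) hi he]
      unfold tables
      rw [if_neg (by omega), if_neg (by omega), if_neg (by omega), if_neg (by omega),
        if_neg (by omega), Nat.add_sub_cancel_left]
    · simp only [keys, Finset.mem_filter, Finset.mem_univ, true_and]
      exact Or.inr (Or.inr he)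

end MinCutOracle

/-- There are one constant `C` and two fixed programs such that, for every graph with `n` vertices,
`m` edges and an `(s,t)`-min-cut of positive size, on words of `w = Ω(log (n + m))` bits. -/
theorem theorem3 :
    ∃ (C : ℕ) (sizeQuery partitionQuery : WordRAM.Prog),
      ∀ (n m : ℕ) (G : MultiDigraph (Fin n) (Fin m)) (s t : Fin n),
        s ≠ t → 0 < G.minCut s t →
        ∀ w : ℕ, C * Nat.clog 2 (n + m) ≤ w →
          ∃ D : List (BitVec w),
            D.length ≤ C * (G.minCut s t * n) ∧
            ReportsMinCutSize D sizeQuery C G s t ∧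
            ReportsMinCutPartition D partitionQuery (C * n) G s t := by
  -- `3592 = 8 + 56 * 64`: the header and 56 arrays of `64 * (k * n)` words, namely 4 for the
  -- dictionary and 26 for each direction.
  refine ⟨3592 + ((MinCutOracle.sizeExpr (.var 0) (.var 1)).cost + 1) +
    MinCutOracle.partitionCost, MinCutOracle.sizeQuery, MinCutOracle.partitionQuery, ?_⟩
  intro n m G s t hst hpos w hw
  obtain ⟨S, rfl, rfl, rfl, hk, hcl⟩ := FlowGraph.exists_flowGraph G hst hpos
  rw [← hk] at hpos ⊢
  have hn2 : 2 ≤ n := by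
    have h1 := S.s.2
    have h2 := S.t.2
    have h3 : (S.s : ℕ) ≠ S.t := fun h => hst (Fin.ext h)
    omega
  have : NeZero n := ⟨by omega⟩
  have hkm : S.k ≤ m := by
    obtain ⟨W, hW⟩ := hcl
    have h1 := Finset.card_le_univ (S.G.inE W)
    rw [FlowGraph.card_inE hW.1, hW.2, Finset.card_empty, Fintype.card_fin] at h1
    omega
  set q := n + m with hq
  set C := 3592 + ((MinCutOracle.sizeExpr (.var 0) (.var 1)).cost + 1) +
    MinCutOracle.partitionCost
  have hq3 : 3 ≤ q := by omega
  have hkn : 0 < S.k * n := Nat.mul_pos hpos (by omega)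
  have hN : S.k * n ≤ q ^ 2 := by
    rw [pow_two]
    exact Nat.mul_le_mul (by omega) (by omega)
  have hq2 : q ≤ q ^ 2 := Nat.le_self_pow (by omega) q
  have hq24 : q ^ 2 * 9 ≤ q ^ 4 := by
    rw [show q ^ 4 = q ^ 2 * q ^ 2 by ring]
    exact Nat.mul_le_mul_left _ (Nat.pow_le_pow_left hq3 2)
  have hq410 : q ^ 4 * 729 ≤ q ^ 10 := by
    rw [show q ^ 10 = q ^ 4 * q ^ 6 by ring]
    exact Nat.mul_le_mul_left _ (Nat.pow_le_pow_left hq3 6)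
  have hN2 : (3 * (S.k * n)) ^ 2 ≤ 9 * q ^ 4 := by
    calc (3 * (S.k * n)) ^ 2 ≤ (3 * q ^ 2) ^ 2 := Nat.pow_le_pow_left (by omega) 2
      _ = 9 * q ^ 4 := by ring
  -- The bound on stored values is `M = q ^ 10`. A product of two of them plus an offset must fit
  -- into a word, for which `21 * log q` bits suffice.
  have hfit : q ^ 10 * q ^ 10 + q ^ 10 < 2 ^ w := by
    have h1 : q ^ 21 ≤ 2 ^ w := by
      calc q ^ 21 ≤ (2 ^ Nat.clog 2 q) ^ 21 :=
            Nat.pow_le_pow_left (Nat.le_pow_clog (by omega) q) 21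
        _ = 2 ^ (21 * Nat.clog 2 q) := by rw [← pow_mul, Nat.mul_comm]
        _ ≤ 2 ^ w := Nat.pow_le_pow_right (by omega)
            ((Nat.mul_le_mul_right _ (by omega)).trans hw)
    have h2 : q ^ 10 * q ^ 10 * 3 ≤ q ^ 21 := by
      rw [show q ^ 21 = q ^ 10 * q ^ 10 * q by ring]
      exact Nat.mul_le_mul_left _ hq3
    have h3 : q ^ 10 ≤ q ^ 10 * q ^ 10 := Nat.le_mul_self _
    omega
  obtain ⟨D, L, d, key, K, hlen, hrep⟩ := MinCutOracle.exists_represents (w := w) S hpos hfit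
    (by omega) (by omega) (by omega)
  refine ⟨D, ?_, ?_, ?_⟩
  · rw [hlen]
    calc 8 + 56 * (64 * (S.k * n)) ≤ 3592 * (S.k * n) := by omega
      _ ≤ C * (S.k * n) := Nat.mul_le_mul_right _ (by omega)
  · intro e f hef σ hσ
    obtain ⟨j, τ, hj, h⟩ := hrep.reportsMinCutSize hst hcl e f hef σ hσ
    exact ⟨j, τ, by omega, h⟩
  · intro e f hef σ hσ
    obtain ⟨j, τ, A, hj, h⟩ := hrep.reportsMinCutPartition hst hcl e f hef σ hσ
    exact ⟨j, τ, A, hj.trans (Nat.mul_le_mul_right _ (by omega)), h⟩
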